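/- Let $N\ge 1$, let $S^N$ be the unit sphere of $\mathbb R^{N+1}$ with its surface measure $\sigma$, and let $\Delta_S$ be the Laplace–Beltrami operator of $S^N$. Let $\lambda_k=k(k+N-1)$, $k=0,1,2,\dots$, be the distinct eigenvalues of $-\Delta_S$, let $H_k$ be the (finite-dimensional) eigenspace of $-\Delta_S$ for $\lambda_k$, and for $f\in L_2(S^N)$ (complex-valued) put $$Y_k(f,x)=\sum_{j} Y^{(k)}_j(x)\int_{S^N} f(y)\,Y^{(k)}_j(y)\,d\sigma(y),$$ where $(Y^{(k)}_j)_j$ is any orthonormal basis of $H_k$ consisting of real functions. For $\alpha>0$ define the Riesz means of order $\alpha$ by $$E_\lambda^\alpha f(x)=\sum_{\lambda_k<\lambda}\Bigl(1-\frac{\lambda_k}{\lambda}\Bigr)^{\alpha}Y_k(f,x)\quad(\lambda\ge 0),\qquad E_n^\alpha f(x)=\sum_{k=0}^{n}\Bigl(1-\frac{\lambda_k}{\lambda_n}\Bigr)^{\alpha}Y_k(f,x)\quad(n\ge 1),$$ and the maximal operator by $E_*^\alpha f(x)=\sup_{\lambda\ge 0}|E_\lambda^\alpha f(x)|$. Then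 for every $\alpha>0$ there is a constant $c_\alpha=c_\alpha(N)<\infty$ such that for every $f\in L_2(S^N)$ the function $E_*^\alpha f$ is measurable and $$\|E_*^\alpha f\|_{L_2(S^N)}\le c_\alpha\,\|f\|_{L_2(S^N)}.$$ Consequently, for every $\alpha>0$ and every $f\in L_2(S^N)$, for almost every $x\in S^N$ both $E_\lambda^\alpha f(x)\to f(x)$ as $\lambda\to\infty$ and $E_n^\alpha f(x)\to f(x)$ as $n\to\infty$. -/

import Mathlib

open MeasureTheory Filter Topology Metric
open scoped NNReal ENNReal ContDiff

noncomputable section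

namespace FourierLaplace

/-- The unit sphere `S^N` of `ℝ^{N+1}`. -/
abbrev Sph (N : ℕ) : Type := sphere (0 : EuclideanSpace ℝ (Fin (N + 1))) 1

/-- The surface measure on `S^N`. -/
abbrev σ (N : ℕ) : Measure (Sph N) :=
  (volume : Measure (EuclideanSpace ℝ (Fin (N + 1)))).toSphere

/-- The extension of `u : S^N → ℝ` to `ℝ^{N+1} ∖ {0}` that is constant along rays,
`x ↦ u (x / |x|)` (with the value `0` at the origin). -/
def radialExt {N : ℕ} (u : Sph N → ℝ) (x : EuclideanSpace ℝ (Fin (N + 1))) : ℝ :=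
  if h : x ≠ 0 then
    u ⟨‖x‖⁻¹ • x, by simp [norm_smul, inv_mul_cancel₀ (norm_ne_zero_iff.mpr h)]⟩
  else 0

/-- `u` is a smooth function on the sphere. -/
def SmoothOnSphere {N : ℕ} (u : Sph N → ℝ) : Prop :=
  ContDiffOn ℝ ∞ (radialExt u) {0}ᶜ

/-- The Laplace–Beltrami operator `Δ_S` of the sphere: the Euclidean Laplacian of the
extension constant along rays, restricted to the sphere. -/
def sphLaplacian {N : ℕ} (u : Sph N → ℝ) (x : Sph N) : ℝ :=
  Laplacian.laplacian (radialExt u) (x : EuclideanSpace ℝ (Fin (N + 1)))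

/-- The distinct eigenvalues `λ_k = k (k + N - 1)` of `-Δ_S`. -/
def eigenvalue (N k : ℕ) : ℝ := (k : ℝ) * ((k : ℝ) + (N : ℝ) - 1)

theorem radialExt_add {N : ℕ} (u v : Sph N → ℝ) :
    radialExt (u + v) = radialExt u + radialExt v := by
  funext x
  by_cases h : x = 0 <;> simp [radialExt, h]

theorem radialExt_smul {N : ℕ} (c : ℝ) (u : Sph N → ℝ) :
    radialExt (c • u) = c • radialExt u := by
  funext x
  by_cases h : x = 0 <;> simp [radialExt, h]

theorem radialExt_zero {N : ℕ} : radialExt (0 : Sph N → ℝ) = 0 := by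
  funext x
  by_cases h : x = 0 <;> simp [radialExt, h]

theorem SmoothOnSphere.contDiffAt {N : ℕ} {u : Sph N → ℝ} (hu : SmoothOnSphere u)
    (x : Sph N) :
    ContDiffAt ℝ 2 (radialExt u) (x : EuclideanSpace ℝ (Fin (N + 1))) := by
  have hx : (x : EuclideanSpace ℝ (Fin (N + 1))) ≠ 0 := ne_zero_of_mem_unit_sphere x
  exact (ContDiffOn.contDiffAt hu (isOpen_compl_singleton.mem_nhds hx)).of_le
    (WithTop.coe_le_coe.2 le_top)

/-- The space `H_k` of spherical harmonics of degree `k`: the eigenspace of `-Δ_S` for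
the eigenvalue `λ_k`. -/
def harmonics (N k : ℕ) : Submodule ℝ (Sph N → ℝ) where
  carrier := {u | SmoothOnSphere u ∧ ∀ x, -sphLaplacian u x = eigenvalue N k * u x}
  zero_mem' := by
    refine ⟨?_, fun x => ?_⟩
    · unfold SmoothOnSphere
      rw [radialExt_zero]
      exact contDiffOn_const
    · have h := InnerProductSpace.laplacian_smul (0 : ℝ)
        (SmoothOnSphere.contDiffAt (u := (0 : Sph N → ℝ)) (by
          unfold SmoothOnSphere
          rw [radialExt_zero]
          exact contDiffOn_const) x)
      rw [zero_smul, zero_smul] at h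
      simp only [sphLaplacian, radialExt_zero] at *
      simp [h]
  add_mem' := by
    rintro u v ⟨hu, hu'⟩ ⟨hv, hv'⟩
    refine ⟨?_, fun x => ?_⟩
    · unfold SmoothOnSphere
      rw [radialExt_add]
      exact ContDiffOn.add hu hv
    · have h := (hu.contDiffAt x).laplacian_add (hv.contDiffAt x)
      have h1 := hu' x
      have h2 := hv' x
      simp only [sphLaplacian, radialExt_add, Pi.add_apply] at *
      rw [h]
      linarith
  smul_mem' := by
    rintro c u ⟨hu, hu'⟩
    refine ⟨?_, fun x => ?_⟩
    · unfold SmoothOnSphere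
      rw [radialExt_smul]
      exact ContDiffOn.const_smul c hu
    · have h := InnerProductSpace.laplacian_smul c (hu.contDiffAt x)
      have h1 := hu' x
      simp only [sphLaplacian, radialExt_smul, Pi.smul_apply, smul_eq_mul] at *
      rw [h]
      linear_combination c * h1

/-- `Y_1, …, Y_m` is an orthonormal basis of `H_k`, for the inner product of `L_2(S^N)`. -/
structure IsHarmonicBasis (N k m : ℕ) (Y : Fin m → Sph N → ℝ) : Prop where
  mem : ∀ j, Y j ∈ harmonics N k
  orthonormal : ∀ i j, ∫ y, Y i y * Y j y ∂(σ N) = if i = j then 1 else 0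
  span : harmonics N k ≤ Submodule.span ℝ (Set.range Y)

/-- The sum `∑_j Y_j(x) ∫ f(y) Y_j(y) dσ(y)`. -/
def fourierSum {N m : ℕ} (Y : Fin m → Sph N → ℝ) (f : Sph N → ℂ) (x : Sph N) : ℂ :=
  ∑ j, (Y j x : ℂ) * ∫ y, f y * (Y j y : ℂ) ∂(σ N)

open Classical in
/-- The component `Y_k(f, x) = ∑_j Y_j^{(k)}(x) ∫ f(y) Y_j^{(k)}(y) dσ(y)` of the
Fourier–Laplace series of `f`, where `Y_1^{(k)}, Y_2^{(k)}, …` is an orthonormal basis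
of `H_k`. By `component_eq` below it does not depend on the basis. (The value `0` is
given in the case, which does not occur, that `H_k` has no finite orthonormal basis.) -/
def component (N k : ℕ) (f : Sph N → ℂ) (x : Sph N) : ℂ :=
  if h : ∃ (m : ℕ) (Y : Fin m → Sph N → ℝ), IsHarmonicBasis N k m Y then
    fourierSum h.choose_spec.choose f x
  else 0

theorem continuous_of_mem_harmonics {N k : ℕ} {u : Sph N → ℝ} (hu : u ∈ harmonics N k) :
    Continuous u := by
  have h1 : ContinuousOn (radialExt u) {0}ᶜ := ContDiffOn.continuousOn hu.1
  have h2 : u = fun x : Sph N => radialExt u (x : EuclideanSpace ℝ (Fin (N + 1))) := by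
    funext x
    have hx : (x : EuclideanSpace ℝ (Fin (N + 1))) ≠ 0 := ne_zero_of_mem_unit_sphere x
    simp [radialExt, hx]
  rw [h2]
  exact h1.comp_continuous continuous_subtype_val fun x => ne_zero_of_mem_unit_sphere x

theorem integrable_mul_of_mem_harmonics {N k : ℕ} {u : Sph N → ℝ}
    (hu : u ∈ harmonics N k) {f : Sph N → ℂ} (hf : MemLp f 2 (σ N)) :
    Integrable (fun y => f y * (u y : ℂ)) (σ N) := by
  have hc : Continuous fun y => (u y : ℂ) :=
    Complex.continuous_ofReal.comp (continuous_of_mem_harmonics hu)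
  obtain ⟨C, hC⟩ := (isCompact_range hc).isBounded.exists_norm_le
  exact (hf.integrable one_le_two).mul_bdd (c := C) hc.aestronglyMeasurable
    (.of_forall fun y => hC _ ⟨y, rfl⟩)

theorem IsHarmonicBasis.expand {N k m : ℕ} {Y : Fin m → Sph N → ℝ}
    (hY : IsHarmonicBasis N k m Y) {u : Sph N → ℝ} (hu : u ∈ harmonics N k) (x : Sph N) :
    u x = ∑ j, (∫ y, u y * Y j y ∂(σ N)) * Y j x := by
  obtain ⟨c, rfl⟩ := (Submodule.mem_span_range_iff_exists_fun ℝ).mp (hY.span hu)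
  have hint : ∀ i j, Integrable (fun y => Y i y * Y j y) (σ N) := fun i j =>
    ((continuous_of_mem_harmonics (hY.mem i)).mul
      (continuous_of_mem_harmonics (hY.mem j))).integrable_of_hasCompactSupport
        (HasCompactSupport.of_compactSpace _)
  have key : ∀ j, ∫ y, (∑ i, c i • Y i) y * Y j y ∂(σ N) = c j := by
    intro j
    simp only [Finset.sum_apply, Pi.smul_apply, smul_eq_mul, Finset.sum_mul, mul_assoc]
    rw [integral_finsetSum _ fun i _ => (hint i j).const_mul (c i)]
    simp [integral_const_mul, hY.orthonormal]
  simp_rw [key]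
  simp

theorem fourierSum_eq {N k m m' : ℕ} {Y : Fin m → Sph N → ℝ} {Y' : Fin m' → Sph N → ℝ}
    (hY : IsHarmonicBasis N k m Y) (hY' : IsHarmonicBasis N k m' Y')
    {f : Sph N → ℂ} (hf : MemLp f 2 (σ N)) (x : Sph N) :
    fourierSum Y f x = fourierSum Y' f x := by
  set A : Fin m → Fin m' → ℝ := fun i j => ∫ y, Y i y * Y' j y ∂(σ N) with hA
  have h1 : ∀ i z, Y i z = ∑ j, A i j * Y' j z := fun i z => hY'.expand (hY.mem i) z
  have h2 : ∀ j z, Y' j z = ∑ i, A i j * Y i z := fun j z => by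
    rw [hY.expand (hY'.mem j) z]
    simp [hA, mul_comm]
  have h3 : ∀ j, ∫ y, f y * (Y' j y : ℂ) ∂(σ N)
      = ∑ i, (A i j : ℂ) * ∫ y, f y * (Y i y : ℂ) ∂(σ N) := by
    intro j
    have : ∀ y, f y * (Y' j y : ℂ) = ∑ i, (A i j : ℂ) * (f y * (Y i y : ℂ)) := by
      intro y
      rw [h2 j y]
      push_cast
      rw [Finset.mul_sum]
      exact Finset.sum_congr rfl fun i _ => by ring
    simp_rw [this]
    rw [integral_finsetSum _ fun i _ =>
      (integrable_mul_of_mem_harmonics (hY.mem i) hf).const_mul _]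
    simp [integral_const_mul]
  unfold fourierSum
  simp_rw [h3, h1 _ x]
  push_cast
  simp_rw [Finset.sum_mul, Finset.mul_sum]
  rw [Finset.sum_comm]
  exact Finset.sum_congr rfl fun i _ => Finset.sum_congr rfl fun j _ => by ring

/-- `component` can be computed from any orthonormal basis of `H_k`. -/
theorem component_eq {N k m : ℕ} {Y : Fin m → Sph N → ℝ} (hY : IsHarmonicBasis N k m Y)
    {f : Sph N → ℂ} (hf : MemLp f 2 (σ N)) (x : Sph N) :
    component N k f x = ∑ j, (Y j x : ℂ) * ∫ y, f y * (Y j y : ℂ) ∂(σ N) := by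
  have h : ∃ (m : ℕ) (Y : Fin m → Sph N → ℝ), IsHarmonicBasis N k m Y := ⟨m, Y, hY⟩
  rw [component, dif_pos h]
  exact fourierSum_eq h.choose_spec.choose_spec hY hf x

theorem finite_eigenvalue_lt (N : ℕ) (t : ℝ) : {k : ℕ | eigenvalue N k < t}.Finite := by
  refine (Set.finite_Iio (⌈t⌉₊ + 2)).subset fun k hk => ?_
  by_contra hk'
  simp only [Set.mem_Iio, not_lt] at hk'
  have h1 : (⌈t⌉₊ : ℝ) + 2 ≤ k := by exact_mod_cast hk'
  have h2 : t ≤ ⌈t⌉₊ := Nat.le_ceil t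
  have h3 : (0 : ℝ) ≤ ⌈t⌉₊ := Nat.cast_nonneg _
  have h4 : (0 : ℝ) ≤ N := Nat.cast_nonneg _
  have hk2 : (k : ℝ) * ((k : ℝ) + (N : ℝ) - 1) < t := hk
  nlinarith

/-- The Riesz mean of order `α`,
`E_t^α f(x) = ∑_{λ_k < t} (1 - λ_k / t)^α Y_k(f, x)`. -/
def rieszMean (N : ℕ) (α t : ℝ) (f : Sph N → ℂ) (x : Sph N) : ℂ :=
  ∑ k ∈ (finite_eigenvalue_lt N t).toFinset,
    (((1 - eigenvalue N k / t) ^ α : ℝ) : ℂ) * component N k f x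

/-- The Riesz mean `E_n^α f(x) = ∑_{k ≤ n} (1 - λ_k / λ_n)^α Y_k(f, x)` with integer
index `n ≥ 1`. -/
def rieszMeanNat (N : ℕ) (α : ℝ) (n : ℕ) (f : Sph N → ℂ) (x : Sph N) : ℂ :=
  ∑ k ∈ Finset.range (n + 1),
    (((1 - eigenvalue N k / eigenvalue N n) ^ α : ℝ) : ℂ) * component N k f x

theorem eigenvalue_strictMono {N : ℕ} (hN : 1 ≤ N) : StrictMono (eigenvalue N) := by
  refine strictMono_nat_of_lt_succ fun k => ?_
  have h1 : (1 : ℝ) ≤ N := by exact_mod_cast hN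
  have h2 : (0 : ℝ) ≤ k := Nat.cast_nonneg _
  unfold eigenvalue
  push_cast
  nlinarith

/-- `E_n^α = E_t^α` for `t = λ_n`. -/
theorem rieszMeanNat_eq {N : ℕ} (hN : 1 ≤ N) {α : ℝ} (hα : 0 < α) {n : ℕ} (hn : 1 ≤ n)
    (f : Sph N → ℂ) (x : Sph N) :
    rieszMeanNat N α n f x = rieszMean N α (eigenvalue N n) f x := by
  have h0 : (0 : ℝ) < eigenvalue N n := by
    have h := eigenvalue_strictMono hN (show 0 < n by omega)
    simpa [eigenvalue] using h
  have hs : (finite_eigenvalue_lt N (eigenvalue N n)).toFinset = Finset.range n := by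
    ext k
    simp [(eigenvalue_strictMono hN).lt_iff_lt]
  rw [rieszMeanNat, rieszMean, hs, Finset.sum_range_succ, div_self h0.ne', sub_self,
    Real.zero_rpow hα.ne']
  simp

/-- The maximal operator `E_*^α f(x) = sup_{t ≥ 0} |E_t^α f(x)|`, with values in
`[0, ∞]`. -/
def rieszMaximal (N : ℕ) (α : ℝ) (f : Sph N → ℂ) (x : Sph N) : ℝ≥0∞ :=
  ⨆ (t : ℝ) (_ : 0 ≤ t), ‖rieszMean N α t f x‖ₑ

end FourierLaplace

end

noncomputable section

namespace FourierLaplace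

/-! The maximal operator is compared with averages over explicit positive kernels, whose maximal
function is of Hardy–Littlewood type; the error is absorbed by a square function that orthogonality
controls.

The comparison kernels are the powers `(1 + ⟨x, y⟩) ^ n`. The Laplacian maps the power `n + 1` to a
combination of the powers `n + 1` and `n` (`sphLaplacian_zonal`). With Green's identity
(`integral_mul_sphLaplacian_sub`) this recursion yields all the harmonic analysis required: every
power is a finite sum of harmonics, every `H_k` has a finite orthonormal basis, and the normalized
averages multiply `H_k` by `∏_{m > n} (1 - λ_k / λ_m)`. This multiplier is `1 - O(λ_k / n)` for `k ≤
n` and is `O(n / λ_k)`, so the average of degree `⌊u⌋` imitates a smooth cutoff at `λ_k ≈ u`. The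
kernels decrease with the distance to `x`, hence are superpositions of indicators of balls, and the
Besicovitch covering theorem gives a weak type estimate and then the `L_2` bound
(`exists_lintegral_zonalMax_sq_le`).

For `α = 2 β + 1`, a Beta integral writes `E_t^α` as a weighted mean over `0 < u ≤ t` of the means
`E_u^β` (`rieszMean_eq_integral`). Each `E_u^β` is split into the zonal average of degree `⌊u⌋` and
a difference. The first part is bounded by the zonal maximal function. The second is bounded, by
Cauchy–Schwarz and uniformly in `t`, by a square function with respect to `du / u`. Its `L_2` bound
reduces to an estimate of a multiplier integral uniform in `k` (`exists_lintegral_diffMult_sq_le`).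
Both the Cauchy–Schwarz weight and that integral are finite because `β > -1/2`, that is, `α > 0`.

Almost everywhere convergence follows from the maximal inequality and the density of finite sums of
harmonics. -/

/-! ### The Euclidean Laplacian along lines: scaling and product rules. -/

theorem laplacian_eq_sum_deriv_line {E ι : Type*} [NormedAddCommGroup E] [InnerProductSpace ℝ E]
    [FiniteDimensional ℝ E] [Fintype ι] (b : OrthonormalBasis ι ℝ E) {f : E → ℝ} {x : E}
    (hf : ContDiffAt ℝ 2 f x) :
    Laplacian.laplacian f x = ∑ i, deriv (deriv fun t : ℝ => f (x + t • b i)) 0 := by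
  rw [InnerProductSpace.laplacian_eq_iteratedFDeriv_orthonormalBasis f b]
  refine Finset.sum_congr rfl fun i _ => ?_
  rw [iteratedFDeriv_two_apply]
  simp only [Matrix.cons_val_zero, Matrix.cons_val_one]
  have hline : ∀ t : ℝ, HasDerivAt (fun t : ℝ => x + t • b i) (b i) t := fun t => by
    simpa using ((hasDerivAt_id t).smul_const (b i)).const_add x
  have hx0 : x + (0 : ℝ) • b i = x := by simp
  have hcont : Tendsto (fun t : ℝ => x + t • b i) (𝓝 0) (𝓝 x) := by
    have := (hline 0).continuousAt.tendsto
    rwa [hx0] at this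
  have hev : ∀ᶠ y in 𝓝 x, DifferentiableAt ℝ f y :=
    ((hf.of_le one_le_two).eventually (by simp)).mono
      fun y hy => hy.differentiableAt (by simp)
  have h1 : (deriv fun t : ℝ => f (x + t • b i)) =ᶠ[𝓝 0]
      fun t => fderiv ℝ f (x + t • b i) (b i) := by
    filter_upwards [hcont.eventually hev] with t ht
    exact (ht.hasFDerivAt.comp_hasDerivAt t (hline t)).deriv
  rw [h1.deriv_eq]
  have h2 : DifferentiableAt ℝ (fderiv ℝ f) x :=
    (hf.fderiv_right (m := 1) (by norm_num)).differentiableAt (by simp)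
  have h3 : HasDerivAt (fun t : ℝ => fderiv ℝ f (x + t • b i)) (fderiv ℝ (fderiv ℝ f) x (b i)) 0 := by
    have h2' := h2.hasFDerivAt
    rw [← hx0] at h2'
    have := h2'.comp_hasDerivAt (0 : ℝ) (hline 0)
    rwa [hx0] at this
  have h4 := h3.clm_apply (hasDerivAt_const (0 : ℝ) (b i))
  simpa using h4.deriv.symm

/-- Form suited to explicit functions: first derivatives are supplied near `0` on each coordinate
line, second derivatives only at `0`. -/
theorem laplacian_eq_sum_of_hasDerivAt_line {E ι : Type*} [NormedAddCommGroup E]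
    [InnerProductSpace ℝ E] [FiniteDimensional ℝ E] [Fintype ι] (b : OrthonormalBasis ι ℝ E)
    {f : E → ℝ} {x : E} (hf : ContDiffAt ℝ 2 f x) {g : ι → ℝ → ℝ} {d : ι → ℝ}
    (hg : ∀ i, ∀ᶠ t in 𝓝 (0 : ℝ), HasDerivAt (fun t : ℝ => f (x + t • b i)) (g i t) t)
    (hd : ∀ i, HasDerivAt (g i) (d i) 0) :
    Laplacian.laplacian f x = ∑ i, d i := by
  rw [laplacian_eq_sum_deriv_line b hf]
  refine Finset.sum_congr rfl fun i _ => ?_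
  have h : (deriv fun t : ℝ => f (x + t • b i)) =ᶠ[𝓝 0] g i :=
    (hg i).mono fun t ht => ht.deriv
  rw [h.deriv_eq, (hd i).deriv]

theorem laplacian_comp_smul {E : Type*} [NormedAddCommGroup E]
    [InnerProductSpace ℝ E] [FiniteDimensional ℝ E] {f : E → ℝ} {c : ℝ} {x : E}
    (hf : ContDiffAt ℝ 2 f (c • x)) :
    Laplacian.laplacian (fun y => f (c • y)) x = c ^ 2 * Laplacian.laplacian f (c • x) := by
  have hf' : ContDiffAt ℝ 2 (fun y => f (c • y)) x :=
    ContDiffAt.comp x hf (contDiff_const_smul c).contDiffAt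
  rw [laplacian_eq_sum_deriv_line (stdOrthonormalBasis ℝ E) hf',
    laplacian_eq_sum_deriv_line (stdOrthonormalBasis ℝ E) hf, Finset.mul_sum]
  refine Finset.sum_congr rfl fun i _ => ?_
  set h : ℝ → ℝ := fun t => f (c • x + t • stdOrthonormalBasis ℝ E i) with hh
  have h1 : (fun t : ℝ => f (c • (x + t • stdOrthonormalBasis ℝ E i))) = fun t => h (c * t) := by
    funext t
    simp [hh, smul_add, smul_smul]
  have h2 : ∀ k : ℝ → ℝ, deriv (fun t => k (c * t)) = fun t => c * deriv k (c * t) := by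
    intro k
    funext t
    simpa using deriv_comp_mul_left c k t
  rw [h1, h2, deriv_const_mul_field, h2 (deriv h)]
  simp
  ring

theorem laplacian_mul {E : Type*} [NormedAddCommGroup E]
    [InnerProductSpace ℝ E] [FiniteDimensional ℝ E] {f g : E → ℝ} {x : E}
    (hf : ContDiffAt ℝ 2 f x) (hg : ContDiffAt ℝ 2 g x) :
    Laplacian.laplacian (fun y => f y * g y) x
      = f x * Laplacian.laplacian g x + g x * Laplacian.laplacian f x
        + 2 * ∑ i, fderiv ℝ f x (stdOrthonormalBasis ℝ E i)
            * fderiv ℝ g x (stdOrthonormalBasis ℝ E i) := by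
  set b := stdOrthonormalBasis ℝ E
  have line : ∀ i, Tendsto (fun t : ℝ => x + t • b i) (𝓝 0) (𝓝 x) := fun i => by
    have : Continuous fun t : ℝ => x + t • b i := by fun_prop
    simpa using this.tendsto 0
  have hline : ∀ i, ContDiff ℝ 2 fun t : ℝ => x + t • b i := fun i => by fun_prop
  have key : ∀ {k : E → ℝ}, ContDiffAt ℝ 2 k x → ∀ i,
      (∀ᶠ t in 𝓝 (0 : ℝ), HasDerivAt (fun t : ℝ => k (x + t • b i))
        (deriv (fun t : ℝ => k (x + t • b i)) t) t) ∧
      HasDerivAt (deriv (fun t : ℝ => k (x + t • b i)))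
        (deriv (deriv (fun t : ℝ => k (x + t • b i))) 0) 0 ∧
      deriv (fun t : ℝ => k (x + t • b i)) 0 = fderiv ℝ k x (b i) := by
    intro k hk i
    have hx0 : x + (0 : ℝ) • b i = x := by simp
    have hk' : ContDiffAt ℝ 2 k (x + (0 : ℝ) • b i) := by rwa [hx0]
    have h : ContDiffAt ℝ 2 (fun t : ℝ => k (x + t • b i)) 0 :=
      ContDiffAt.comp (0 : ℝ) hk' (hline i).contDiffAt
    refine ⟨((h.of_le one_le_two).eventually (by simp)).mono
      fun y hy => (hy.differentiableAt (by simp)).hasDerivAt, ?_, ?_⟩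
    · have h1 : DifferentiableAt ℝ (fderiv ℝ fun t : ℝ => k (x + t • b i)) 0 :=
        (h.fderiv_right (m := 1) (by norm_num)).differentiableAt (by simp)
      have h2 : (deriv fun t : ℝ => k (x + t • b i))
          = fun s => fderiv ℝ (fun t : ℝ => k (x + t • b i)) s 1 := by
        funext s
        exact fderiv_apply_one_eq_deriv.symm
      rw [h2]
      exact (h1.clm_apply (differentiableAt_const _)).hasDerivAt
    · have h2 := hk'.differentiableAt (by simp)
      have hl : HasDerivAt (fun t : ℝ => x + t • b i) (b i) 0 := by
        simpa using ((hasDerivAt_id (0 : ℝ)).smul_const (b i)).const_add x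
      have := (h2.hasFDerivAt.comp_hasDerivAt (0 : ℝ) hl).deriv
      rw [hx0] at this
      exact this
  rw [laplacian_eq_sum_of_hasDerivAt_line b (hf.mul hg)
    (g := fun i t => deriv (fun t : ℝ => f (x + t • b i)) t * g (x + t • b i)
      + f (x + t • b i) * deriv (fun t : ℝ => g (x + t • b i)) t)
    (fun i => by
      filter_upwards [(key hf i).1, (key hg i).1] with t h1 h2 using h1.mul h2)
    (fun i => ((key hf i).2.1.mul (key hg i).1.self_of_nhds).add
      ((key hf i).1.self_of_nhds.mul (key hg i).2.1)),
    laplacian_eq_sum_deriv_line b hf, laplacian_eq_sum_deriv_line b hg]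
  simp only [(key hf _).2.2, (key hg _).2.2, zero_smul, add_zero]
  rw [Finset.mul_sum, Finset.mul_sum, Finset.mul_sum, ← Finset.sum_add_distrib,
    ← Finset.sum_add_distrib]
  exact Finset.sum_congr rfl fun i _ => by ring

/-! ### Zonal powers and the recursion for their Laplacians. -/

theorem radialExt_apply {N : ℕ} (u : Sph N → ℝ) {x : EuclideanSpace ℝ (Fin (N + 1))} (h : x ≠ 0) :
    radialExt u x
      = u ⟨‖x‖⁻¹ • x, by simp [norm_smul, inv_mul_cancel₀ (norm_ne_zero_iff.mpr h)]⟩ := by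
  rw [radialExt, dif_pos h]

theorem radialExt_smul_arg {N : ℕ} (u : Sph N → ℝ) {c : ℝ} (hc : 0 < c)
    (x : EuclideanSpace ℝ (Fin (N + 1))) : radialExt u (c • x) = radialExt u x := by
  by_cases h : x = 0
  · simp [h]
  · rw [radialExt_apply u h, radialExt_apply u (smul_ne_zero hc.ne' h)]
    congr 2
    rw [norm_smul, Real.norm_of_nonneg hc.le, smul_smul]
    congr 1
    field_simp

/-- The function `y ↦ (1 + ⟨a, y⟩) ^ m` on the sphere. -/
def zonal {N : ℕ} (a : Sph N) (m : ℕ) (y : Sph N) : ℝ :=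
  (1 + inner ℝ (a : EuclideanSpace ℝ (Fin (N + 1))) (y : EuclideanSpace ℝ (Fin (N + 1)))) ^ m

theorem radialExt_zonal {N : ℕ} (a : Sph N) (m : ℕ) {x : EuclideanSpace ℝ (Fin (N + 1))}
    (h : x ≠ 0) :
    radialExt (zonal a m) x
      = (1 + inner ℝ (a : EuclideanSpace ℝ (Fin (N + 1))) x / ‖x‖) ^ m := by
  rw [radialExt_apply _ h, zonal, inner_smul_right, inv_mul_eq_div]

theorem smoothOnSphere_zonal {N : ℕ} (a : Sph N) (m : ℕ) : SmoothOnSphere (zonal a m) := by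
  have h : ContDiffOn ℝ ∞ (fun x : EuclideanSpace ℝ (Fin (N + 1)) =>
      (1 + inner ℝ (a : EuclideanSpace ℝ (Fin (N + 1))) x / ‖x‖) ^ m) {0}ᶜ := by
    refine ContDiffOn.pow (contDiffOn_const.add (ContDiffOn.div ?_ ?_ ?_)) m
    · exact (contDiff_const.inner ℝ contDiff_id).contDiffOn
    · exact fun x hx => (contDiffAt_id.norm ℝ hx).contDiffWithinAt
    · exact fun x hx => norm_ne_zero_iff.mpr hx
  exact h.congr fun x hx => radialExt_zonal a m hx

theorem norm_line_sq {E : Type*} [NormedAddCommGroup E] [InnerProductSpace ℝ E] {x e : E}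
    (hx : ‖x‖ = 1) (he : ‖e‖ = 1) (t : ℝ) :
    ‖x + t • e‖ ^ 2 = 1 + 2 * t * inner ℝ x e + t ^ 2 := by
  rw [norm_add_sq_real, inner_smul_right, norm_smul, hx, he]
  simp
  ring

theorem hasDerivAt_norm_line {E : Type*} [NormedAddCommGroup E] [InnerProductSpace ℝ E] {x e : E}
    (hx : ‖x‖ = 1) (he : ‖e‖ = 1) {t : ℝ} (ht : x + t • e ≠ 0) :
    HasDerivAt (fun t : ℝ => ‖x + t • e‖) ((inner ℝ x e + t) / ‖x + t • e‖) t := by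
  have h0 : ‖x + t • e‖ ≠ 0 := norm_ne_zero_iff.mpr ht
  have h1 : HasDerivAt (fun t : ℝ => 1 + 2 * t * inner ℝ x e + t ^ 2)
      (2 * inner ℝ x e + 2 * t) t := by
    have := ((((hasDerivAt_id t).const_mul 2).mul_const (inner ℝ x e)).const_add 1).add
      ((hasDerivAt_id t).pow 2)
    refine this.congr_deriv ?_
    simp
  have h2 := h1.sqrt (by rw [← norm_line_sq hx he t]; exact pow_ne_zero 2 h0)
  have h3 : (fun t : ℝ => ‖x + t • e‖) = fun t => √(1 + 2 * t * inner ℝ x e + t ^ 2) := by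
    funext s
    rw [← norm_line_sq hx he s, Real.sqrt_sq (norm_nonneg _)]
  rw [h3]
  convert h2 using 1
  rw [← norm_line_sq hx he t, Real.sqrt_sq (norm_nonneg _)]
  field_simp

/-- On functions `g (p)` of `p = ⟨a, y⟩` the operator `Δ_S` is `(1 - p²) g'' - N p g'`. For `g = (1
+ p) ^ (m + 1)` the factor `1 - p² = (1 + p) (2 - (1 + p))` leaves only the powers `m + 1` and `m`.
-/
theorem sphLaplacian_zonal {N : ℕ} (a : Sph N) (m : ℕ) (y : Sph N) :
    -sphLaplacian (zonal a (m + 1)) y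
      = eigenvalue N (m + 1) * zonal a (m + 1) y - (m + 1) * (2 * m + N) * zonal a m y := by
  set b := EuclideanSpace.basisFun (Fin (N + 1)) ℝ
  set A : EuclideanSpace ℝ (Fin (N + 1)) := (a : EuclideanSpace ℝ (Fin (N + 1))) with hA
  set x : EuclideanSpace ℝ (Fin (N + 1)) := (y : EuclideanSpace ℝ (Fin (N + 1))) with hxdef
  have hx : ‖x‖ = 1 := by simp [hxdef]
  have ha : ‖A‖ = 1 := by simp [hA]
  have hb : ∀ i, ‖b i‖ = 1 := fun i => b.orthonormal.1 i
  have hx0 : x ≠ 0 := ne_zero_of_mem_unit_sphere y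
  set p : ℝ := inner ℝ A x with hp
  have hne : ∀ i, ∀ᶠ t in 𝓝 (0 : ℝ), x + t • b i ≠ 0 := fun i => by
    have h : Continuous fun t : ℝ => x + t • b i := by fun_prop
    exact (h.tendsto 0).eventually (by simpa using eventually_ne_nhds hx0)
  -- the function `⟨a, ·⟩ / ‖·‖` along a line
  set φ : Fin (N + 1) → ℝ → ℝ := fun i t => (p + t * inner ℝ A (b i)) / ‖x + t • b i‖ with hφ
  set φ' : Fin (N + 1) → ℝ → ℝ := fun i t => inner ℝ A (b i) / ‖x + t • b i‖
    - (p + t * inner ℝ A (b i)) * (inner ℝ x (b i) + t) / ‖x + t • b i‖ ^ 3 with hφ'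
  have hd1 : ∀ i t, x + t • b i ≠ 0 → HasDerivAt (φ i) (φ' i t) t := by
    intro i t ht
    have h0 : ‖x + t • b i‖ ≠ 0 := norm_ne_zero_iff.mpr ht
    have h := ((((hasDerivAt_id t).mul_const (inner ℝ A (b i))).const_add p).div
      (hasDerivAt_norm_line hx (hb i) ht) h0)
    refine h.congr_deriv ?_
    simp only [hφ', id]
    field_simp
  have hd2 : ∀ i, HasDerivAt (φ' i)
      (-2 * inner ℝ A (b i) * inner ℝ x (b i) + p * (3 * inner ℝ x (b i) ^ 2 - 1)) 0 := by
    intro i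
    have h00 : x + (0 : ℝ) • b i ≠ 0 := by simpa using hx0
    have h0 : ‖x + (0 : ℝ) • b i‖ ≠ 0 := norm_ne_zero_iff.mpr h00
    have hn := hasDerivAt_norm_line hx (hb i) h00
    have h1 := (hasDerivAt_const (0 : ℝ) (inner ℝ A (b i) : ℝ)).div hn h0
    have h2 := ((((hasDerivAt_id (0 : ℝ)).mul_const (inner ℝ A (b i))).const_add p).mul
      ((hasDerivAt_id (0 : ℝ)).const_add (inner ℝ x (b i)))).div (hn.pow 3) (pow_ne_zero 3 h0)
    refine (h1.sub h2).congr_deriv ?_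
    simp [hx]
    ring
  have hdz : ∀ i, ∀ᶠ t in 𝓝 (0 : ℝ), HasDerivAt
      (fun t : ℝ => radialExt (zonal a (m + 1)) (x + t • b i))
      ((m + 1) * (1 + φ i t) ^ m * φ' i t) t := by
    intro i
    filter_upwards [(hne i).eventually_nhds] with t ht
    have h := (((hd1 i t ht.self_of_nhds).const_add 1).pow (m + 1))
    refine HasDerivAt.congr_of_eventuallyEq (h.congr_deriv ?_) ?_
    · simp
    · filter_upwards [ht] with s hs
      rw [radialExt_zonal a _ hs, inner_add_right, inner_smul_right]
      rfl
  have hdz2 : ∀ i, HasDerivAt (fun t => (m + 1) * (1 + φ i t) ^ m * φ' i t)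
      ((m + 1) * (m * (1 + p) ^ (m - 1)) * (inner ℝ A (b i) - p * inner ℝ x (b i)) ^ 2
        + (m + 1) * (1 + p) ^ m * (-2 * inner ℝ A (b i) * inner ℝ x (b i)
          + p * (3 * inner ℝ x (b i) ^ 2 - 1))) 0 := by
    intro i
    have h := (((((hd1 i 0 (by simpa using hx0)).const_add 1).pow m).const_mul ((m : ℝ) + 1))).mul
      (hd2 i)
    refine h.congr_deriv ?_
    simp [hφ, hφ', hx]
    ring
  have hL := laplacian_eq_sum_of_hasDerivAt_line b ((smoothOnSphere_zonal a (m + 1)).contDiffAt y)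
    hdz hdz2
  have s1 : ∑ i, inner ℝ A (b i) * inner ℝ x (b i) = p := by
    rw [hp, ← b.sum_inner_mul_inner A x]
    exact Finset.sum_congr rfl fun i _ => by rw [real_inner_comm (b i) x]
  have s2 : ∑ i, inner ℝ A (b i) ^ 2 = 1 := by
    have h := b.sum_inner_mul_inner A A
    rw [real_inner_self_eq_norm_sq, ha, one_pow] at h
    rw [← h]
    exact Finset.sum_congr rfl fun i _ => by rw [real_inner_comm (b i) A, sq]
  have s3 : ∑ i, inner ℝ x (b i) ^ 2 = 1 := by
    have h := b.sum_inner_mul_inner x x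
    rw [real_inner_self_eq_norm_sq, hx, one_pow] at h
    rw [← h]
    exact Finset.sum_congr rfl fun i _ => by rw [real_inner_comm (b i) x, sq]
  have s4 : ∑ i : Fin (N + 1), (1 : ℝ) = N + 1 := by simp
  -- By Parseval the squares `(⟨A, e_i⟩ - p ⟨x, e_i⟩)²` add up to `1 - p²`, and the second-order
  -- terms to `-2p + 3p - (N + 1) p = -N p`.
  have hsum : ∑ i, ((m + 1) * (m * (1 + p) ^ (m - 1))
          * (inner ℝ A (b i) - p * inner ℝ x (b i)) ^ 2
        + (m + 1) * (1 + p) ^ m * (-2 * inner ℝ A (b i) * inner ℝ x (b i)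
          + p * (3 * inner ℝ x (b i) ^ 2 - 1)))
      = (m + 1) * (m * (1 + p) ^ (m - 1)) * (1 - p ^ 2)
        + (m + 1) * (1 + p) ^ m * (-(N * p)) := by
    have e : ∀ i, ((m + 1) * (m * (1 + p) ^ (m - 1))
          * (inner ℝ A (b i) - p * inner ℝ x (b i)) ^ 2
        + (m + 1) * (1 + p) ^ m * (-2 * inner ℝ A (b i) * inner ℝ x (b i)
          + p * (3 * inner ℝ x (b i) ^ 2 - 1)))
        = (m + 1) * (m * (1 + p) ^ (m - 1)) * inner ℝ A (b i) ^ 2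
          + (-2 * p * ((m + 1) * (m * (1 + p) ^ (m - 1))) - 2 * ((m + 1) * (1 + p) ^ m))
            * (inner ℝ A (b i) * inner ℝ x (b i))
          + (p ^ 2 * ((m + 1) * (m * (1 + p) ^ (m - 1))) + 3 * p * ((m + 1) * (1 + p) ^ m))
            * inner ℝ x (b i) ^ 2
          + (-(p * ((m + 1) * (1 + p) ^ m))) * 1 := fun i => by ring
    simp_rw [e]
    rw [Finset.sum_add_distrib, Finset.sum_add_distrib, Finset.sum_add_distrib,
      ← Finset.mul_sum, ← Finset.mul_sum, ← Finset.mul_sum, ← Finset.mul_sum, s1, s2, s3, s4]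
    ring
  rw [sphLaplacian, hL, hsum, eigenvalue, zonal, zonal]
  change _ = _ * (1 + p) ^ (m + 1) - _ * (1 + p) ^ m
  -- For `m = 0` the truncated exponent `m - 1` is harmless: its term carries the factor `m`.
  cases m with
  | zero =>
    simp
    ring
  | succ m =>
    simp only [Nat.add_sub_cancel]
    push_cast
    ring

/-! ### Green's identity on the sphere, by a radial cutoff in Euclidean space. -/

/-- A smooth bump function of the radius, supported in `1/2 ≤ |t| ≤ 3/2`. -/
def radiusBump : ContDiffBump (1 : ℝ) := ⟨1 / 4, 1 / 2, by norm_num, by norm_num⟩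

/-- The radial cutoff function `x ↦ χ (|x|²)`. -/
def radialCutoff {E : Type*} [NormedAddCommGroup E] (x : E) : ℝ := radiusBump (‖x‖ ^ 2)

theorem contDiff_radialCutoff {E : Type*} [NormedAddCommGroup E] [InnerProductSpace ℝ E] :
    ContDiff ℝ ∞ (radialCutoff : E → ℝ) :=
  radiusBump.contDiff.comp (contDiff_norm_sq ℝ)

theorem radialCutoff_eq_zero {E : Type*} [NormedAddCommGroup E] {x : E}
    (h : 1 / 2 ≤ |‖x‖ ^ 2 - 1|) : radialCutoff x = 0 :=
  radiusBump.zero_of_le_dist h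

theorem radialCutoff_eventually_eq_zero {E : Type*} [NormedAddCommGroup E] :
    ∀ᶠ x : E in 𝓝 0, radialCutoff x = 0 := by
  filter_upwards [Metric.ball_mem_nhds (0 : E) (show (0 : ℝ) < 1 / 2 by norm_num)] with x hx
  rw [mem_ball_zero_iff] at hx
  refine radialCutoff_eq_zero ?_
  rw [abs_sub_comm, abs_of_nonneg (by nlinarith [norm_nonneg x])]
  nlinarith [norm_nonneg x]

theorem hasCompactSupport_radialCutoff {E : Type*} [NormedAddCommGroup E] [ProperSpace E] :
    HasCompactSupport (radialCutoff : E → ℝ) := by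
  refine HasCompactSupport.of_support_subset_isCompact (isCompact_closedBall 0 2) fun x hx => ?_
  by_contra h
  rw [mem_closedBall_zero_iff, not_le] at h
  refine hx (radialCutoff_eq_zero ?_)
  rw [abs_of_nonneg (by nlinarith [norm_nonneg x])]
  nlinarith [norm_nonneg x]

/-- The cutoff vanishes near the origin, so a singularity of `f` there does no harm. -/
theorem contDiff_radialCutoff_mul {E : Type*} [NormedAddCommGroup E] [InnerProductSpace ℝ E]
    {f : E → ℝ} (hf : ContDiffOn ℝ ∞ f {0}ᶜ) :
    ContDiff ℝ ∞ fun x => radialCutoff x * f x := by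
  rw [contDiff_iff_contDiffAt]
  intro x
  by_cases hx : x = 0
  · subst hx
    refine (contDiffAt_const (c := (0 : ℝ))).congr_of_eventuallyEq ?_
    filter_upwards [radialCutoff_eventually_eq_zero (E := E)] with y hy
    rw [hy, zero_mul]
  · exact contDiff_radialCutoff.contDiffAt.mul
      (hf.contDiffAt (isOpen_compl_singleton.mem_nhds hx))

theorem fderiv_radialExt_self {N : ℕ} {u : Sph N → ℝ} (hu : SmoothOnSphere u)
    {x : EuclideanSpace ℝ (Fin (N + 1))} (hx : x ≠ 0) : fderiv ℝ (radialExt u) x x = 0 := by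
  have h1 : DifferentiableAt ℝ (radialExt u) x :=
    (ContDiffOn.contDiffAt hu (isOpen_compl_singleton.mem_nhds hx)).differentiableAt (by simp)
  have h2 : HasDerivAt (fun t : ℝ => t • x) x 1 := by
    simpa using (hasDerivAt_id (1 : ℝ)).smul_const x
  have h1' : HasFDerivAt (radialExt u) (fderiv ℝ (radialExt u) x) ((1 : ℝ) • x) := by
    rw [one_smul]
    exact h1.hasFDerivAt
  have h3 := h1'.comp_hasDerivAt (1 : ℝ) h2
  have h4 : (radialExt u ∘ fun t : ℝ => t • x) =ᶠ[𝓝 1] fun _ => radialExt u x := by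
    filter_upwards [lt_mem_nhds (zero_lt_one (α := ℝ))] with t ht
    exact radialExt_smul_arg u ht x
  exact h3.unique ((hasDerivAt_const (1 : ℝ) _).congr_of_eventuallyEq h4)

/-- The gradient of the cutoff is radial, whereas a function constant along rays has tangential
gradient. This removes the cross term of the product rule. -/
theorem sum_fderiv_radialCutoff_mul {N : ℕ} {u : Sph N → ℝ} (hu : SmoothOnSphere u)
    {x : EuclideanSpace ℝ (Fin (N + 1))} (hx : x ≠ 0) :
    ∑ i, fderiv ℝ (radialCutoff : EuclideanSpace ℝ (Fin (N + 1)) → ℝ) x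
        (stdOrthonormalBasis ℝ _ i) * fderiv ℝ (radialExt u) x (stdOrthonormalBasis ℝ _ i)
      = 0 := by
  set b := stdOrthonormalBasis ℝ (EuclideanSpace ℝ (Fin (N + 1)))
  have h1 : HasFDerivAt (fun y : EuclideanSpace ℝ (Fin (N + 1)) => ‖y‖ ^ 2)
      (2 • innerSL ℝ x) x := (hasStrictFDerivAt_norm_sq x).hasFDerivAt
  have h2 : HasDerivAt radiusBump (deriv radiusBump (‖x‖ ^ 2)) (‖x‖ ^ 2) :=
    ((radiusBump.contDiff (n := 1)).differentiable (by simp) _).hasDerivAt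
  have h3 := (h2.comp_hasFDerivAt x h1).fderiv
  have h4 : ∀ v, fderiv ℝ (radialCutoff : EuclideanSpace ℝ (Fin (N + 1)) → ℝ) x v
      = 2 * deriv radiusBump (‖x‖ ^ 2) * inner ℝ x v := by
    intro v
    have : (radialCutoff : EuclideanSpace ℝ (Fin (N + 1)) → ℝ)
      = radiusBump ∘ fun y => ‖y‖ ^ 2 := rfl
    rw [this, h3]
    simp
    ring
  simp_rw [h4, mul_assoc]
  rw [← Finset.mul_sum, ← Finset.mul_sum]
  have h5 : ∑ i, inner ℝ x (b i) * fderiv ℝ (radialExt u) x (b i)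
      = fderiv ℝ (radialExt u) x x := by
    generalize fderiv ℝ (radialExt u) x = L
    conv_rhs => rw [← b.sum_repr' x]
    rw [map_sum]
    refine Finset.sum_congr rfl fun i _ => ?_
    rw [map_smul, smul_eq_mul, real_inner_comm]
  rw [h5, fderiv_radialExt_self hu hx]
  ring

/-- The extension is homogeneous of degree `0`, so its Laplacian is homogeneous of degree `-2`. -/
theorem laplacian_radialExt {N : ℕ} {u : Sph N → ℝ} (hu : SmoothOnSphere u)
    {x : EuclideanSpace ℝ (Fin (N + 1))} (hx : x ≠ 0) :
    Laplacian.laplacian (radialExt u) x = (‖x‖ ^ 2)⁻¹ * radialExt (sphLaplacian u) x := by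
  have hn : 0 < ‖x‖⁻¹ := inv_pos.mpr (norm_pos_iff.mpr hx)
  have h1 : radialExt u = fun y => radialExt u (‖x‖⁻¹ • y) := by
    funext y
    rw [radialExt_smul_arg u hn]
  have h2 : ContDiffAt ℝ 2 (radialExt u) (‖x‖⁻¹ • x) :=
    (ContDiffOn.contDiffAt hu (isOpen_compl_singleton.mem_nhds
      (smul_ne_zero hn.ne' hx))).of_le (WithTop.coe_le_coe.2 le_top)
  rw [h1, laplacian_comp_smul h2, radialExt_apply _ hx, sphLaplacian, inv_pow]

theorem laplacian_radialCutoff_mul {N : ℕ} {u : Sph N → ℝ} (hu : SmoothOnSphere u)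
    {x : EuclideanSpace ℝ (Fin (N + 1))} (hx : x ≠ 0) :
    Laplacian.laplacian (fun y => radialCutoff y * radialExt u y) x
      = radialCutoff x * ((‖x‖ ^ 2)⁻¹ * radialExt (sphLaplacian u) x)
        + radialExt u x * Laplacian.laplacian
            (radialCutoff : EuclideanSpace ℝ (Fin (N + 1)) → ℝ) x := by
  rw [laplacian_mul ((contDiff_radialCutoff.contDiffAt).of_le (WithTop.coe_le_coe.2 le_top))
    ((ContDiffOn.contDiffAt hu (isOpen_compl_singleton.mem_nhds hx)).of_le
      (WithTop.coe_le_coe.2 le_top)), sum_fderiv_radialCutoff_mul hu hx, laplacian_radialExt hu hx]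
  ring

/-- Polar coordinates. Integrability is not required, since the integral of a product function over
a product measure always factors. -/
theorem integral_radial_mul {N : ℕ} (φ : ℝ → ℝ) (w : Sph N → ℝ) :
    ∫ x : EuclideanSpace ℝ (Fin (N + 1)), φ ‖x‖ * radialExt w x
      = (∫ y, w y ∂(σ N)) * ∫ r : Set.Ioi (0 : ℝ), φ r ∂(Measure.volumeIoiPow N) := by
  set E := EuclideanSpace ℝ (Fin (N + 1))
  have hdim : Module.finrank ℝ E - 1 = N := by simp [E]
  have h := (volume : Measure E).measurePreserving_homeomorphUnitSphereProd.integral_comp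
    (Homeomorph.measurableEmbedding _) (fun z : sphere (0 : E) 1 × Set.Ioi (0 : ℝ) => w z.1 * φ z.2)
  rw [integral_prod_mul w fun r : Set.Ioi (0 : ℝ) => φ r, hdim] at h
  have h' := integral_subtype_comap (μ := (volume : Measure E))
    (measurableSet_singleton (0 : E)).compl fun x : E => φ ‖x‖ * radialExt w x
  rw [restrict_compl_singleton] at h'
  rw [← h, ← h']
  refine integral_congr_ae (.of_forall fun x => ?_)
  have hx : (x : E) ≠ 0 := x.2
  simp only
  rw [radialExt_apply w hx, mul_comm]
  congr 2
  · exact Subtype.ext (homeomorphUnitSphereProd_apply_fst_coe E x).symm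
  · exact (homeomorphUnitSphereProd_apply_snd_coe E x).symm

/-- This is the radial factor that must be cancelled in Green's identity. Polar coordinates identify
it, up to the mass of the sphere, with the integral of a nonnegative continuous function that is
positive on unit vectors. -/
theorem radial_integral_cutoff_ne_zero (N : ℕ) :
    ∫ r : Set.Ioi (0 : ℝ), radiusBump ((r : ℝ) ^ 2) * (radiusBump ((r : ℝ) ^ 2) * ((r : ℝ) ^ 2)⁻¹)
      ∂(Measure.volumeIoiPow N) ≠ 0 := by
  set E := EuclideanSpace ℝ (Fin (N + 1))
  have h := integral_radial_mul (N := N)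
    (fun r => radiusBump (r ^ 2) * (radiusBump (r ^ 2) * (r ^ 2)⁻¹)) (fun _ => 1)
  have h1 : ∫ x : E, radialCutoff x * (radialCutoff x * (‖x‖ ^ 2)⁻¹)
      = ∫ x : E, (radiusBump (‖x‖ ^ 2) * (radiusBump (‖x‖ ^ 2) * (‖x‖ ^ 2)⁻¹))
        * radialExt (N := N) (fun _ => 1) x := by
    refine integral_congr_ae (.of_forall fun x => ?_)
    simp only [radialCutoff]
    by_cases hx : x = 0
    · simp [hx]
    · rw [radialExt_apply _ hx, mul_one]
  have hc : Continuous fun x : E => radialCutoff x * (radialCutoff x * (‖x‖ ^ 2)⁻¹) := by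
    refine (contDiff_radialCutoff_mul (ContDiffOn.mul contDiff_radialCutoff.contDiffOn
      (ContDiffOn.inv (contDiff_norm_sq ℝ).contDiffOn fun x hx => ?_))).continuous
    exact pow_ne_zero 2 (norm_ne_zero_iff.mpr hx)
  obtain ⟨e, he⟩ : ∃ e : E, ‖e‖ = 1 := ⟨EuclideanSpace.single 0 1, by
    rw [PiLp.norm_single, norm_one]⟩
  have hpos : 0 < ∫ x : E, radialCutoff x * (radialCutoff x * (‖x‖ ^ 2)⁻¹) := by
    refine hc.integral_pos_of_hasCompactSupport_nonneg_nonzero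
      hasCompactSupport_radialCutoff.mul_right (fun x => ?_) (x := e) ?_
    · rw [← mul_assoc]
      exact mul_nonneg (mul_self_nonneg _) (by positivity)
    · have : radialCutoff e = 1 := by
        rw [radialCutoff, he]
        exact radiusBump.one_of_mem_closedBall (by simp [radiusBump])
      simp [this, he]
  rw [h1, h] at hpos
  intro h0
  rw [h0, mul_zero] at hpos
  exact hpos.false

/-- Green's identity on the sphere. -/
theorem integral_mul_sphLaplacian_sub {N : ℕ} {u v : Sph N → ℝ} (hu : SmoothOnSphere u)
    (hv : SmoothOnSphere v) :
    ∫ y, (u y * sphLaplacian v y - v y * sphLaplacian u y) ∂(σ N) = 0 := by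
  set E := EuclideanSpace ℝ (Fin (N + 1))
  set F : SchwartzMap E ℝ := (hasCompactSupport_radialCutoff.mul_right).toSchwartzMap
    (contDiff_radialCutoff_mul hu) with hF
  set G : SchwartzMap E ℝ := (hasCompactSupport_radialCutoff.mul_right).toSchwartzMap
    (contDiff_radialCutoff_mul hv) with hG
  have hF' : (F : E → ℝ) = fun x => radialCutoff x * radialExt u x := rfl
  have hG' : (G : E → ℝ) = fun x => radialCutoff x * radialExt v x := rfl
  have hsym := SchwartzMap.integral_mul_laplacian_right_eq_left (μ := (volume : Measure E)) F G
  have hi1 : Integrable (fun x => F x * Laplacian.laplacian G x) (volume : Measure E) :=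
    (SchwartzMap.pairing (ContinuousLinearMap.mul ℝ ℝ) F (Laplacian.laplacian G)).integrable
  have hi2 : Integrable (fun x => Laplacian.laplacian F x * G x) (volume : Measure E) :=
    (SchwartzMap.pairing (ContinuousLinearMap.mul ℝ ℝ) (Laplacian.laplacian F) G).integrable
  have h0 : ∫ x, (F x * Laplacian.laplacian G x - Laplacian.laplacian F x * G x) = 0 := by
    rw [integral_sub hi1 hi2, hsym, sub_self]
  -- The terms in which the Laplacian falls on the cutoff are symmetric in `u` and `v` and cancel;
  -- the rest is a radial function times the Green integrand.
  have h1 : ∫ x : E, (F x * Laplacian.laplacian G x - Laplacian.laplacian F x * G x)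
      = ∫ x : E, (radiusBump (‖x‖ ^ 2) * (radiusBump (‖x‖ ^ 2) * (‖x‖ ^ 2)⁻¹))
        * radialExt (fun y => u y * sphLaplacian v y - v y * sphLaplacian u y) x := by
    refine integral_congr_ae (.of_forall fun x => ?_)
    simp only
    by_cases hx : x = 0
    · simp [hF', hG', hx, radialExt]
    · rw [SchwartzMap.laplacian_apply, SchwartzMap.laplacian_apply, hF', hG',
        laplacian_radialCutoff_mul hu hx, laplacian_radialCutoff_mul hv hx]
      beta_reduce
      rw [radialExt_apply u hx, radialExt_apply v hx, radialExt_apply (sphLaplacian u) hx,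
        radialExt_apply (sphLaplacian v) hx, radialExt_apply _ hx]
      simp only [radialCutoff]
      ring
  rw [h1, integral_radial_mul (N := N)
    (fun r => radiusBump (r ^ 2) * (radiusBump (r ^ 2) * (r ^ 2)⁻¹))] at h0
  exact (mul_eq_zero.mp h0).resolve_right (radial_integral_cutoff_ne_zero N)

/-! ### Orthogonality of harmonics and the decomposition of zonal powers. -/

theorem _root_.Continuous.integrable_sph {N : ℕ} {F : Type*} [NormedAddCommGroup F]
    {f : Sph N → F} (hf : Continuous f) : Integrable f (σ N) :=
  hf.integrable_of_hasCompactSupport (HasCompactSupport.of_compactSpace _)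

theorem eigenvalue_zero (N : ℕ) : eigenvalue N 0 = 0 := by simp [eigenvalue]

theorem eigenvalue_nonneg {N : ℕ} (hN : 1 ≤ N) (k : ℕ) : 0 ≤ eigenvalue N k := by
  rw [← eigenvalue_zero N]
  exact (eigenvalue_strictMono hN).monotone (Nat.zero_le k)

theorem eigenvalue_pos {N : ℕ} (hN : 1 ≤ N) {k : ℕ} (hk : 0 < k) : 0 < eigenvalue N k := by
  rw [← eigenvalue_zero N]
  exact eigenvalue_strictMono hN hk

theorem sq_le_eigenvalue {N : ℕ} (hN : 1 ≤ N) (k : ℕ) : (k : ℝ) ^ 2 ≤ eigenvalue N k := by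
  have h1 : (1 : ℝ) ≤ N := by exact_mod_cast hN
  have h2 : (0 : ℝ) ≤ k := Nat.cast_nonneg _
  unfold eigenvalue
  nlinarith

theorem continuous_zonal {N : ℕ} (a : Sph N) (m : ℕ) : Continuous (zonal a m) := by
  unfold zonal
  fun_prop

theorem zonal_zero {N : ℕ} (a : Sph N) : zonal a 0 = 1 := by
  funext y
  simp [zonal]

theorem zonal_nonneg {N : ℕ} (a : Sph N) (m : ℕ) (y : Sph N) : 0 ≤ zonal a m y := by
  refine pow_nonneg ?_ m
  have h := abs_real_inner_le_norm (a : EuclideanSpace ℝ (Fin (N + 1)))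
    (y : EuclideanSpace ℝ (Fin (N + 1)))
  simp only [norm_eq_of_mem_sphere, mul_one] at h
  linarith [(abs_le.mp h).1]

theorem zonal_self_pos {N : ℕ} (a : Sph N) (m : ℕ) : 0 < zonal a m a := by
  refine pow_pos ?_ m
  rw [real_inner_self_eq_norm_sq]
  positivity

theorem SmoothOnSphere.add {N : ℕ} {u v : Sph N → ℝ} (hu : SmoothOnSphere u)
    (hv : SmoothOnSphere v) : SmoothOnSphere (u + v) := by
  unfold SmoothOnSphere
  rw [radialExt_add]
  exact ContDiffOn.add hu hv

theorem sphLaplacian_add {N : ℕ} {u v : Sph N → ℝ} (hu : SmoothOnSphere u)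
    (hv : SmoothOnSphere v) (x : Sph N) :
    sphLaplacian (u + v) x = sphLaplacian u x + sphLaplacian v x := by
  rw [sphLaplacian, radialExt_add, (hu.contDiffAt x).laplacian_add (hv.contDiffAt x)]
  rfl

theorem one_mem_harmonics (N : ℕ) : (1 : Sph N → ℝ) ∈ harmonics N 0 := by
  have h : Set.EqOn (radialExt (1 : Sph N → ℝ)) (fun _ => 1) {0}ᶜ := fun x hx => by
    rw [radialExt_apply _ hx]
    rfl
  refine ⟨contDiffOn_const.congr h, fun x => ?_⟩
  have h1 : radialExt (1 : Sph N → ℝ) =ᶠ[𝓝 (x : EuclideanSpace ℝ (Fin (N + 1)))] fun _ => 1 :=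
    h.eventuallyEq_of_mem (isOpen_compl_singleton.mem_nhds (ne_zero_of_mem_unit_sphere x))
  rw [sphLaplacian, (InnerProductSpace.laplacian_congr_nhds h1).self_of_nhds, eigenvalue_zero]
  simp

/-- Green's identity gives `(λ_j - λ_k) ∫ u v = 0`, and the eigenvalues are distinct. -/
theorem integral_mul_eq_zero_of_mem_harmonics {N : ℕ} (hN : 1 ≤ N) {j k : ℕ} (hjk : j ≠ k)
    {u v : Sph N → ℝ} (hu : u ∈ harmonics N j) (hv : v ∈ harmonics N k) :
    ∫ y, u y * v y ∂(σ N) = 0 := by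
  have h := integral_mul_sphLaplacian_sub hu.1 hv.1
  have e : ∀ y, u y * sphLaplacian v y - v y * sphLaplacian u y
      = (eigenvalue N j - eigenvalue N k) * (u y * v y) := fun y => by
    linear_combination v y * hu.2 y - u y * hv.2 y
  simp_rw [e] at h
  rw [integral_const_mul] at h
  exact (mul_eq_zero.mp h).resolve_left
    (sub_ne_zero.mpr ((eigenvalue_strictMono hN).injective.ne hjk))

/-- The span of the functions `y ↦ (1 + ⟨a, y⟩) ^ m` with `m ≤ n`. -/
def zonalSpan (N n : ℕ) : Submodule ℝ (Sph N → ℝ) :=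
  Submodule.span ℝ {u | ∃ (a : Sph N) (m : ℕ), m ≤ n ∧ u = zonal a m}

theorem zonal_mem_zonalSpan {N : ℕ} (a : Sph N) {m n : ℕ} (h : m ≤ n) :
    zonal a m ∈ zonalSpan N n :=
  Submodule.subset_span ⟨a, m, h, rfl⟩

theorem zonalSpan_mono {N m n : ℕ} (h : m ≤ n) : zonalSpan N m ≤ zonalSpan N n := by
  refine Submodule.span_mono ?_
  rintro u ⟨a, l, hl, rfl⟩
  exact ⟨a, l, hl.trans h, rfl⟩

/-- Each zonal power is a power of an affine function, so the span lies in the `n`-th power, in the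
algebra of functions, of the space `A` generated by `1` and the coordinates. -/
instance finiteDimensional_zonalSpan (N n : ℕ) : FiniteDimensional ℝ (zonalSpan N n) := by
  set A : Submodule ℝ (Sph N → ℝ) := Submodule.span ℝ (insert 1 (Set.range
    fun (i : Fin (N + 1)) (y : Sph N) => (y : EuclideanSpace ℝ (Fin (N + 1))) i)) with hA
  have h1 : (1 : Sph N → ℝ) ∈ A := Submodule.subset_span (Set.mem_insert _ _)
  have h1' : (1 : Submodule ℝ (Sph N → ℝ)) ≤ A := Submodule.one_le.mpr h1
  have hz : ∀ a : Sph N, zonal a 1 ∈ A := by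
    intro a
    have e : zonal a 1 = 1 + ∑ i, (a : EuclideanSpace ℝ (Fin (N + 1))) i •
        fun y : Sph N => (y : EuclideanSpace ℝ (Fin (N + 1))) i := by
      funext y
      simp [zonal, PiLp.inner_apply, mul_comm]
    rw [e]
    exact A.add_mem h1 (A.sum_mem fun i _ => A.smul_mem _
      (Submodule.subset_span (Set.mem_insert_of_mem _ ⟨i, rfl⟩)))
  have hle : zonalSpan N n ≤ A ^ n := by
    refine Submodule.span_le.mpr ?_
    rintro u ⟨a, m, hm, rfl⟩
    have e : zonal a m = zonal a 1 ^ m := by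
      funext y
      simp [zonal]
    rw [e]
    exact pow_le_pow_right' h1' hm (Submodule.pow_mem_pow A (hz a) m)
  have hfg : (A ^ n).FG := (Submodule.fg_span ((Set.finite_range _).insert _)).pow n
  have : FiniteDimensional ℝ (A ^ n : Submodule ℝ (Sph N → ℝ)) := .of_fg hfg
  exact Submodule.finiteDimensional_of_le hle

theorem sum_harmonics {N : ℕ} {h : ℕ → Sph N → ℝ} (hh : ∀ k, h k ∈ harmonics N k)
    (s : Finset ℕ) :
    SmoothOnSphere (∑ k ∈ s, h k) ∧
      ∀ x, -sphLaplacian (∑ k ∈ s, h k) x = ∑ k ∈ s, eigenvalue N k * h k x := by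
  classical
  induction s using Finset.induction_on with
  | empty =>
    have h0 := (harmonics N 0).zero_mem
    refine ⟨h0.1, fun x => ?_⟩
    rw [Finset.sum_empty, Finset.sum_empty, h0.2 x]
    simp
  | insert k s hk ih =>
    rw [Finset.sum_insert hk]
    refine ⟨(hh k).1.add ih.1, fun x => ?_⟩
    rw [sphLaplacian_add (hh k).1 ih.1, Finset.sum_insert hk, ← ih.2 x, ← (hh k).2 x]
    ring

/-- The recursion of `sphLaplacian_zonal` is triangular with distinct diagonal entries `λ_k`, hence
can be diagonalized step by step. Membership in `zonalSpan` is carried along because it later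
provides finite dimension. -/
theorem zonal_eq_sum_harmonics {N : ℕ} (hN : 1 ≤ N) (a : Sph N) (n : ℕ) :
    ∃ h : ℕ → Sph N → ℝ, (∀ k, h k ∈ harmonics N k ⊓ zonalSpan N k) ∧
      zonal a n = ∑ k ∈ Finset.range (n + 1), h k := by
  induction n with
  | zero =>
    refine ⟨fun k => if k = 0 then 1 else 0, fun k => ?_, by simp [zonal_zero]⟩
    by_cases hk : k = 0
    · subst hk
      simp only [if_true]
      exact ⟨one_mem_harmonics N, by rw [← zonal_zero a]; exact zonal_mem_zonalSpan a le_rfl⟩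
    · simp [hk]
  | succ n ih =>
    obtain ⟨h, hmem, hsum⟩ := ih
    -- Chosen so that `-Δ_S - λ_{n+1}` sends `∑ c_k h_k` to `(n + 1) (2 n + N)` times the power `n`,
    -- which cancels the lower-order term of the recursion.
    set c : ℕ → ℝ := fun k => (n + 1) * (2 * n + N) / (eigenvalue N k - eigenvalue N (n + 1))
      with hc
    set g : ℕ → Sph N → ℝ := fun k => c k • h k with hg
    have hgmem : ∀ k, g k ∈ harmonics N k ⊓ zonalSpan N k := fun k =>
      Submodule.smul_mem _ _ (hmem k)
    obtain ⟨hs, hl⟩ := sum_harmonics (fun k => (hgmem k).1) (Finset.range (n + 1))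
    set w := ∑ k ∈ Finset.range (n + 1), g k with hw
    have hwmem : w ∈ zonalSpan N (n + 1) := Submodule.sum_mem _ fun k hk =>
      zonalSpan_mono (Finset.mem_range.mp hk).le (hgmem k).2
    have htop : zonal a (n + 1) + w ∈ harmonics N (n + 1) ⊓ zonalSpan N (n + 1) := by
      refine ⟨⟨(smoothOnSphere_zonal a _).add hs, fun x => ?_⟩,
        Submodule.add_mem _ (zonal_mem_zonalSpan a le_rfl) hwmem⟩
      have e : ∑ k ∈ Finset.range (n + 1), eigenvalue N k * g k x
          = eigenvalue N (n + 1) * w x + (n + 1) * (2 * n + N) * zonal a n x := by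
        rw [hsum, hw, Finset.sum_apply, Finset.sum_apply, Finset.mul_sum, Finset.mul_sum,
          ← Finset.sum_add_distrib]
        refine Finset.sum_congr rfl fun k hk => ?_
        have hne : eigenvalue N k - eigenvalue N (n + 1) ≠ 0 := sub_ne_zero.mpr
          ((eigenvalue_strictMono hN).injective.ne (Finset.mem_range.mp hk).ne)
        have e1 : c k * (eigenvalue N k - eigenvalue N (n + 1)) = (n + 1) * (2 * n + N) :=
          div_mul_cancel₀ _ hne
        simp only [hg, Pi.smul_apply, smul_eq_mul]
        linear_combination h k x * e1
      rw [sphLaplacian_add (smoothOnSphere_zonal a _) hs, Pi.add_apply]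
      linear_combination sphLaplacian_zonal a n x + hl x + e
    refine ⟨fun k => if k = n + 1 then zonal a (n + 1) + w else -g k, fun k => ?_, ?_⟩
    · by_cases hk : k = n + 1
      · subst hk
        simpa using htop
      · simp only [hk, if_false]
        exact Submodule.neg_mem _ (hgmem k)
    · rw [Finset.sum_range_succ, if_pos rfl, Finset.sum_congr rfl fun k hk =>
        if_neg (Finset.mem_range.mp hk).ne, Finset.sum_neg_distrib, ← hw]
      abel

/-! ### Zonal averages as an approximate identity; orthonormal bases of `H_k`. -/

/-- The total mass of the kernel `(1 + ⟨a, y⟩) ^ n`. -/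
def zonalMass {N : ℕ} (a : Sph N) (n : ℕ) : ℝ := ∫ y, zonal a n y ∂(σ N)

theorem zonalMass_pos {N : ℕ} (a : Sph N) (n : ℕ) : 0 < zonalMass a n :=
  (continuous_zonal a n).integral_pos_of_hasCompactSupport_nonneg_nonzero
    (HasCompactSupport.of_compactSpace _) (zonal_nonneg a n) (zonal_self_pos a n).ne'

/-- Green's identity for a zonal power and a harmonic. The case `u = 1` is the recursion for the
masses. -/
theorem integral_zonal_succ_mul {N k : ℕ} {u : Sph N → ℝ} (hu : u ∈ harmonics N k) (a : Sph N)
    (n : ℕ) :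
    (eigenvalue N (n + 1) - eigenvalue N k) * ∫ y, zonal a (n + 1) y * u y ∂(σ N)
      = (n + 1) * (2 * n + N) * ∫ y, zonal a n y * u y ∂(σ N) := by
  have h := integral_mul_sphLaplacian_sub (smoothOnSphere_zonal a (n + 1)) hu.1
  have e : ∀ y, zonal a (n + 1) y * sphLaplacian u y - u y * sphLaplacian (zonal a (n + 1)) y
      = (eigenvalue N (n + 1) - eigenvalue N k) * (zonal a (n + 1) y * u y)
        - (n + 1) * (2 * n + N) * (zonal a n y * u y) := fun y => by
    linear_combination u y * sphLaplacian_zonal a n y - zonal a (n + 1) y * hu.2 y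
  have hc := continuous_of_mem_harmonics hu
  simp_rw [e] at h
  have hi : ∀ m, Integrable (fun y => zonal a m y * u y) (σ N) := fun m =>
    ((continuous_zonal a m).mul hc).integrable_sph
  rw [integral_sub ((hi (n + 1)).const_mul _) ((hi n).const_mul _), integral_const_mul,
    integral_const_mul] at h
  linarith

theorem eigenvalue_mul_zonalMass_succ {N : ℕ} (a : Sph N) (n : ℕ) :
    eigenvalue N (n + 1) * zonalMass a (n + 1) = (n + 1) * (2 * n + N) * zonalMass a n := by
  have h := integral_zonal_succ_mul (one_mem_harmonics N) a n
  simpa [eigenvalue_zero, zonalMass] using h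

/-- The mass recursion and its initial value do not involve the pole, so rotation invariance of `σ`
is not needed. -/
theorem zonalMass_eq {N : ℕ} (hN : 1 ≤ N) (a b : Sph N) (n : ℕ) :
    zonalMass a n = zonalMass b n := by
  induction n with
  | zero => simp [zonalMass, zonal_zero]
  | succ n ih =>
    have h1 := eigenvalue_mul_zonalMass_succ a n
    rw [ih, ← eigenvalue_mul_zonalMass_succ b n] at h1
    exact mul_left_cancel₀ (eigenvalue_pos hN n.succ_pos).ne' h1

/-- The average of `f` against the normalized kernel `(1 + ⟨x, y⟩) ^ n`. -/
def zonalAvg {N : ℕ} {F : Type*} [NormedAddCommGroup F] [NormedSpace ℝ F] (n : ℕ)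
    (f : Sph N → F) (x : Sph N) : F :=
  (zonalMass x n)⁻¹ • ∫ y, zonal x n y • f y ∂(σ N)

/-- The kernels are the powers of one nonnegative continuous function whose unique maximum is at
`x`. -/
theorem tendsto_zonalAvg {N : ℕ} {F : Type*} [NormedAddCommGroup F] [NormedSpace ℝ F]
    [CompleteSpace F] {f : Sph N → F} (hf : Continuous f) (x : Sph N) :
    Tendsto (fun n => zonalAvg n f x) atTop (𝓝 (f x)) := by
  have h := tendsto_setIntegral_pow_smul_of_unique_maximum_of_isCompact_of_continuousOn
    (μ := σ N) (x₀ := x) (g := f) (s := Set.univ) isCompact_univ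
    (c := zonal x 1) (continuous_zonal x 1).continuousOn (fun y _ hy => ?_)
    (fun y _ => zonal_nonneg x 1 y) (zonal_self_pos x 1) (by simp) hf.continuousOn
  · simp only [Measure.restrict_univ] at h
    have e : ∀ (n : ℕ) (y : Sph N), zonal x 1 y ^ n = zonal x n y := fun n y => by
      simp [zonal]
    simp_rw [e] at h
    exact h
  · have h1 : inner ℝ (x : EuclideanSpace ℝ (Fin (N + 1)))
        (y : EuclideanSpace ℝ (Fin (N + 1))) < 1 :=
      (inner_lt_one_iff_real_of_norm_eq_one (by simp) (by simp)).mpr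
        fun h => hy (Subtype.ext h.symm)
    simp only [zonal, pow_one]
    rw [real_inner_self_eq_norm_sq]
    simpa using h1

/-- Quotient of the recursion for the pairings by the recursion for the masses. -/
theorem zonalAvg_eq_mul_succ {N : ℕ} (hN : 1 ≤ N) {k : ℕ} {u : Sph N → ℝ}
    (hu : u ∈ harmonics N k) (n : ℕ) (x : Sph N) :
    zonalAvg n u x
      = (1 - eigenvalue N k / eigenvalue N (n + 1)) * zonalAvg (n + 1) u x := by
  have h1 := integral_zonal_succ_mul hu x n
  have h2 := eigenvalue_mul_zonalMass_succ x n
  have h3 := (zonalMass_pos x n).ne'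
  have h4 := (zonalMass_pos x (n + 1)).ne'
  have h5 := (eigenvalue_pos hN n.succ_pos).ne'
  simp only [zonalAvg, smul_eq_mul]
  have h6 : ((n : ℝ) + 1) * (2 * n + N) ≠ 0 := by
    intro h
    rw [h, zero_mul] at h2
    exact mul_ne_zero h5 h4 h2
  field_simp
  refine mul_left_cancel₀ h6 ?_
  linear_combination (-zonalMass x (n + 1) * eigenvalue N (n + 1)) * h1
    + (eigenvalue N (n + 1) - eigenvalue N k) * (∫ y, zonal x (n + 1) y * u y ∂(σ N)) * h2

theorem integrable_mul_sph {N : ℕ} {u v : Sph N → ℝ} (hu : Continuous u) (hv : Continuous v) :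
    Integrable (fun y => u y * v y) (σ N) :=
  (hu.mul hv).integrable_sph

/-- The inner product of `L_2(S^N)` on a space of continuous functions. -/
@[reducible] def continuousInnerCore {N : ℕ} (U : Submodule ℝ (Sph N → ℝ)) (hU : ∀ u ∈ U, Continuous u) :
    InnerProductSpace.Core ℝ U where
  inner u v := ∫ y, (u : Sph N → ℝ) y * (v : Sph N → ℝ) y ∂(σ N)
  conj_inner_symm u v := by simp [mul_comm]
  re_inner_nonneg u := integral_nonneg fun y => mul_self_nonneg _
  add_left u v w := by
    simp only [Submodule.coe_add, Pi.add_apply, add_mul]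
    exact integral_add (integrable_mul_sph (hU _ u.2) (hU _ w.2))
      (integrable_mul_sph (hU _ v.2) (hU _ w.2))
  smul_left u v r := by
    simp only [Submodule.coe_smul, Pi.smul_apply, smul_eq_mul, mul_assoc]
    exact integral_const_mul _ _
  definite u h := by
    have hc := hU _ u.2
    by_contra hne
    obtain ⟨y, hy⟩ : ∃ y, (u : Sph N → ℝ) y ≠ 0 := by
      by_contra! hz
      exact hne (Subtype.ext (funext hz))
    have := (hc.mul hc).integral_pos_of_hasCompactSupport_nonneg_nonzero (μ := σ N)
      (HasCompactSupport.of_compactSpace _) (fun y => mul_self_nonneg _)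
      (mul_self_ne_zero.mpr hy)
    exact this.ne' h

theorem exists_orthonormal_functions {N : ℕ} (U : Submodule ℝ (Sph N → ℝ))
    (hU : ∀ u ∈ U, Continuous u) [FiniteDimensional ℝ U] :
    ∃ (m : ℕ) (Y : Fin m → Sph N → ℝ), (∀ j, Y j ∈ U) ∧
      (∀ i j, ∫ y, Y i y * Y j y ∂(σ N) = if i = j then 1 else 0) ∧
      U ≤ Submodule.span ℝ (Set.range Y) := by
  let _ : NormedAddCommGroup U := (continuousInnerCore U hU).toNormedAddCommGroup
  let _ : InnerProductSpace ℝ U := InnerProductSpace.ofCore (continuousInnerCore U hU).toCore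
  let b := stdOrthonormalBasis ℝ U
  refine ⟨_, fun j => (b j : Sph N → ℝ), fun j => (b j).2, fun i j => ?_, fun u hu => ?_⟩
  · exact orthonormal_iff_ite.mp b.orthonormal i j
  · have h := b.sum_repr ⟨u, hu⟩
    have h' := congrArg (Subtype.val) h
    rw [Submodule.coe_sum] at h'
    change _ = u at h'
    rw [← h']
    exact Submodule.sum_mem _ fun i _ => Submodule.smul_mem _ _
      (Submodule.subset_span ⟨i, rfl⟩)

theorem integral_mul_eq_zero_of_mem_span {N m : ℕ} {Y : Fin m → Sph N → ℝ}
    (hY : ∀ j, Continuous (Y j)) {u v : Sph N → ℝ} (hu : Continuous u)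
    (h : ∀ j, ∫ y, Y j y * u y ∂(σ N) = 0) (hv : v ∈ Submodule.span ℝ (Set.range Y)) :
    ∫ y, v y * u y ∂(σ N) = 0 := by
  obtain ⟨c, rfl⟩ := (Submodule.mem_span_range_iff_exists_fun ℝ).mp hv
  simp only [Finset.sum_apply, Pi.smul_apply, smul_eq_mul, Finset.sum_mul, mul_assoc]
  rw [integral_finsetSum _ fun i _ => (integrable_mul_sph (hY i) hu).const_mul (c i)]
  simp [integral_const_mul, h]

/-- A basis of the finite-dimensional part `U` of `H_k` inside `zonalSpan` already spans `H_k`.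
Indeed, `u` minus its projection `p` to `U` is orthogonal to `U` and to the harmonics of other
degrees, hence to all zonal powers; its zonal averages vanish, and so does their limit `u - p`. -/
theorem exists_harmonicBasis {N : ℕ} (hN : 1 ≤ N) (k : ℕ) :
    ∃ (m : ℕ) (Y : Fin m → Sph N → ℝ), IsHarmonicBasis N k m Y := by
  set U := harmonics N k ⊓ zonalSpan N k with hUdef
  have hU : ∀ u ∈ U, Continuous u := fun u hu => continuous_of_mem_harmonics hu.1
  have : FiniteDimensional ℝ U := Submodule.finiteDimensional_of_le
    (inf_le_right : U ≤ zonalSpan N k)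
  obtain ⟨m, Y, hmem, horth, hspan⟩ := exists_orthonormal_functions U hU
  refine ⟨m, Y, fun j => (hmem j).1, horth, fun u hu => ?_⟩
  set p : Sph N → ℝ := ∑ j, (∫ y, Y j y * u y ∂(σ N)) • Y j with hp
  have hpU : p ∈ U := Submodule.sum_mem _ fun j _ => Submodule.smul_mem _ _ (hmem j)
  have hd : u - p ∈ harmonics N k := Submodule.sub_mem _ hu hpU.1
  have hdc := continuous_of_mem_harmonics hd
  have hYp : ∀ i, ∫ y, Y i y * p y ∂(σ N) = ∫ y, Y i y * u y ∂(σ N) := by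
    intro i
    simp only [hp, Finset.sum_apply, Pi.smul_apply, smul_eq_mul, Finset.mul_sum]
    rw [integral_finsetSum]
    · have e : ∀ j (y : Sph N), Y i y * ((∫ z, Y j z * u z ∂(σ N)) * Y j y)
          = (∫ z, Y j z * u z ∂(σ N)) * (Y i y * Y j y) := fun j y => by ring
      simp [e, integral_const_mul, horth]
    · intro j _
      exact integrable_mul_sph (hU _ (hmem i)) (continuous_const.mul (hU _ (hmem j)))
  have hperp : ∀ j, ∫ y, Y j y * (u - p) y ∂(σ N) = 0 := by
    intro j
    simp only [Pi.sub_apply, mul_sub]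
    rw [integral_sub (integrable_mul_sph (hU _ (hmem j)) (continuous_of_mem_harmonics hu))
      (integrable_mul_sph (hU _ (hmem j)) (hU _ hpU)), hYp j, sub_self]
  have hz : ∀ (x : Sph N) (n : ℕ), ∫ y, zonal x n y * (u - p) y ∂(σ N) = 0 := by
    intro x n
    obtain ⟨h, hh, hs⟩ := zonal_eq_sum_harmonics hN x n
    simp only [hs, Finset.sum_apply, Finset.sum_mul]
    rw [integral_finsetSum _ fun i _ => integrable_mul_sph
      (continuous_of_mem_harmonics (hh i).1) hdc]
    refine Finset.sum_eq_zero fun i _ => ?_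
    by_cases hik : i = k
    · subst hik
      exact integral_mul_eq_zero_of_mem_span (fun j => hU _ (hmem j)) hdc hperp (hspan (hh i))
    · exact integral_mul_eq_zero_of_mem_harmonics hN hik (hh i).1 hd
  have h0 : u - p = 0 := by
    funext x
    have ht := tendsto_zonalAvg hdc x
    simp only [zonalAvg, smul_eq_mul, hz, mul_zero] at ht
    exact tendsto_nhds_unique ht tendsto_const_nhds
  rw [sub_eq_zero.mp h0]
  exact Submodule.sum_mem _ fun j _ => Submodule.smul_mem _ _ (Submodule.subset_span ⟨j, rfl⟩)

/-! ### The multipliers of the zonal averages. -/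

/-- The partial products of `∏_{m > n} (1 - λ_k / λ_m)`. -/
def partialMult (N n k M : ℕ) : ℝ :=
  ∏ m ∈ Finset.range M, (1 - eigenvalue N k / eigenvalue N (n + 1 + m))

/-- The multiplier `∏_{m > n} (1 - λ_k / λ_m)` by which the averages with kernel
`(1 + ⟨x, y⟩) ^ n` act on harmonics of degree `k`. -/
def zonalMult (N n k : ℕ) : ℝ := if k ≤ n then ⨅ M, partialMult N n k M else 0

theorem partialMult_succ (N n k M : ℕ) : partialMult N n k (M + 1)
    = partialMult N n k M * (1 - eigenvalue N k / eigenvalue N (n + 1 + M)) :=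
  Finset.prod_range_succ _ _

theorem eigenvalue_div_mem_Icc {N : ℕ} (hN : 1 ≤ N) {k m : ℕ} (h : k ≤ m) :
    eigenvalue N k / eigenvalue N m ∈ Set.Icc (0 : ℝ) 1 :=
  ⟨div_nonneg (eigenvalue_nonneg hN k) (eigenvalue_nonneg hN m),
    div_le_one_of_le₀ ((eigenvalue_strictMono hN).monotone h) (eigenvalue_nonneg hN m)⟩

theorem partialMult_nonneg {N : ℕ} (hN : 1 ≤ N) {n k : ℕ} (h : k ≤ n) (M : ℕ) :
    0 ≤ partialMult N n k M :=
  Finset.prod_nonneg fun m _ => sub_nonneg.mpr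
    (eigenvalue_div_mem_Icc hN (by omega : k ≤ n + 1 + m)).2

theorem partialMult_antitone {N : ℕ} (hN : 1 ≤ N) {n k : ℕ} (h : k ≤ n) :
    Antitone (partialMult N n k) := by
  refine antitone_nat_of_succ_le fun M => ?_
  rw [partialMult_succ]
  exact mul_le_of_le_one_right (partialMult_nonneg hN h M)
    (by linarith [(eigenvalue_div_mem_Icc hN (by omega : k ≤ n + 1 + M)).1])

theorem partialMult_le_one {N : ℕ} (hN : 1 ≤ N) {n k : ℕ} (h : k ≤ n) (M : ℕ) :
    partialMult N n k M ≤ 1 := by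
  have := partialMult_antitone hN h (Nat.zero_le M)
  simpa [partialMult] using this

theorem tendsto_partialMult {N : ℕ} (hN : 1 ≤ N) (n k : ℕ) :
    Tendsto (partialMult N n k) atTop (𝓝 (zonalMult N n k)) := by
  rw [zonalMult]
  split_ifs with h
  · exact tendsto_atTop_ciInf (partialMult_antitone hN h)
      ⟨0, by rintro _ ⟨M, rfl⟩; exact partialMult_nonneg hN h M⟩
  -- For `k > n` the factor with `m = k` is zero, and it is present as soon as `M ≥ k - n`.
  · refine tendsto_const_nhds.congr' ?_
    filter_upwards [eventually_ge_atTop (k - n)] with M hM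
    refine (Finset.prod_eq_zero (Finset.mem_range.mpr (by omega : k - n - 1 < M)) ?_).symm
    rw [show n + 1 + (k - n - 1) = k by omega,
      div_self (eigenvalue_pos hN (by omega : 0 < k)).ne', sub_self]

theorem zonalAvg_eq_partialMult_mul {N : ℕ} (hN : 1 ≤ N) {k : ℕ} {u : Sph N → ℝ}
    (hu : u ∈ harmonics N k) (n M : ℕ) (x : Sph N) :
    zonalAvg n u x = partialMult N n k M * zonalAvg (n + M) u x := by
  induction M with
  | zero => simp [partialMult]
  | succ M ih =>
    rw [ih, partialMult_succ, zonalAvg_eq_mul_succ hN hu (n + M) x,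
      show n + 1 + M = n + M + 1 by omega, show n + (M + 1) = n + M + 1 by omega, mul_assoc]

/-- The one-step relation is iterated `M` times; as `M → ∞` the averages of degree `n + M` tend to
`u x`. -/
theorem zonalAvg_of_mem_harmonics {N : ℕ} (hN : 1 ≤ N) {k : ℕ} {u : Sph N → ℝ}
    (hu : u ∈ harmonics N k) (n : ℕ) (x : Sph N) :
    zonalAvg n u x = zonalMult N n k * u x := by
  have h1 := (tendsto_zonalAvg (continuous_of_mem_harmonics hu) x).comp
    (tendsto_add_atTop_nat n)
  have h2 := (tendsto_partialMult hN n k).mul h1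
  refine tendsto_nhds_unique ?_ h2
  refine tendsto_const_nhds.congr fun M => ?_
  rw [zonalAvg_eq_partialMult_mul hN hu n M x]
  simp [add_comm]

theorem zonalMult_of_lt {N n k : ℕ} (h : n < k) : zonalMult N n k = 0 :=
  if_neg h.not_ge

theorem zonalMult_zero {N : ℕ} (n : ℕ) : zonalMult N n 0 = 1 := by
  simp [zonalMult, partialMult, eigenvalue_zero]

theorem zonalMult_nonneg {N : ℕ} (hN : 1 ≤ N) (n k : ℕ) : 0 ≤ zonalMult N n k := by
  by_cases h : k ≤ n
  · exact ge_of_tendsto' (tendsto_partialMult hN n k) fun M => partialMult_nonneg hN h M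
  · rw [zonalMult_of_lt (not_le.mp h)]

theorem zonalMult_le_one {N : ℕ} (hN : 1 ≤ N) (n k : ℕ) : zonalMult N n k ≤ 1 := by
  by_cases h : k ≤ n
  · exact le_of_tendsto' (tendsto_partialMult hN n k) fun M => partialMult_le_one hN h M
  · rw [zonalMult_of_lt (not_le.mp h)]
    exact zero_le_one

/-- A product of factors `1 - x_m` in `[0, 1]` is at least `1 - ∑ x_m`. Here `x_m ≤ λ_k / m²`, and
`1 / m² ≤ 1 / (m - 1) - 1 / m` telescopes; the induction keeps the telescoped form. -/
theorem one_sub_zonalMult_le {N : ℕ} (hN : 1 ≤ N) {n k : ℕ} (hn : 0 < n) (h : k ≤ n) :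
    1 - zonalMult N n k ≤ eigenvalue N k / n := by
  have hn' : (0 : ℝ) < n := by exact_mod_cast hn
  have key : ∀ M : ℕ, 1 - eigenvalue N k * (1 / n - 1 / (n + M)) ≤ partialMult N n k M := by
    intro M
    induction M with
    | zero => simp [partialMult]
    | succ M ih =>
      have hx := (eigenvalue_div_mem_Icc hN (by omega : k ≤ n + 1 + M)).1
      have h1 := partialMult_le_one hN h M
      have hM : (0 : ℝ) ≤ M := Nat.cast_nonneg M
      have hl := eigenvalue_nonneg hN k
      have h2 : eigenvalue N k / eigenvalue N (n + 1 + M)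
          ≤ eigenvalue N k * (1 / (n + M) - 1 / (n + (M + 1))) := by
        have h3 := sq_le_eigenvalue hN (n + 1 + M)
        push_cast at h3
        have h4 : 1 / ((n : ℝ) + 1 + M) ^ 2 ≤ 1 / (n + M) - 1 / (n + (M + 1)) := by
          rw [div_sub_div _ _ (by positivity) (by positivity),
            div_le_div_iff₀ (by positivity) (by positivity)]
          nlinarith
        rw [div_eq_mul_one_div]
        refine mul_le_mul_of_nonneg_left (le_trans ?_ h4) hl
        exact one_div_le_one_div_of_le (by positivity) h3
      rw [partialMult_succ]
      push_cast
      nlinarith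
  refine sub_le_comm.mp (ge_of_tendsto' (tendsto_partialMult hN n k) fun M => ?_)
  refine le_trans ?_ (key M)
  have : eigenvalue N k * (1 / n - 1 / (n + M)) ≤ eigenvalue N k * (1 / n) :=
    mul_le_mul_of_nonneg_left (sub_le_self _ (by positivity)) (eigenvalue_nonneg hN k)
  rw [mul_one_div] at this
  linarith

/-- Only the `n` factors with `n < m ≤ 2 n` are kept, each at most `1 - x` with `x = λ_k / λ_{2n}`.
Bernoulli's inequality gives `(1 - x) ^ n ≤ 1 / (1 + n x)`, and `λ_{2n} ≤ 2 (N + 1) n²` yields the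
constant. -/
theorem zonalMult_le {N : ℕ} (hN : 1 ≤ N) {n k : ℕ} (hk : 0 < k) :
    zonalMult N n k ≤ 2 * (N + 1) * n / eigenvalue N k := by
  have hlk := eigenvalue_pos hN hk
  by_cases h : k ≤ n
  · have hn : 0 < n := by omega
    have hn' : (1 : ℝ) ≤ n := by exact_mod_cast hn
    have hN' : (1 : ℝ) ≤ N := by exact_mod_cast hN
    set x := eigenvalue N k / eigenvalue N (n + n) with hx
    obtain ⟨hx0, hx1⟩ := eigenvalue_div_mem_Icc hN (by omega : k ≤ n + n)
    have h2n := eigenvalue_pos hN (by omega : 0 < n + n)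
    have hle : zonalMult N n k ≤ (1 - x) ^ n := by
      refine le_trans ((partialMult_antitone hN h).le_of_tendsto
        (tendsto_partialMult hN n k) n) ?_
      rw [partialMult, ← Finset.card_range n, ← Finset.prod_const, Finset.card_range]
      refine Finset.prod_le_prod (fun m _ => sub_nonneg.mpr
        (eigenvalue_div_mem_Icc hN (by omega : k ≤ n + 1 + m)).2) fun m hm => ?_
      refine sub_le_sub_left (div_le_div_of_nonneg_left hlk.le
        (eigenvalue_pos hN (by omega)) ((eigenvalue_strictMono hN).monotone ?_)) _
      have := Finset.mem_range.mp hm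
      omega
    have h1 : (1 - x) ^ n * (1 + n * x) ≤ 1 := by
      calc (1 - x) ^ n * (1 + n * x) ≤ (1 - x) ^ n * (1 + x) ^ n :=
            mul_le_mul_of_nonneg_left (one_add_mul_le_pow (by linarith) n)
              (pow_nonneg (sub_nonneg.mpr hx1) n)
        _ = (1 - x ^ 2) ^ n := by rw [← mul_pow]; ring
        _ ≤ 1 := pow_le_one₀ (by nlinarith) (by nlinarith)
    have h2 : (1 - x) ^ n * (n * x) ≤ 1 := by
      have := pow_nonneg (sub_nonneg.mpr hx1) n
      nlinarith
    have h3 : eigenvalue N (n + n) ≤ 2 * (N + 1) * n * n := by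
      unfold eigenvalue
      push_cast
      nlinarith [mul_nonneg (sub_nonneg.mpr hN') (sub_nonneg.mpr hn')]
    refine hle.trans ?_
    rw [le_div_iff₀ hlk]
    have h4 : (1 - x) ^ n * eigenvalue N k * n ≤ eigenvalue N (n + n) := by
      have e : eigenvalue N k = x * eigenvalue N (n + n) := (div_mul_cancel₀ _ h2n.ne').symm
      rw [e]
      nlinarith
    nlinarith
  · rw [zonalMult_of_lt (not_le.mp h)]
    positivity

/-- The zonal averages are multiplier operators. -/
theorem zonalAvg_eq_sum_component {N : ℕ} (hN : 1 ≤ N) {f : Sph N → ℂ} (hf : MemLp f 2 (σ N))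
    (n : ℕ) (x : Sph N) :
    zonalAvg n f x = ∑ k ∈ Finset.range (n + 1), (zonalMult N n k : ℂ) * component N k f x := by
  choose m Y hY using exists_harmonicBasis hN
  obtain ⟨h, hh, hs⟩ := zonal_eq_sum_harmonics hN x n
  have hM := (zonalMass_pos x n).ne'
  -- By orthogonality, `Y_j` pairs with the degree `k` part of the kernel as with the whole kernel,
  -- and the latter pairing is a zonal average.
  have hcoef : ∀ k ∈ Finset.range (n + 1), ∀ j,
      ∫ y, h k y * Y k j y ∂(σ N) = zonalMass x n * (zonalMult N n k * Y k j x) := by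
    intro k hk j
    have hYc := continuous_of_mem_harmonics ((hY k).mem j)
    rw [← zonalAvg_of_mem_harmonics hN ((hY k).mem j) n x, zonalAvg, smul_eq_mul,
      mul_inv_cancel_left₀ hM]
    simp only [hs, Finset.sum_apply, smul_eq_mul, Finset.sum_mul]
    rw [integral_finsetSum _ fun i _ => integrable_mul_sph
      (continuous_of_mem_harmonics (hh i).1) hYc, Finset.sum_eq_single k]
    · intro i _ hik
      exact integral_mul_eq_zero_of_mem_harmonics hN hik (hh i).1 ((hY k).mem j)
    · exact fun hk' => absurd hk hk'
  have hexp : ∀ y, zonal x n y • f y = ∑ k ∈ Finset.range (n + 1), ∑ j,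
      ((zonalMass x n * (zonalMult N n k * Y k j x) : ℝ) : ℂ) * (f y * (Y k j y : ℂ)) := by
    intro y
    rw [Complex.real_smul, hs, Finset.sum_apply, Complex.ofReal_sum, Finset.sum_mul]
    refine Finset.sum_congr rfl fun k hk => ?_
    rw [(hY k).expand (hh k).1 y, Complex.ofReal_sum, Finset.sum_mul]
    refine Finset.sum_congr rfl fun j _ => ?_
    rw [hcoef k hk j]
    push_cast
    ring
  rw [zonalAvg]
  simp_rw [hexp]
  rw [integral_finsetSum _ fun k _ => integrable_finsetSum _ fun j _ =>
    (integrable_mul_of_mem_harmonics ((hY k).mem j) hf).const_mul _, Finset.smul_sum]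
  refine Finset.sum_congr rfl fun k _ => ?_
  rw [integral_finsetSum _ fun j _ =>
    (integrable_mul_of_mem_harmonics ((hY k).mem j) hf).const_mul _, component_eq (hY k) hf x,
    Finset.smul_sum, Finset.mul_sum]
  refine Finset.sum_congr rfl fun j _ => ?_
  rw [integral_const_mul, Complex.real_smul]
  have hM' : (zonalMass x n : ℂ) ≠ 0 := by exact_mod_cast hM
  push_cast
  field_simp

/-! ### The maximal function of the zonal averages. -/

/-- A satellite configuration involves only distances between centres, so one in the subset is also
one in the ambient space. -/
theorem hasBesicovitchCovering_subtype {E : Type*} [MetricSpace E] [HasBesicovitchCovering E]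
    (s : Set E) : HasBesicovitchCovering s := by
  obtain ⟨n, τ, hτ, he⟩ := HasBesicovitchCovering.no_satelliteConfig (α := E)
  exact ⟨n, τ, hτ, ⟨fun a => he.false
    ⟨fun i => a.c i, a.r, a.rpos, a.h, a.hlast, a.inter⟩⟩⟩

/-- The weak type estimate for centered maximal functions in a space with the Besicovitch
covering property. -/
theorem exists_weak_type {α : Type*} [MetricSpace α] [SecondCountableTopology α]
    [MeasurableSpace α] [OpensMeasurableSpace α] [HasBesicovitchCovering α] (R : ℝ) :
    ∃ C : ℕ, ∀ (μ ν : Measure α) (s : ℝ≥0∞) (A : Set α),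
      (∀ x ∈ A, ∃ r, 0 < r ∧ r ≤ R ∧ s * μ (closedBall x r) ≤ ν (closedBall x r)) →
        s * μ A ≤ C * ν Set.univ := by
  obtain ⟨n, τ, hτ, he⟩ := HasBesicovitchCovering.no_satelliteConfig (α := α)
  refine ⟨n, fun μ ν s A hA => ?_⟩
  choose! r hr0 hrR hr using hA
  let q : Besicovitch.BallPackage A α :=
    ⟨fun x => x, fun x => r x, fun x => hr0 x x.2, R, fun x => hrR x x.2⟩
  -- The number `n` of disjoint families depends on the space alone, not on `μ`, `ν`, `s` or `A`; it
  -- is the constant of the estimate.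
  obtain ⟨t, hdisj, hcov⟩ := Besicovitch.exist_disjoint_covering_families hτ he q
  have hcount : ∀ i, (t i).Countable := fun i =>
    (hdisj i).countable_of_nonempty_interior fun x _ =>
      ⟨x, ball_subset_interior_closedBall (mem_ball_self (hr0 x x.2))⟩
  have hsub : A ⊆ ⋃ i : Fin n, ⋃ j ∈ t i, closedBall (q.c j) (q.r j) := by
    intro x hx
    have := hcov ⟨⟨x, hx⟩, rfl⟩
    simp only [Set.mem_iUnion] at this ⊢
    obtain ⟨i, j, hj, hb⟩ := this
    exact ⟨i, j, hj, ball_subset_closedBall hb⟩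
  calc s * μ A ≤ s * ∑ i : Fin n, ∑' j : t i, μ (closedBall (q.c j) (q.r j)) := by
        gcongr
        refine (measure_mono hsub).trans ((measure_iUnion_fintype_le _ _).trans ?_)
        exact Finset.sum_le_sum fun i _ => measure_biUnion_le μ (hcount i) _
    _ = ∑ i : Fin n, ∑' j : t i, s * μ (closedBall (q.c j) (q.r j)) := by
        rw [Finset.mul_sum]
        simp_rw [ENNReal.tsum_mul_left]
    _ ≤ ∑ i : Fin n, ∑' j : t i, ν (closedBall (q.c j) (q.r j)) :=
        Finset.sum_le_sum fun i _ => ENNReal.tsum_le_tsum fun j => hr _ j.1.2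
    _ ≤ ∑ _i : Fin n, ν Set.univ := by
        refine Finset.sum_le_sum fun i _ => ?_
        rw [← measure_biUnion (hcount i) (hdisj i) fun j _ => measurableSet_closedBall]
        exact measure_mono (Set.subset_univ _)
    _ = n * ν Set.univ := by simp

theorem dist_sq_sph {N : ℕ} (x y : Sph N) : dist y x ^ 2
    = 2 - 2 * inner ℝ (x : EuclideanSpace ℝ (Fin (N + 1)))
        (y : EuclideanSpace ℝ (Fin (N + 1))) := by
  rw [Subtype.dist_eq, dist_eq_norm, norm_sub_sq_real, real_inner_comm]
  simp
  ring

theorem zonal_le_zonal {N : ℕ} {x y z : Sph N} (h : dist z x ≤ dist y x) (n : ℕ) :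
    zonal x n y ≤ zonal x n z := by
  have h1 : dist z x ^ 2 ≤ dist y x ^ 2 := pow_le_pow_left₀ dist_nonneg h 2
  rw [dist_sq_sph, dist_sq_sph] at h1
  have h2 := zonal_nonneg x 1 y
  simp only [zonal, pow_one] at h2
  exact pow_le_pow_left₀ h2 (by linarith) n

/-- The kernel decreases with the distance to `x`, so the superlevel set is the ball whose radius is
the largest distance attained on it. -/
theorem exists_superlevel_eq_closedBall {N : ℕ} (x : Sph N) (n : ℕ) {t : ℝ}
    (ht : t < zonal x n x) : ∃ r, 0 < r ∧ {y | t ≤ zonal x n y} = closedBall x r := by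
  have hc := continuous_zonal x n
  have hcl : IsClosed {y | t ≤ zonal x n y} := isClosed_le continuous_const hc
  obtain ⟨y, hy, hmax⟩ := hcl.isCompact.exists_isMaxOn ⟨x, ht.le⟩
    (continuous_id.dist continuous_const : Continuous fun y => dist y x).continuousOn
  obtain ⟨ρ, hρ, hsub⟩ := Metric.nhds_basis_closedBall.mem_iff.mp
    ((isOpen_lt continuous_const hc).mem_nhds ht)
  -- The number `ρ` keeps the radius positive in case the superlevel set is `{x}`.
  refine ⟨max ρ (dist y x), lt_max_of_lt_left hρ, Set.Subset.antisymm (fun z hz => ?_) ?_⟩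
  · exact mem_closedBall.mpr (le_max_of_le_right (hmax hz))
  · intro z hz
    rcases le_max_iff.mp (mem_closedBall.mp hz) with h | h
    · have h1 : t < zonal x n z := hsub (mem_closedBall.mpr h)
      exact h1.le
    · exact le_trans hy (zonal_le_zonal h n)

theorem lintegral_zonal {N : ℕ} (x : Sph N) (n : ℕ) :
    ∫⁻ y, ENNReal.ofReal (zonal x n y) ∂(σ N) = ENNReal.ofReal (zonalMass x n) :=
  (ofReal_integral_eq_lintegral_ofReal (continuous_zonal x n).integrable_sph
    (.of_forall (zonal_nonneg x n))).symm

/-- The layer cake formula, for `σ` and for the measure with density `F`, reduces the bound to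
superlevel sets of the kernel, which are balls about `x`. -/
theorem lintegral_zonal_mul_le {N : ℕ} {F : Sph N → ℝ≥0∞} (hF : AEMeasurable F (σ N)) {s : ℝ≥0∞}
    (hs : s ≠ ⊤) {x : Sph N}
    (h : ∀ r, 0 < r → ∫⁻ y in closedBall x r, F y ∂(σ N) ≤ s * σ N (closedBall x r)) (n : ℕ) :
    ∫⁻ y, ENNReal.ofReal (zonal x n y) * F y ∂(σ N) ≤ s * ENNReal.ofReal (zonalMass x n) := by
  set ν := (σ N).withDensity F
  have hc := continuous_zonal x n
  have h1 : ∫⁻ y, ENNReal.ofReal (zonal x n y) * F y ∂(σ N)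
      = ∫⁻ y, ENNReal.ofReal (zonal x n y) ∂ν := by
    rw [lintegral_withDensity_eq_lintegral_mul₀ hF
      hc.measurable.ennreal_ofReal.aemeasurable]
    simp [mul_comm]
  rw [h1, ← lintegral_zonal, lintegral_eq_lintegral_meas_le ν (.of_forall (zonal_nonneg x n))
    hc.measurable.aemeasurable, lintegral_eq_lintegral_meas_le (σ N)
    (.of_forall (zonal_nonneg x n)) hc.measurable.aemeasurable, ← lintegral_const_mul' _ _ hs]
  -- At the maximal height the superlevel set need not be a ball of positive radius; this single
  -- height is negligible.
  have hae : ∀ᵐ t ∂(volume.restrict (Set.Ioi (0 : ℝ))), t ≠ zonal x n x :=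
    ae_restrict_of_ae (Measure.ae_ne volume _)
  refine lintegral_mono_ae (hae.mono fun t ht => ?_)
  rcases lt_or_gt_of_ne ht with h2 | h2
  · obtain ⟨r, hr, e⟩ := exists_superlevel_eq_closedBall x n h2
    rw [e, withDensity_apply _ measurableSet_closedBall]
    exact h r hr
  · have e : {y | t ≤ zonal x n y} = ∅ := by
      refine Set.eq_empty_of_forall_notMem fun y hy => ?_
      have := zonal_le_zonal (x := x) (y := y) (z := x) (by simp) n
      exact absurd (le_trans hy this) (not_le.mpr h2)
    simp [e]

/-- The maximal operator `sup_n` of the averages with kernels `(1 + ⟨x, y⟩) ^ n`. -/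
def zonalMax {N : ℕ} (F : Sph N → ℝ≥0∞) (x : Sph N) : ℝ≥0∞ :=
  ⨆ n, ENNReal.ofReal (zonalMass x n)⁻¹ * ∫⁻ y, ENNReal.ofReal (zonal x n y) * F y ∂(σ N)

theorem zonalMax_congr {N : ℕ} {F G : Sph N → ℝ≥0∞} (h : F =ᵐ[σ N] G) :
    zonalMax F = zonalMax G := by
  funext x
  refine iSup_congr fun n => ?_
  congr 1
  exact lintegral_congr_ae (h.mono fun y hy => by simp only [hy])

theorem enorm_zonalAvg_le {N : ℕ} {F : Type*} [NormedAddCommGroup F] [NormedSpace ℝ F]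
    (n : ℕ) (f : Sph N → F) (x : Sph N) :
    ‖zonalAvg n f x‖ₑ ≤ zonalMax (fun y => ‖f y‖ₑ) x := by
  refine le_iSup_of_le n ?_
  rw [zonalAvg, enorm_smul, Real.enorm_of_nonneg (inv_nonneg.mpr (zonalMass_pos x n).le)]
  gcongr
  refine (enorm_integral_le_lintegral_enorm _).trans (lintegral_mono fun y => ?_)
  rw [enorm_smul, Real.enorm_of_nonneg (zonal_nonneg x n y)]

theorem measurable_zonalMax {N : ℕ} (hN : 1 ≤ N) {F : Sph N → ℝ≥0∞}
    (hF : AEMeasurable F (σ N)) : Measurable (zonalMax F) := by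
  rw [zonalMax_congr hF.ae_eq_mk]
  refine Measurable.iSup fun n => ?_
  refine Measurable.mul ?_ ?_
  · rcases isEmpty_or_nonempty (Sph N) with h | ⟨⟨a⟩⟩
    · exact measurable_of_empty _
    · have : (fun x : Sph N => ENNReal.ofReal (zonalMass x n)⁻¹)
          = fun _ => ENNReal.ofReal (zonalMass a n)⁻¹ := by
        funext x
        rw [zonalMass_eq hN x a]
      rw [this]
      exact measurable_const
  · refine Measurable.lintegral_prod_right' (f := fun p : Sph N × Sph N =>
      ENNReal.ofReal (zonal p.1 n p.2) * hF.mk F p.2) ?_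
    have : Continuous fun p : Sph N × Sph N => zonal p.1 n p.2 := by
      unfold zonal
      fun_prop
    exact this.measurable.ennreal_ofReal.mul (hF.measurable_mk.comp measurable_snd)

theorem zonalMax_add_const_le {N : ℕ} {F G : Sph N → ℝ≥0∞} {s : ℝ≥0∞} (h : ∀ y, F y ≤ G y + s)
    (x : Sph N) : zonalMax F x ≤ zonalMax G x + s := by
  refine iSup_le fun n => ?_
  have hz : Measurable fun y => ENNReal.ofReal (zonal x n y) :=
    (continuous_zonal x n).measurable.ennreal_ofReal
  have h1 : ∫⁻ y, ENNReal.ofReal (zonal x n y) * F y ∂(σ N)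
      ≤ ∫⁻ y, ENNReal.ofReal (zonal x n y) * G y ∂(σ N) + ENNReal.ofReal (zonalMass x n) * s := by
    rw [← lintegral_zonal, ← lintegral_mul_const _ hz,
      ← lintegral_add_right _ (hz.mul_const s)]
    refine lintegral_mono fun y => ?_
    rw [← mul_add]
    exact mul_le_mul_right (h y) _
  refine (mul_le_mul_right h1 _).trans ?_
  rw [mul_add, ← mul_assoc, ← ENNReal.ofReal_mul (inv_nonneg.mpr (zonalMass_pos x n).le),
    inv_mul_cancel₀ (zonalMass_pos x n).ne', ENNReal.ofReal_one, one_mul]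
  gcongr
  exact le_iSup (fun n => ENNReal.ofReal (zonalMass x n)⁻¹
    * ∫⁻ y, ENNReal.ofReal (zonal x n y) * G y ∂(σ N)) n

/-- If the maximal function exceeds `s` at `x`, then so does the mean of `F` over some ball about
`x`, by `lintegral_zonal_mul_le`; the covering estimate applies to these balls. -/
theorem exists_zonalMax_weak_type (N : ℕ) :
    ∃ C : ℕ, ∀ F : Sph N → ℝ≥0∞, AEMeasurable F (σ N) → ∀ s : ℝ≥0∞, s ≠ ⊤ →
      s * σ N {x | s < zonalMax F x} ≤ C * ∫⁻ y, F y ∂(σ N) := by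
  have := hasBesicovitchCovering_subtype (sphere (0 : EuclideanSpace ℝ (Fin (N + 1))) 1)
  obtain ⟨C, hC⟩ := exists_weak_type (α := Sph N) 3
  refine ⟨C, fun F hF s hs => ?_⟩
  have h := hC (σ N) ((σ N).withDensity F) s {x | s < zonalMax F x} fun x hx => ?_
  · simpa using h
  · by_contra! hcon
    refine (show s < zonalMax F x from hx).not_ge (iSup_le fun n => ?_)
    have hb : ∀ r, 0 < r →
        ∫⁻ y in closedBall x r, F y ∂(σ N) ≤ s * σ N (closedBall x r) := by
      intro r hr
      -- The sphere has diameter at most `2`, so radii above `3` give nothing new and the radii stay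
      -- bounded.
      have e : closedBall x r = closedBall x (min r 3) := by
        refine Set.Subset.antisymm (fun y hy => ?_) (closedBall_subset_closedBall (min_le_left _ _))
        refine mem_closedBall.mpr (le_min (mem_closedBall.mp hy) ?_)
        have h1 := dist_sq_sph x y
        have h2 := abs_real_inner_le_norm (x : EuclideanSpace ℝ (Fin (N + 1)))
          (y : EuclideanSpace ℝ (Fin (N + 1)))
        simp only [norm_eq_of_mem_sphere, mul_one] at h2
        nlinarith [(abs_le.mp h2).1]
      have h1 := (hcon (min r 3) (lt_min hr (by norm_num)) (min_le_right _ _)).le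
      rwa [withDensity_apply _ measurableSet_closedBall, ← e] at h1
    have hm := zonalMass_pos x n
    calc ENNReal.ofReal (zonalMass x n)⁻¹ * ∫⁻ y, ENNReal.ofReal (zonal x n y) * F y ∂(σ N)
        ≤ ENNReal.ofReal (zonalMass x n)⁻¹ * (s * ENNReal.ofReal (zonalMass x n)) := by
          gcongr
          exact lintegral_zonal_mul_le hF hs hb n
      _ = s := by
          rw [mul_left_comm, ← ENNReal.ofReal_mul (inv_nonneg.mpr hm.le), inv_mul_cancel₀ hm.ne',
            ENNReal.ofReal_one, mul_one]

theorem lintegral_two_mul_indicator (a : ℝ) (ha : 0 ≤ a) :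
    ∫⁻ t in Set.Ioi (0 : ℝ), Set.indicator {t : ℝ | t < a} (fun t => ENNReal.ofReal (2 * t)) t
      = ENNReal.ofReal a ^ 2 := by
  have hs : MeasurableSet {t : ℝ | t < a} := measurableSet_Iio
  rw [lintegral_indicator hs, Measure.restrict_restrict hs,
    show {t : ℝ | t < a} ∩ Set.Ioi 0 = Set.Ioo 0 a by ext t; simp [and_comm],
    ← ofReal_integral_eq_lintegral_ofReal, ← integral_Ioc_eq_integral_Ioo,
    ← intervalIntegral.integral_of_le ha, ← ENNReal.ofReal_pow ha]
  · rw [intervalIntegral.integral_const_mul, integral_id]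
    congr 1
    ring
  · exact (continuous_const.mul continuous_id).continuousOn.integrableOn_Icc.mono_set
      Set.Ioo_subset_Icc_self
  · filter_upwards [ae_restrict_mem measurableSet_Ioo] with t ht
    exact mul_nonneg zero_le_two ht.1.le

/-- Layer cake formula for the square, derived from finite `b ≤ a` so that `a = ∞` is included. -/
theorem sq_le_lintegral (a : ℝ≥0∞) :
    a ^ 2 ≤ ∫⁻ t in Set.Ioi (0 : ℝ),
      Set.indicator {t : ℝ | ENNReal.ofReal t < a} (fun t => ENNReal.ofReal (2 * t)) t := by
  have key : ∀ b : ℝ≥0, (b : ℝ≥0∞) ≤ a → (b : ℝ≥0∞) ^ 2 ≤ ∫⁻ t in Set.Ioi (0 : ℝ),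
      Set.indicator {t : ℝ | ENNReal.ofReal t < a} (fun t => ENNReal.ofReal (2 * t)) t := by
    intro b hb
    rw [← ENNReal.ofReal_coe_nnreal, ← lintegral_two_mul_indicator b b.2]
    refine setLIntegral_mono' measurableSet_Ioi fun t ht => ?_
    by_cases htb : t < b
    · have h1 : ENNReal.ofReal t < a := lt_of_lt_of_le
        (by rw [← ENNReal.ofReal_coe_nnreal]
            exact (ENNReal.ofReal_lt_ofReal_iff (lt_trans ht htb)).mpr htb) hb
      rw [Set.indicator_of_mem (show t ∈ {t : ℝ | t < b} from htb),
        Set.indicator_of_mem (show t ∈ {t : ℝ | ENNReal.ofReal t < a} from h1)]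
    · rw [Set.indicator_of_notMem (show t ∉ {t : ℝ | t < b} from htb)]
      exact zero_le
  induction a with
  | top =>
    refine le_of_le_of_eq le_top (ENNReal.eq_top_of_forall_nnreal_le fun r => ?_).symm
    refine le_trans ?_ (key (r + 1) le_top)
    exact_mod_cast (by nlinarith [r.2] : r ≤ (r + 1) ^ 2)
  | coe b => exact key b le_rfl

/-- The maximal operator of the zonal averages is bounded on `L_2`. -/
theorem exists_lintegral_zonalMax_sq_le {N : ℕ} (hN : 1 ≤ N) :
    ∃ C : ℕ, ∀ F : Sph N → ℝ≥0∞, AEMeasurable F (σ N) →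
      ∫⁻ x, zonalMax F x ^ 2 ∂(σ N) ≤ C * ∫⁻ y, F y ^ 2 ∂(σ N) := by
  obtain ⟨C, hC⟩ := exists_zonalMax_weak_type N
  -- The constant is `4 · 2`: the weak type estimate is used at height `t / 2`, with `2 t = 4 (t /
  -- 2)`, and for fixed `y` the heights with `t / 2 < F y` form an interval of length `2 F y`.
  refine ⟨8 * C, ?_⟩
  suffices H : ∀ F : Sph N → ℝ≥0∞, Measurable F →
      ∫⁻ x, zonalMax F x ^ 2 ∂(σ N) ≤ (8 * C : ℕ) * ∫⁻ y, F y ^ 2 ∂(σ N) by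
    intro F hF
    rw [zonalMax_congr hF.ae_eq_mk]
    refine (H _ hF.measurable_mk).trans_eq ?_
    congr 1
    exact lintegral_congr_ae (hF.ae_eq_mk.mono fun y hy => by simp only [hy])
  intro F hF
  have hG := measurable_zonalMax hN hF.aemeasurable
  -- the weak type estimate applied to the part of `F` above half of the height
  have hweak : ∀ t : ℝ, 0 < t → ENNReal.ofReal (2 * t) * σ N {x | ENNReal.ofReal t < zonalMax F x}
      ≤ 4 * C * ∫⁻ y, Set.indicator {y | ENNReal.ofReal (t / 2) < F y} F y ∂(σ N) := by
    intro t ht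
    set s := ENNReal.ofReal (t / 2) with hs
    have hms : MeasurableSet {y | s < F y} := measurableSet_lt measurable_const hF
    have h1 := hC (Set.indicator {y | s < F y} F) (hF.indicator hms).aemeasurable s
      ENNReal.ofReal_ne_top
    have hts : ENNReal.ofReal t = s + s := by
      rw [hs, ← ENNReal.ofReal_add (by positivity) (by positivity), add_halves]
    have h2 : {x | ENNReal.ofReal t < zonalMax F x}
        ⊆ {x | s < zonalMax (Set.indicator {y | s < F y} F) x} := by
      intro x hx
      have hx' : ENNReal.ofReal t < zonalMax F x := hx
      have h3 : zonalMax F x ≤ zonalMax (Set.indicator {y | s < F y} F) x + s := by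
        refine zonalMax_add_const_le (fun y => ?_) x
        by_cases hy : s < F y
        · rw [Set.indicator_of_mem (show y ∈ {y | s < F y} from hy)]
          exact le_self_add
        · exact (not_lt.mp hy).trans le_add_self
      have h4 := hx'.trans_le h3
      rw [hts] at h4
      exact lt_of_add_lt_add_right h4
    have h5 : ENNReal.ofReal (2 * t) = 4 * s := by
      rw [hs, ← ENNReal.ofReal_ofNat 4, ← ENNReal.ofReal_mul (by norm_num)]
      congr 1
      ring
    rw [h5, mul_assoc, mul_assoc]
    exact mul_le_mul_right ((mul_le_mul_right (measure_mono h2) _).trans h1) _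
  have hmeas1 : Measurable fun p : Sph N × ℝ =>
      Set.indicator {t : ℝ | ENNReal.ofReal t < zonalMax F p.1}
        (fun t => ENNReal.ofReal (2 * t)) p.2 := by
    have hset : MeasurableSet {p : Sph N × ℝ | ENNReal.ofReal p.2 < zonalMax F p.1} :=
      measurableSet_lt measurable_snd.ennreal_ofReal (hG.comp measurable_fst)
    exact (measurable_snd.const_mul (2 : ℝ)).ennreal_ofReal.indicator hset
  have hmeas2 : Measurable fun p : ℝ × Sph N =>
      Set.indicator {y | ENNReal.ofReal (p.1 / 2) < F y} F p.2 := by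
    have hset : MeasurableSet {p : ℝ × Sph N | ENNReal.ofReal (p.1 / 2) < F p.2} :=
      measurableSet_lt (measurable_fst.div_const 2).ennreal_ofReal (hF.comp measurable_snd)
    exact (hF.comp measurable_snd).indicator hset
  calc ∫⁻ x, zonalMax F x ^ 2 ∂(σ N)
      ≤ ∫⁻ x, (∫⁻ t in Set.Ioi (0 : ℝ), Set.indicator {t : ℝ | ENNReal.ofReal t < zonalMax F x}
          (fun t => ENNReal.ofReal (2 * t)) t) ∂(σ N) :=
        lintegral_mono fun x => sq_le_lintegral _
    _ = ∫⁻ t in Set.Ioi (0 : ℝ), ∫⁻ x, Set.indicator {t : ℝ | ENNReal.ofReal t < zonalMax F x}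
          (fun t => ENNReal.ofReal (2 * t)) t ∂(σ N) :=
        lintegral_lintegral_swap hmeas1.aemeasurable
    _ = ∫⁻ t in Set.Ioi (0 : ℝ),
          ENNReal.ofReal (2 * t) * σ N {x | ENNReal.ofReal t < zonalMax F x} := by
        refine lintegral_congr fun t => ?_
        rw [← setLIntegral_const, ← lintegral_indicator (measurableSet_lt measurable_const hG)]
        rfl
    _ ≤ ∫⁻ t in Set.Ioi (0 : ℝ),
          4 * C * ∫⁻ y, Set.indicator {y | ENNReal.ofReal (t / 2) < F y} F y ∂(σ N) :=
        setLIntegral_mono' measurableSet_Ioi fun t ht => hweak t ht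
    _ = 4 * C * ∫⁻ y, (∫⁻ t in Set.Ioi (0 : ℝ),
          Set.indicator {y | ENNReal.ofReal (t / 2) < F y} F y) ∂(σ N) := by
        rw [lintegral_const_mul' _ _ (ENNReal.mul_ne_top (by simp) (by simp)),
          lintegral_lintegral_swap hmeas2.aemeasurable]
    _ ≤ 4 * C * ∫⁻ y, 2 * F y ^ 2 ∂(σ N) := by
        gcongr with y
        have e : ∀ t : ℝ, Set.indicator {y | ENNReal.ofReal (t / 2) < F y} F y
            = Set.indicator {t : ℝ | ENNReal.ofReal (t / 2) < F y} (fun _ => F y) t :=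
          fun t => rfl
        simp_rw [e]
        have hset : MeasurableSet {t : ℝ | ENNReal.ofReal (t / 2) < F y} :=
          measurableSet_lt (measurable_id.div_const 2).ennreal_ofReal measurable_const
        rw [lintegral_indicator hset, setLIntegral_const, Measure.restrict_apply hset, sq,
          mul_left_comm]
        gcongr
        rcases eq_or_ne (F y) ⊤ with h | h
        · simp [h]
        · refine (measure_mono (t := Set.Ioo 0 (2 * (F y).toReal)) fun t ht => ?_).trans ?_
          · refine ⟨ht.2, ?_⟩
            have h1 := (ENNReal.ofReal_lt_iff_lt_toReal (div_nonneg (le_of_lt ht.2) zero_le_two)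
              h).mp ht.1
            linarith
          · rw [Real.volume_Ioo, sub_zero, ENNReal.ofReal_mul zero_le_two, ENNReal.ofReal_toReal h]
            simp
    _ = (8 * C : ℕ) * ∫⁻ y, F y ^ 2 ∂(σ N) := by
        rw [lintegral_const_mul' _ _ (by simp), ← mul_assoc]
        congr 1
        push_cast
        ring

/-! ### Beta integrals and the square integral of the multiplier difference. -/

theorem intervalIntegrable_rpow_mul_rpow {β : ℝ} (hβ : -1 < β) {a b : ℝ} (hab : a < b) :
    IntervalIntegrable (fun u => (b - u) ^ β * (u - a) ^ β) volume a b := by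
  have h1 : a < (a + b) / 2 := by linarith
  have h2 : (a + b) / 2 < b := by linarith
  refine IntervalIntegrable.trans (b := (a + b) / 2) ?_ ?_
  · refine IntervalIntegrable.continuousOn_mul ?_ ?_
    · have := (intervalIntegral.intervalIntegrable_rpow' hβ (a := 0)
        (b := (a + b) / 2 - a)).comp_sub_right a
      simpa using this
    · refine ContinuousOn.rpow_const (by fun_prop) fun u hu => Or.inl ?_
      rw [Set.uIcc_of_le h1.le] at hu
      linarith [hu.2]
  · refine IntervalIntegrable.mul_continuousOn ?_ ?_
    · have := (intervalIntegral.intervalIntegrable_rpow' hβ (a := b - (a + b) / 2)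
        (b := 0)).comp_sub_left b
      simpa using this
    · refine ContinuousOn.rpow_const (by fun_prop) fun u hu => Or.inl ?_
      rw [Set.uIcc_of_le h2.le] at hu
      linarith [hu.1]

/-- The Beta integral `B(β + 1, β + 1)`. -/
def symmBeta (β : ℝ) : ℝ := ∫ v in (0 : ℝ)..1, (1 - v) ^ β * (v - 0) ^ β

theorem symmBeta_pos {β : ℝ} (hβ : -1 < β) : 0 < symmBeta β := by
  refine intervalIntegral.intervalIntegral_pos_of_pos_on
    (intervalIntegrable_rpow_mul_rpow hβ zero_lt_one) (fun v hv => ?_) zero_lt_one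
  have h1 : 0 < 1 - v := sub_pos.mpr hv.2
  have h2 : 0 < v - 0 := sub_pos.mpr hv.1
  positivity

theorem integral_rpow_mul_rpow (β : ℝ) {a b : ℝ} (hab : a < b) :
    ∫ u in a..b, (b - u) ^ β * (u - a) ^ β = (b - a) ^ (2 * β + 1) * symmBeta β := by
  have hc : 0 < b - a := sub_pos.mpr hab
  have h := intervalIntegral.smul_integral_comp_mul_add (a := 0) (b := 1)
    (fun u => (b - u) ^ β * (u - a) ^ β) (b - a) a
  rw [mul_zero, mul_one, zero_add, sub_add_cancel] at h
  rw [← h, symmBeta, smul_eq_mul]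
  have e : ∫ v in (0 : ℝ)..1, (b - ((b - a) * v + a)) ^ β * ((b - a) * v + a - a) ^ β
      = ∫ v in (0 : ℝ)..1, (b - a) ^ (2 * β) * ((1 - v) ^ β * (v - 0) ^ β) := by
    refine intervalIntegral.integral_congr fun v hv => ?_
    rw [Set.uIcc_of_le zero_le_one] at hv
    have e1 : b - ((b - a) * v + a) = (b - a) * (1 - v) := by ring
    have e2 : (b - a) * v + a - a = (b - a) * (v - 0) := by ring
    rw [e1, e2, Real.mul_rpow hc.le (sub_nonneg.mpr hv.2), Real.mul_rpow hc.le
      (sub_nonneg.mpr hv.1), two_mul, Real.rpow_add hc]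
    ring
  rw [e, intervalIntegral.integral_const_mul, Real.rpow_add hc, Real.rpow_one]
  ring

/-- The left side vanishes to second order at `y = 1`, and `y ^ (2 β)` absorbs its growth at `0`
when `β < 0`. Bernoulli's inequality with an integer `m > β` serves for `β ≥ 0`; for `-1 < β < 0`
the bound `y ^ (β + 1) ≤ 1` suffices. -/
theorem exists_rpow_sub_one_sq_le {β : ℝ} (hβ : -1 < β) :
    ∃ K : ℝ, 0 ≤ K ∧ ∀ y : ℝ, 0 < y → y < 1 →
      (y ^ β - 1) ^ 2 ≤ K * ((1 - y) ^ 2 * (1 + y ^ (2 * β))) := by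
  obtain ⟨m, hm⟩ := exists_nat_gt β
  refine ⟨(m + 1) ^ 2, by positivity, fun y hy0 hy1 => ?_⟩
  have hyβ : 0 < y ^ β := Real.rpow_pos_of_pos hy0 β
  have e2 : y ^ (2 * β) = (y ^ β) ^ 2 := by
    rw [mul_comm, Real.rpow_mul hy0.le]
    norm_cast
  have hm0 : (0 : ℝ) ≤ m := Nat.cast_nonneg m
  have hs : 0 < 1 - y := sub_pos.mpr hy1
  rcases le_or_gt 0 β with h | h
  · have h1 : y ^ β ≤ 1 := Real.rpow_le_one hy0.le hy1.le h
    have h2 : 1 - m * (1 - y) ≤ y ^ β := by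
      calc 1 - m * (1 - y) = 1 + m * (y - 1) := by ring
        _ ≤ (1 + (y - 1)) ^ m := one_add_mul_le_pow (by linarith) m
        _ = y ^ (m : ℝ) := by rw [add_sub_cancel, Real.rpow_natCast]
        _ ≤ y ^ β := Real.rpow_le_rpow_of_exponent_ge hy0 hy1.le hm.le
    have h3 : (y ^ β - 1) ^ 2 ≤ (m * (1 - y)) ^ 2 :=
      sq_le_sq' (by linarith) (by nlinarith)
    rw [e2]
    calc (y ^ β - 1) ^ 2 ≤ (m * (1 - y)) ^ 2 := h3
      _ ≤ ((m + 1) * (1 - y)) ^ 2 * (1 + (y ^ β) ^ 2) := by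
        have h4 : (m * (1 - y)) ^ 2 ≤ ((m + 1) * (1 - y)) ^ 2 :=
          pow_le_pow_left₀ (by positivity) (by nlinarith) 2
        nlinarith [sq_nonneg (y ^ β), sq_nonneg ((m + 1) * (1 - y))]
      _ = _ := by ring
  · have h1 : y ≤ y ^ (-β) := by
      calc y = y ^ (1 : ℝ) := (Real.rpow_one y).symm
        _ ≤ y ^ (-β) := Real.rpow_le_rpow_of_exponent_ge hy0 hy1.le (by linarith)
    have h2 : y ^ β * y ^ (-β) = 1 := by
      rw [← Real.rpow_add hy0, add_neg_cancel, Real.rpow_zero]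
    have h3 : 1 ≤ y ^ β := Real.one_le_rpow_of_pos_of_le_one_of_nonpos hy0 hy1.le h.le
    have h4 : y ^ β - 1 ≤ y ^ β * (1 - y) := by nlinarith
    have h5 : (y ^ β - 1) ^ 2 ≤ (y ^ β * (1 - y)) ^ 2 :=
      pow_le_pow_left₀ (by linarith) h4 2
    rw [e2]
    have h6 : (1 : ℝ) ≤ (m + 1) ^ 2 := by nlinarith
    have h7 : 0 ≤ (1 - y) ^ 2 * (1 + (y ^ β) ^ 2) := by positivity
    nlinarith [sq_nonneg (1 - y)]

/-- The antiderivative is `(1 - c / u) ^ (γ + 1) / (γ + 1)`. The value does not depend on `c`, which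
later makes the estimates uniform in `λ_k`. -/
theorem lintegral_Ioi_div_sq_mul_rpow {c γ : ℝ} (hc : 0 < c) (hγ : -1 < γ) :
    ∫⁻ u in Set.Ioi c, ENNReal.ofReal (c / u ^ 2 * (1 - c / u) ^ γ)
      = ENNReal.ofReal (1 / (γ + 1)) := by
  have hγ1 : 0 < γ + 1 := by linarith
  set g : ℝ → ℝ := fun u => (1 - c / u) ^ (γ + 1) / (γ + 1) with hg
  have hpos : ∀ u ∈ Set.Ioi c, 0 < 1 - c / u := fun u hu =>
    sub_pos.mpr ((div_lt_one (hc.trans hu)).mpr hu)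
  have hcont : ContinuousWithinAt g (Set.Ici c) c := by
    refine ContinuousAt.continuousWithinAt ?_
    refine ContinuousAt.div_const (ContinuousAt.rpow_const ?_ (Or.inr hγ1.le)) _
    exact continuousAt_const.sub (continuousAt_const.div continuousAt_id hc.ne')
  have hder : ∀ u ∈ Set.Ioi c, HasDerivAt g (c / u ^ 2 * (1 - c / u) ^ γ) u := by
    intro u hu
    have hu0 : u ≠ 0 := (hc.trans hu).ne'
    have h1 : HasDerivAt (fun u : ℝ => 1 - c / u) (c / u ^ 2) u := by
      have := (((hasDerivAt_id u).fun_inv hu0).const_mul c).const_sub 1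
      refine (this.congr_deriv ?_).congr_of_eventuallyEq (.of_forall fun v => ?_)
      · simp [div_eq_mul_inv]
      · simp [div_eq_mul_inv]
    refine ((h1.rpow_const (p := γ + 1) (Or.inl (hpos u hu).ne')).div_const (γ + 1)).congr_deriv ?_
    rw [add_sub_cancel_right]
    field_simp
  have hnn : ∀ u ∈ Set.Ioi c, 0 ≤ c / u ^ 2 * (1 - c / u) ^ γ := fun u hu => by
    have := hpos u hu
    positivity
  have hlim : Tendsto g atTop (𝓝 (1 / (γ + 1))) := by
    have h1 : Tendsto (fun u : ℝ => 1 - c / u) atTop (𝓝 1) := by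
      simpa [div_eq_mul_inv] using (tendsto_const_nhds (x := (1 : ℝ))).sub
        ((tendsto_inv_atTop_zero (𝕜 := ℝ)).const_mul c)
    have h2 := (h1.rpow_const (p := γ + 1) (Or.inl one_ne_zero)).div_const (γ + 1)
    rwa [Real.one_rpow] at h2
  have hgc : g c = 0 := by
    simp [hg, div_self hc.ne', Real.zero_rpow hγ1.ne']
  rw [← ofReal_integral_eq_lintegral_ofReal
    (integrableOn_Ioi_deriv_of_nonneg hcont hder hnn hlim)
    ((ae_restrict_mem measurableSet_Ioi).mono hnn),
    integral_Ioi_of_hasDerivAt_of_nonneg hcont hder hnn hlim, hgc, sub_zero]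

/-- The difference of the multipliers of the Riesz mean of order `β` and of the zonal average
of degree `⌊u⌋`. -/
def diffMult (N : ℕ) (β : ℝ) (k : ℕ) (u : ℝ) : ℝ :=
  (if eigenvalue N k < u then (1 - eigenvalue N k / u) ^ β else 0) - zonalMult N ⌊u⌋₊ k

theorem measurable_diffMult (N : ℕ) (β : ℝ) (k : ℕ) : Measurable (diffMult N β k) := by
  refine Measurable.sub (Measurable.ite measurableSet_Ioi ?_ measurable_const) ?_
  · fun_prop
  · exact (measurable_from_nat (f := fun n => zonalMult N n k)).comp Nat.measurable_floor

theorem natCast_le_eigenvalue {N : ℕ} (hN : 1 ≤ N) (k : ℕ) : (k : ℝ) ≤ eigenvalue N k := by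
  refine le_trans ?_ (sq_le_eigenvalue hN k)
  exact_mod_cast Nat.le_self_pow two_ne_zero k

/-- For `u ≤ λ_k` the Riesz multiplier is zero and the zonal one is `O(u / λ_k)`. For `u > λ_k`,
with `s = λ_k / u`, the zonal multiplier is `1 - O(s)`, and the squared difference is at most a
constant times `s (1 + (1 - s) ^ (2 β))`. The singularity at `s = 1` is integrable because `β >
-1/2`. For `k = 0` both multipliers equal `1`. -/
theorem exists_lintegral_diffMult_sq_le {N : ℕ} (hN : 1 ≤ N) {β : ℝ} (hβ : -1 / 2 < β) :
    ∃ C : ℝ≥0, ∀ k, ∫⁻ u in Set.Ioi (0 : ℝ), ENNReal.ofReal (diffMult N β k u ^ 2 / u) ≤ C := by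
  obtain ⟨K, hK0, hK⟩ := exists_rpow_sub_one_sq_le (β := β) (by linarith)
  set A : ℝ := 4 * (N + 1) ^ 2 with hA
  have hA0 : 0 ≤ A := by positivity
  refine ⟨Real.toNNReal A + Real.toNNReal (2 * K + 8) * (1 + Real.toNNReal (1 / (2 * β + 1))),
    fun k => ?_⟩
  rcases Nat.eq_zero_or_pos k with rfl | hk
  · refine le_of_eq_of_le ?_ zero_le
    rw [setLIntegral_congr_fun (g := fun _ => 0) measurableSet_Ioi fun u hu => ?_]
    · simp
    · have hu' : (0 : ℝ) < u := hu
      simp [diffMult, eigenvalue_zero, hu', zonalMult_zero]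
  set l := eigenvalue N k with hl
  have hl0 : 0 < l := eigenvalue_pos hN hk
  have hkl : (k : ℝ) ≤ l := natCast_le_eigenvalue hN k
  have hl1 : 1 ≤ l := le_trans (by exact_mod_cast hk) hkl
  rw [← Set.Ioc_union_Ioi_eq_Ioi hl0.le, lintegral_union measurableSet_Ioi
    (Set.Ioc_disjoint_Ioi le_rfl)]
  have hsmall : ∀ u ∈ Set.Ioc 0 l, ENNReal.ofReal (diffMult N β k u ^ 2 / u)
      ≤ ENNReal.ofReal (A / l) := by
    intro u hu
    refine ENNReal.ofReal_le_ofReal ?_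
    have h1 : diffMult N β k u = -zonalMult N ⌊u⌋₊ k := by
      simp [diffMult, ← hl, hu.2.not_gt]
    have h2 := zonalMult_nonneg hN ⌊u⌋₊ k
    have h3 : zonalMult N ⌊u⌋₊ k ≤ 2 * (N + 1) * u / l := by
      refine (zonalMult_le hN hk).trans ?_
      rw [← hl]
      gcongr
      exact Nat.floor_le hu.1.le
    rw [h1, neg_sq, div_le_div_iff₀ hu.1 hl0]
    calc zonalMult N ⌊u⌋₊ k ^ 2 * l ≤ (2 * (N + 1) * u / l) ^ 2 * l := by gcongr
      _ = A * u * (u / l) := by rw [hA]; field_simp; ring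
      _ ≤ A * u * 1 := by
        gcongr
        · exact mul_nonneg hA0 hu.1.le
        · exact (div_le_one hl0).mpr hu.2
      _ = A * u := mul_one _
  have hlarge : ∀ u ∈ Set.Ioi l, ENNReal.ofReal (diffMult N β k u ^ 2 / u)
      ≤ ENNReal.ofReal (2 * K + 8) * (ENNReal.ofReal (l / u ^ 2 * (1 - l / u) ^ (0 : ℝ))
        + ENNReal.ofReal (l / u ^ 2 * (1 - l / u) ^ (2 * β))) := by
    intro u hu
    have hu0 : 0 < u := hl0.trans hu
    have hu1 : 1 < u := hl1.trans_lt hu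
    set n := ⌊u⌋₊ with hn
    have hn0 : 0 < n := Nat.floor_pos.mpr hu1.le
    have hkn : k ≤ n := Nat.le_floor (hkl.trans (le_of_lt hu))
    have hnu : u / 2 ≤ n := by
      have h1 := Nat.lt_floor_add_one u
      have h2 : (1 : ℝ) ≤ n := by exact_mod_cast hn0
      rw [← hn] at h1
      linarith
    set s := l / u with hs
    have hs0 : 0 < s := div_pos hl0 hu0
    have hs1 : s < 1 := (div_lt_one hu0).mpr hu
    have h1 : 1 - zonalMult N n k ≤ 2 * s := by
      refine (one_sub_zonalMult_le hN hn0 hkn).trans ?_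
      rw [← hl, hs, mul_div_assoc', div_le_div_iff₀ (by exact_mod_cast hn0) hu0]
      nlinarith
    have h2 := zonalMult_le_one hN n k
    have h3 := hK (1 - s) (by linarith) (by linarith)
    rw [sub_sub_cancel] at h3
    have hy : 0 < (1 - s) ^ (2 * β) := Real.rpow_pos_of_pos (by linarith) _
    have h4 : diffMult N β k u = ((1 - s) ^ β - 1) + (1 - zonalMult N n k) := by
      rw [diffMult, ← hl, if_pos (show l < u from hu), ← hs, ← hn]
      ring
    have h5 : diffMult N β k u ^ 2 ≤ (2 * K + 8) * (s * (1 + (1 - s) ^ (2 * β))) := by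
      rw [h4]
      calc (((1 - s) ^ β - 1) + (1 - zonalMult N n k)) ^ 2
          ≤ 2 * ((1 - s) ^ β - 1) ^ 2 + 2 * (1 - zonalMult N n k) ^ 2 := by
            nlinarith [sq_nonneg (((1 - s) ^ β - 1) - (1 - zonalMult N n k))]
        _ ≤ 2 * (K * (s ^ 2 * (1 + (1 - s) ^ (2 * β)))) + 2 * (2 * s) ^ 2 := by
            have : (1 - zonalMult N n k) ^ 2 ≤ (2 * s) ^ 2 :=
              pow_le_pow_left₀ (by linarith) h1 2
            linarith
        _ ≤ (2 * K + 8) * (s ^ 2 * (1 + (1 - s) ^ (2 * β))) := by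
            nlinarith [mul_nonneg (sq_nonneg s) hy.le]
        _ ≤ (2 * K + 8) * (s * (1 + (1 - s) ^ (2 * β))) := by
            gcongr
            nlinarith
    rw [← ENNReal.ofReal_add (by rw [Real.rpow_zero]; positivity) (by positivity),
      ← ENNReal.ofReal_mul (by positivity)]
    refine ENNReal.ofReal_le_ofReal ?_
    rw [div_le_iff₀ hu0, Real.rpow_zero]
    refine h5.trans_eq ?_
    rw [hs]
    field_simp
  have hm : ∀ γ : ℝ, Measurable fun u : ℝ => ENNReal.ofReal (l / u ^ 2 * (1 - l / u) ^ γ) :=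
    fun γ => by fun_prop
  push_cast
  refine add_le_add ?_ ?_
  · refine (setLIntegral_mono' measurableSet_Ioc hsmall).trans ?_
    rw [setLIntegral_const, Real.volume_Ioc, sub_zero,
      ← ENNReal.ofReal_mul (div_nonneg hA0 hl0.le), div_mul_cancel₀ _ hl0.ne']
    rfl
  · refine (setLIntegral_mono' measurableSet_Ioi hlarge).trans ?_
    rw [lintegral_const_mul' _ _ ENNReal.ofReal_ne_top, lintegral_add_left (hm 0),
      lintegral_Ioi_div_sq_mul_rpow hl0 (by norm_num),
      lintegral_Ioi_div_sq_mul_rpow hl0 (by linarith)]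
    simp [ENNReal.ofReal]

/-! ### Integral representation of Riesz means and splitting off the zonal averages. -/

/-- The kernel `(t - u)^β u^β (1 - λ/u)_+^β` of the integral representation of Riesz means. -/
def rieszKernel (β t l u : ℝ) : ℝ :=
  (t - u) ^ β * u ^ β * if l < u then (1 - l / u) ^ β else 0

/-- Since `u ^ β (1 - l / u) ^ β = (u - l) ^ β`, the factor `u ^ β` turns the kernel into that of a
Beta integral on `(l, t]`. -/
theorem rieszKernel_eq_indicator (β t l : ℝ) :
    Set.EqOn (rieszKernel β t l)
      (Set.indicator (Set.Ioc l t) fun u => (t - u) ^ β * (u - l) ^ β) (Set.Ioc 0 t) := by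
  intro u hu
  by_cases h : l < u
  · rw [Set.indicator_of_mem (show u ∈ Set.Ioc l t from ⟨h, hu.2⟩), rieszKernel, if_pos h, mul_assoc,
      ← Real.mul_rpow hu.1.le (sub_nonneg.mpr ((div_le_one hu.1).mpr h.le)), mul_sub, mul_one,
      mul_div_cancel₀ _ hu.1.ne']
  · rw [Set.indicator_of_notMem (fun h' => h h'.1), rieszKernel, if_neg h, mul_zero]

theorem integrableOn_rieszKernel {β : ℝ} (hβ : -1 < β) {t l : ℝ} (hlt : l < t) :
    IntegrableOn (rieszKernel β t l) (Set.Ioc 0 t) := by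
  have h := (intervalIntegrable_iff_integrableOn_Ioc_of_le hlt.le).mp
    (intervalIntegrable_rpow_mul_rpow hβ hlt)
  refine IntegrableOn.congr_fun ?_ (rieszKernel_eq_indicator β t l).symm measurableSet_Ioc
  exact (h.integrable_indicator measurableSet_Ioc).integrableOn

theorem integral_rieszKernel {β : ℝ} {t l : ℝ} (hl : 0 ≤ l) (hlt : l < t) :
    ∫ u in Set.Ioc 0 t, rieszKernel β t l u = (t - l) ^ (2 * β + 1) * symmBeta β := by
  rw [setIntegral_congr_fun measurableSet_Ioc (rieszKernel_eq_indicator β t l),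
    setIntegral_indicator measurableSet_Ioc,
    Set.inter_eq_self_of_subset_right (Set.Ioc_subset_Ioc_left hl),
    ← intervalIntegral.integral_of_le hlt.le, integral_rpow_mul_rpow β hlt]

/-- Riesz means of order `2 β + 1` as averages of Riesz means of order `β`. -/
theorem rieszMean_eq_integral {N : ℕ} (hN : 1 ≤ N) {β : ℝ} (hβ : -1 < β) {t : ℝ} (ht : 0 < t)
    (f : Sph N → ℂ) (x : Sph N) :
    rieszMean N (2 * β + 1) t f x = ((symmBeta β * t ^ (2 * β + 1))⁻¹ : ℝ) •
      ∫ u in Set.Ioc 0 t, ((t - u) ^ β * u ^ β) • rieszMean N β u f x := by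
  have hB := symmBeta_pos hβ
  have hint : ∀ k ∈ (finite_eigenvalue_lt N t).toFinset, IntegrableOn
      (fun u => rieszKernel β t (eigenvalue N k) u • component N k f x) (Set.Ioc 0 t) := by
    intro k hk
    exact (integrableOn_rieszKernel hβ (by simpa using hk)).smul_const _
  -- The index set is enlarged to `λ_k < t`, independent of `u`, so that the finite sum and the
  -- integral can be exchanged.
  have hsum : ∀ u ∈ Set.Ioc 0 t, ((t - u) ^ β * u ^ β) • rieszMean N β u f x
      = ∑ k ∈ (finite_eigenvalue_lt N t).toFinset,
        rieszKernel β t (eigenvalue N k) u • component N k f x := by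
    intro u hu
    rw [rieszMean, Finset.smul_sum]
    have hsub : (finite_eigenvalue_lt N u).toFinset ⊆ (finite_eigenvalue_lt N t).toFinset := by
      intro k hk
      simp only [Set.Finite.mem_toFinset, Set.mem_ofPred_eq] at hk ⊢
      exact hk.trans_le hu.2
    rw [← Finset.sum_subset hsub fun k _ hk => ?_]
    · refine Finset.sum_congr rfl fun k hk => ?_
      rw [rieszKernel, if_pos (by simpa using hk), Complex.real_smul, Complex.real_smul]
      push_cast
      ring
    · rw [rieszKernel, if_neg (by simpa using hk), mul_zero, zero_smul]
  rw [setIntegral_congr_fun measurableSet_Ioc hsum, integral_finsetSum _ hint, Finset.smul_sum,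
    rieszMean]
  refine Finset.sum_congr rfl fun k hk => ?_
  have hkt : eigenvalue N k < t := by simpa using hk
  rw [integral_smul_const, integral_rieszKernel (eigenvalue_nonneg hN k) hkt, smul_smul,
    Complex.real_smul]
  congr 2
  have h1 : 1 - eigenvalue N k / t = (t - eigenvalue N k) / t := by field_simp
  have h2 : (0 : ℝ) < t ^ (2 * β + 1) := Real.rpow_pos_of_pos ht _
  rw [h1, Real.div_rpow (sub_nonneg.mpr hkt.le) ht.le]
  field_simp

/-- The difference of the Riesz mean of order `β` and the zonal average of degree `⌊u⌋`. -/
def diffMean (N : ℕ) (β : ℝ) (f : Sph N → ℂ) (u : ℝ) (x : Sph N) : ℂ :=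
  ∑ k ∈ Finset.range (⌊u⌋₊ + 1), (diffMult N β k u : ℂ) * component N k f x

theorem rieszMean_eq_add_diffMean {N : ℕ} (hN : 1 ≤ N) (β : ℝ) {f : Sph N → ℂ}
    (hf : MemLp f 2 (σ N)) (u : ℝ) (x : Sph N) :
    rieszMean N β u f x = zonalAvg ⌊u⌋₊ f x + diffMean N β f u x := by
  -- As `k ≤ λ_k`, the degrees up to `⌊u⌋` include all those of the Riesz mean.
  have hsub : (finite_eigenvalue_lt N u).toFinset ⊆ Finset.range (⌊u⌋₊ + 1) := by
    intro k hk
    have hk' : eigenvalue N k < u := by simpa using hk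
    exact Finset.mem_range_succ_iff.mpr
      (Nat.le_floor ((natCast_le_eigenvalue hN k).trans hk'.le))
  rw [zonalAvg_eq_sum_component hN hf, diffMean, ← Finset.sum_add_distrib, rieszMean]
  have hz : ∀ k ∈ Finset.range (⌊u⌋₊ + 1), k ∉ (finite_eigenvalue_lt N u).toFinset →
      (((if eigenvalue N k < u then (1 - eigenvalue N k / u) ^ β else 0 : ℝ) : ℂ)
        * component N k f x) = 0 := by
    intro k _ hk
    rw [if_neg (by simpa using hk)]
    simp
  calc _ = ∑ k ∈ (finite_eigenvalue_lt N u).toFinset,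
        ((if eigenvalue N k < u then (1 - eigenvalue N k / u) ^ β else 0 : ℝ) : ℂ)
          * component N k f x := by
        refine Finset.sum_congr rfl fun k hk => ?_
        rw [if_pos (by simpa using hk)]
    _ = _ := by
        rw [Finset.sum_subset hsub hz]
        refine Finset.sum_congr rfl fun k _ => ?_
        rw [diffMult]
        push_cast
        ring

theorem continuous_component (N k : ℕ) (f : Sph N → ℂ) : Continuous (component N k f) := by
  unfold component
  split_ifs with h
  · unfold fourierSum
    exact continuous_finsetSum _ fun j _ => (Complex.continuous_ofReal.comp
      (continuous_of_mem_harmonics (h.choose_spec.choose_spec.mem j))).mul continuous_const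
  · exact continuous_const

theorem continuous_rieszMean (N : ℕ) (α t : ℝ) (f : Sph N → ℂ) :
    Continuous (rieszMean N α t f) := by
  unfold rieszMean
  exact continuous_finsetSum _ fun k _ => continuous_const.mul (continuous_component N k f)

/-- The supremum is uncountable, but a supremum of continuous functions is lower semicontinuous. -/
theorem measurable_rieszMaximal (N : ℕ) (α : ℝ) (f : Sph N → ℂ) :
    Measurable (rieszMaximal N α f) := by
  refine LowerSemicontinuous.measurable ?_
  exact lowerSemicontinuous_iSup fun t => lowerSemicontinuous_iSup fun _ =>
    (continuous_rieszMean N α t f).enorm.lowerSemicontinuous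

/-- The range of summation depends on `u` only through `⌊u⌋`, which is treated as a separate
countable variable. -/
theorem measurable_diffMean (N : ℕ) (β : ℝ) (f : Sph N → ℂ) :
    Measurable fun p : ℝ × Sph N => diffMean N β f p.1 p.2 := by
  have h : ∀ n : ℕ, Measurable fun p : ℝ × Sph N => ∑ k ∈ Finset.range (n + 1),
      (diffMult N β k p.1 : ℂ) * component N k f p.2 := by
    intro n
    refine Finset.measurable_fun_sum _ fun k _ => ?_
    have h1 : Measurable fun p : ℝ × Sph N => (diffMult N β k p.1 : ℂ) :=
      Complex.measurable_ofReal.comp ((measurable_diffMult N β k).comp measurable_fst)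
    have h2 : Measurable fun p : ℝ × Sph N => component N k f p.2 :=
      (continuous_component N k f).measurable.comp measurable_snd
    exact h1.mul h2
  set g : ℕ → ℝ × Sph N → ℂ := fun n p => ∑ k ∈ Finset.range (n + 1),
    (diffMult N β k p.1 : ℂ) * component N k f p.2 with hg
  have h' : Measurable fun q : ℕ × (ℝ × Sph N) => g q.1 q.2 :=
    measurable_from_prod_countable_right h
  have hfl : Measurable fun p : ℝ × Sph N => (⌊p.1⌋₊, p) :=
    (Nat.measurable_floor.comp measurable_fst).prodMk measurable_id
  have e : (fun p : ℝ × Sph N => diffMean N β f p.1 p.2) = fun p => g ⌊p.1⌋₊ p := by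
    funext p
    rw [diffMean, hg]
  rw [e]
  clear_value g
  exact h'.comp hfl

/-! ### The square function and the maximal inequality. -/

/-- The square function which compares Riesz means of order `β` with zonal averages. -/
def squareFn (N : ℕ) (β : ℝ) (f : Sph N → ℂ) (x : Sph N) : ℝ≥0∞ :=
  ∫⁻ u in Set.Ioi (0 : ℝ), ‖diffMean N β f u x‖ₑ ^ 2 * ENNReal.ofReal (1 / u)

/-- The weight factor of the Cauchy–Schwarz step: `u ^ (2 β + 1)` is bounded by its value at `t`,
and `(t - u) ^ (2 β)` is integrable because `2 β > -1`. -/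
theorem lintegral_weight_sq_le {β : ℝ} (hβ : -1 / 2 < β) {t : ℝ} (ht : 0 < t) :
    ∫⁻ u in Set.Ioc 0 t, ENNReal.ofReal ((t - u) ^ β * u ^ β * √u) ^ 2
      ≤ ENNReal.ofReal (t ^ (2 * β + 1) * (t ^ (2 * β + 1) / (2 * β + 1))) := by
  have hα : 0 < 2 * β + 1 := by linarith
  have hint : IntervalIntegrable (fun u => (t - u) ^ (2 * β)) volume 0 t := by
    have := (intervalIntegral.intervalIntegrable_rpow' (by linarith : -1 < 2 * β) (a := t)
      (b := 0)).comp_sub_left t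
    simpa using this
  have hval : ∫ u in (0 : ℝ)..t, (t - u) ^ (2 * β) = t ^ (2 * β + 1) / (2 * β + 1) := by
    rw [intervalIntegral.integral_comp_sub_left (fun u => u ^ (2 * β)) t,
      integral_rpow (Or.inl (by linarith))]
    simp [Real.zero_rpow hα.ne']
  have hle : ∀ u ∈ Set.Ioc 0 t, ENNReal.ofReal ((t - u) ^ β * u ^ β * √u) ^ 2
      ≤ ENNReal.ofReal (t ^ (2 * β + 1)) * ENNReal.ofReal ((t - u) ^ (2 * β)) := by
    intro u hu
    have h1 : 0 ≤ t - u := sub_nonneg.mpr hu.2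
    have h0 : ∀ v : ℝ, 0 ≤ v → v ^ (2 * β) = (v ^ β) ^ 2 := fun v hv => by
      rw [mul_comm, Real.rpow_mul hv]
      norm_cast
    have h2 : u ^ (2 * β + 1) ≤ t ^ (2 * β + 1) := Real.rpow_le_rpow hu.1.le hu.2 hα.le
    have h3 := hu.1.le
    rw [← ENNReal.ofReal_pow (by positivity), ← ENNReal.ofReal_mul (by positivity)]
    refine ENNReal.ofReal_le_ofReal ?_
    calc ((t - u) ^ β * u ^ β * √u) ^ 2 = u ^ (2 * β + 1) * (t - u) ^ (2 * β) := by
          rw [mul_pow, mul_pow, Real.sq_sqrt hu.1.le, Real.rpow_add hu.1, Real.rpow_one,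
            h0 u hu.1.le, h0 _ h1]
          ring
      _ ≤ _ := by gcongr
  refine (setLIntegral_mono' measurableSet_Ioc hle).trans ?_
  rw [lintegral_const_mul' _ _ ENNReal.ofReal_ne_top, ← ofReal_integral_eq_lintegral_ofReal
    ((intervalIntegrable_iff_integrableOn_Ioc_of_le ht.le).mp hint),
    ← intervalIntegral.integral_of_le ht.le, hval, ← ENNReal.ofReal_mul (by positivity)]
  filter_upwards [ae_restrict_mem measurableSet_Ioc] with u hu
  exact Real.rpow_nonneg (sub_nonneg.mpr hu.2) _

/-- In the integral representation the zonal averages are bounded by the maximal function, and the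
weight has total mass equal to the normalization. The difference is treated by Cauchy–Schwarz. All
powers of `t` cancel, so the bound is uniform in `t`. -/
theorem enorm_rieszMean_le {N : ℕ} (hN : 1 ≤ N) {β : ℝ} (hβ : -1 / 2 < β) {f : Sph N → ℂ}
    (hf : MemLp f 2 (σ N)) {t : ℝ} (ht : 0 < t) (x : Sph N) :
    ‖rieszMean N (2 * β + 1) t f x‖ₑ ≤ zonalMax (fun y => ‖f y‖ₑ) x
      + ENNReal.ofReal ((symmBeta β)⁻¹ * √((2 * β + 1)⁻¹)) * squareFn N β f x ^ (1 / 2 : ℝ) := by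
  have hβ1 : -1 < β := by linarith
  have hα : 0 < 2 * β + 1 := by linarith
  have hB := symmBeta_pos hβ1
  have htα : 0 < t ^ (2 * β + 1) := Real.rpow_pos_of_pos ht _
  set c : ℝ := (symmBeta β * t ^ (2 * β + 1))⁻¹ with hc
  have hc0 : 0 ≤ c := by positivity
  set w : ℝ → ℝ := fun u => (t - u) ^ β * u ^ β with hw
  have hw0 : ∀ u ∈ Set.Ioc 0 t, 0 ≤ w u := fun u hu =>
    mul_nonneg (Real.rpow_nonneg (sub_nonneg.mpr hu.2) _) (Real.rpow_nonneg hu.1.le _)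
  have hwm : Measurable w := by fun_prop
  set V := zonalMax (fun y => ‖f y‖ₑ) x with hV
  have hwint : ∫⁻ u in Set.Ioc 0 t, ENNReal.ofReal (w u)
      = ENNReal.ofReal (t ^ (2 * β + 1) * symmBeta β) := by
    have h1 := (intervalIntegrable_iff_integrableOn_Ioc_of_le ht.le).mp
      (intervalIntegrable_rpow_mul_rpow hβ1 ht)
    have h2 := integral_rpow_mul_rpow β ht
    rw [intervalIntegral.integral_of_le ht.le] at h2
    simp only [sub_zero] at h1 h2
    rw [← h2, ofReal_integral_eq_lintegral_ofReal h1]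
    filter_upwards [ae_restrict_mem measurableSet_Ioc] with u hu using hw0 u hu
  have hDm : Measurable fun u => ‖diffMean N β f u x‖ₑ :=
    ((measurable_diffMean N β f).comp (measurable_id.prodMk measurable_const)).enorm
  have hCS : ∫⁻ u in Set.Ioc 0 t, ENNReal.ofReal (w u) * ‖diffMean N β f u x‖ₑ
      ≤ ENNReal.ofReal (t ^ (2 * β + 1) * √((2 * β + 1)⁻¹)) * squareFn N β f x ^ (1 / 2 : ℝ) := by
    -- The factor `√u · (√u)⁻¹` is inserted so that the second Cauchy–Schwarz factor carries the
    -- measure `du / u` of the square function.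
    have e : ∫⁻ u in Set.Ioc 0 t, ENNReal.ofReal (w u) * ‖diffMean N β f u x‖ₑ
        = ∫⁻ u in Set.Ioc 0 t, ((fun u => ENNReal.ofReal (w u * √u))
          * fun u => ‖diffMean N β f u x‖ₑ * ENNReal.ofReal (√u)⁻¹) u := by
      refine setLIntegral_congr_fun measurableSet_Ioc fun u hu => ?_
      have h1 : 0 < √u := Real.sqrt_pos.mpr hu.1
      simp only [Pi.mul_apply]
      rw [ENNReal.ofReal_mul (hw0 u hu), ENNReal.ofReal_inv_of_pos h1]
      have h2 : ENNReal.ofReal √u * (ENNReal.ofReal √u)⁻¹ = 1 :=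
        ENNReal.mul_inv_cancel (by simpa using hu.1) ENNReal.ofReal_ne_top
      calc ENNReal.ofReal (w u) * ‖diffMean N β f u x‖ₑ
          = ENNReal.ofReal (w u) * ‖diffMean N β f u x‖ₑ
            * (ENNReal.ofReal √u * (ENNReal.ofReal √u)⁻¹) := by rw [h2, mul_one]
        _ = _ := by ring
    rw [e]
    refine (ENNReal.lintegral_mul_le_Lp_mul_Lq _ Real.HolderConjugate.two_two
      (by fun_prop) (by fun_prop)).trans ?_
    simp only [ENNReal.rpow_two]
    refine mul_le_mul' ?_ ?_
    · have e1 : t ^ (2 * β + 1) * √((2 * β + 1)⁻¹)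
          = (t ^ (2 * β + 1) * (t ^ (2 * β + 1) / (2 * β + 1))) ^ (1 / 2 : ℝ) := by
        rw [← Real.sqrt_eq_rpow, div_eq_mul_inv, ← mul_assoc, Real.sqrt_mul (by positivity),
          Real.sqrt_mul_self htα.le]
      rw [e1, ← ENNReal.ofReal_rpow_of_nonneg (by positivity) (by norm_num)]
      exact ENNReal.rpow_le_rpow (lintegral_weight_sq_le hβ ht) (by norm_num)
    · refine ENNReal.rpow_le_rpow ?_ (by norm_num)
      rw [squareFn]
      refine le_trans (setLIntegral_mono' measurableSet_Ioc fun u hu => ?_)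
        (lintegral_mono_set (Set.Ioc_subset_Ioi_self))
      rw [mul_pow, ← ENNReal.ofReal_pow (by positivity), inv_pow, Real.sq_sqrt hu.1.le, one_div]
  rw [rieszMean_eq_integral hN hβ1 ht, enorm_smul, Real.enorm_of_nonneg hc0]
  calc ENNReal.ofReal c * ‖∫ u in Set.Ioc 0 t, w u • rieszMean N β u f x‖ₑ
      ≤ ENNReal.ofReal c * ∫⁻ u in Set.Ioc 0 t,
          (ENNReal.ofReal (w u) * V + ENNReal.ofReal (w u) * ‖diffMean N β f u x‖ₑ) := by
        gcongr
        refine (enorm_integral_le_lintegral_enorm _).trans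
          (setLIntegral_mono' measurableSet_Ioc fun u hu => ?_)
        rw [enorm_smul, Real.enorm_of_nonneg (hw0 u hu), ← mul_add,
          rieszMean_eq_add_diffMean hN β hf]
        gcongr
        exact (enorm_add_le _ _).trans (add_le_add_left (enorm_zonalAvg_le _ f x) _)
    _ = ENNReal.ofReal c * (ENNReal.ofReal (t ^ (2 * β + 1) * symmBeta β) * V
          + ∫⁻ u in Set.Ioc 0 t, ENNReal.ofReal (w u) * ‖diffMean N β f u x‖ₑ) := by
        rw [lintegral_add_left (hwm.ennreal_ofReal.mul_const V),
          lintegral_mul_const _ hwm.ennreal_ofReal, hwint]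
    _ ≤ ENNReal.ofReal c * (ENNReal.ofReal (t ^ (2 * β + 1) * symmBeta β) * V
          + ENNReal.ofReal (t ^ (2 * β + 1) * √((2 * β + 1)⁻¹))
            * squareFn N β f x ^ (1 / 2 : ℝ)) := by gcongr
    _ = _ := by
        rw [mul_add, ← mul_assoc, ← mul_assoc, ← ENNReal.ofReal_mul hc0, ← ENNReal.ofReal_mul hc0]
        have e1 : c * (t ^ (2 * β + 1) * symmBeta β) = 1 := by
          rw [hc]
          field_simp
        have e2 : c * (t ^ (2 * β + 1) * √((2 * β + 1)⁻¹))
            = (symmBeta β)⁻¹ * √((2 * β + 1)⁻¹) := by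
          rw [hc]
          field_simp
        rw [e1, e2, ENNReal.ofReal_one, one_mul]

theorem eLpNorm_two_sq {α E : Type*} [MeasurableSpace α] [TopologicalSpace E]
    [ContinuousENorm E] (f : α → E) (μ : Measure α) :
    eLpNorm f 2 μ ^ 2 = ∫⁻ x, ‖f x‖ₑ ^ 2 ∂μ := by
  have h := eLpNorm_nnreal_pow_eq_lintegral (μ := μ) (f := f) (p := 2) two_ne_zero
  simpa using h

/-- A spherical harmonic as a complex-valued continuous function. -/
def harmonicC {N k : ℕ} (u : Sph N → ℝ) (hu : u ∈ harmonics N k) : C(Sph N, ℂ) :=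
  ⟨fun y => (u y : ℂ), Complex.continuous_ofReal.comp (continuous_of_mem_harmonics hu)⟩

/-- Here `E k` is the squared `L_2` norm of the degree `k` component. Bessel's inequality and the
Pythagorean identity suffice; completeness of the harmonics is not used. -/
theorem exists_energy {N : ℕ} (hN : 1 ≤ N) {f : Sph N → ℂ} (hf : MemLp f 2 (σ N)) :
    ∃ E : ℕ → ℝ≥0∞, (∀ K, ∑ k ∈ Finset.range K, E k ≤ ∫⁻ x, ‖f x‖ₑ ^ 2 ∂(σ N)) ∧
      ∀ (a : ℕ → ℝ) (K : ℕ),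
        ∫⁻ x, ‖∑ k ∈ Finset.range K, (a k : ℂ) * component N k f x‖ₑ ^ 2 ∂(σ N)
          = ∑ k ∈ Finset.range K, ENNReal.ofReal (a k ^ 2) * E k := by
  choose m Y hY using exists_harmonicBasis hN
  set T := ContinuousMap.toLp (E := ℂ) 2 (σ N) ℂ with hT
  set y : (Σ k, Fin (m k)) → C(Sph N, ℂ) := fun i => harmonicC _ ((hY i.1).mem i.2) with hy
  have horth : Orthonormal ℂ fun i => T (y i) := by
    classical
    rw [orthonormal_iff_ite]
    rintro ⟨k, i⟩ ⟨l, j⟩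
    rw [hT, ContinuousMap.inner_toLp]
    have e : ∀ x, y ⟨l, j⟩ x * (starRingEnd ℂ) (y ⟨k, i⟩ x) = ((Y l j x * Y k i x : ℝ) : ℂ) := by
      intro x
      simp [hy, harmonicC]
    simp_rw [e]
    rw [integral_complex_ofReal]
    by_cases hkl : k = l
    · subst hkl
      rw [(hY k).orthonormal]
      by_cases hij : i = j
      · simp [hij]
      · simp [hij, Ne.symm hij]
    · rw [integral_mul_eq_zero_of_mem_harmonics hN (Ne.symm hkl) ((hY l).mem j) ((hY k).mem i)]
      simp [hkl]
  set c : (Σ k, Fin (m k)) → ℂ := fun i => ∫ z, f z * (Y i.1 i.2 z : ℂ) ∂(σ N) with hc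
  have hinner : ∀ i, inner ℂ (T (y i)) (hf.toLp f) = c i := by
    intro i
    rw [L2.inner_def]
    refine integral_congr_ae ?_
    filter_upwards [ContinuousMap.coeFn_toLp (σ N) (𝕜 := ℂ) (p := 2) (y i),
      hf.coeFn_toLp] with z h1 h2
    rw [h1, h2]
    simp [hy, harmonicC]
  refine ⟨fun k => ∑ j, ENNReal.ofReal (‖c ⟨k, j⟩‖ ^ 2), fun K => ?_, fun a K => ?_⟩
  · have h := horth.sum_inner_products_le (s := (Finset.range K).sigma fun _ => Finset.univ)
      (hf.toLp f)
    simp only [hinner] at h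
    rw [Finset.sum_sigma, Lp.norm_toLp] at h
    rw [← eLpNorm_two_sq]
    have h2 : ∀ k, ∑ j, ENNReal.ofReal (‖c ⟨k, j⟩‖ ^ 2)
        = ENNReal.ofReal (∑ j, ‖c ⟨k, j⟩‖ ^ 2) := fun k =>
      (ENNReal.ofReal_sum_of_nonneg fun j _ => by positivity).symm
    simp_rw [h2]
    rw [← ENNReal.ofReal_sum_of_nonneg fun k _ => Finset.sum_nonneg fun j _ => by positivity]
    refine (ENNReal.ofReal_le_ofReal h).trans_eq ?_
    rw [ENNReal.ofReal_pow ENNReal.toReal_nonneg, ENNReal.ofReal_toReal hf.2.ne]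
  · set s : Finset (Σ k, Fin (m k)) := (Finset.range K).sigma fun _ => Finset.univ with hs
    set l : (Σ k, Fin (m k)) → ℂ := fun i => a i.1 * c i with hl
    set g : C(Sph N, ℂ) := ∑ i ∈ s, l i • y i with hg
    have hgx : ∀ x, ∑ k ∈ Finset.range K, (a k : ℂ) * component N k f x = g x := by
      intro x
      rw [hg, hs, Finset.sum_sigma, ContinuousMap.sum_apply]
      refine Finset.sum_congr rfl fun k _ => ?_
      rw [component_eq (hY k) hf, Finset.mul_sum, ContinuousMap.sum_apply]
      refine Finset.sum_congr rfl fun j _ => ?_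
      simp [hl, hc, hy, harmonicC]
      ring
    have hTg : T g = ∑ i ∈ s, l i • T (y i) := by
      rw [hg, map_sum]
      simp
    have hnorm : ‖T g‖ ^ 2 = ∑ i ∈ s, ‖l i‖ ^ 2 := by
      have h1 : inner ℂ (T g) (T g) = ∑ i ∈ s, (starRingEnd ℂ) (l i) * l i := by
        rw [hTg]
        exact horth.inner_sum l l s
      have h2 : ∀ i, (starRingEnd ℂ) (l i) * l i = ((‖l i‖ ^ 2 : ℝ) : ℂ) := fun i => by
        rw [mul_comm, Complex.mul_conj, Complex.normSq_eq_norm_sq]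
      simp_rw [h2] at h1
      rw [← Complex.ofReal_sum] at h1
      rw [← inner_self_eq_norm_sq (𝕜 := ℂ), h1]
      exact Complex.ofReal_re _
    simp_rw [hgx]
    have hTe : ENNReal.ofReal (‖T g‖ ^ 2) = ∫⁻ x, ‖g x‖ₑ ^ 2 ∂(σ N) := by
      rw [Lp.norm_def, ENNReal.ofReal_pow ENNReal.toReal_nonneg,
        ENNReal.ofReal_toReal (Lp.eLpNorm_ne_top _), eLpNorm_two_sq]
      refine lintegral_congr_ae ?_
      filter_upwards [ContinuousMap.coeFn_toLp (σ N) (𝕜 := ℂ) (p := 2) g] with x hx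
      rw [hx]
    rw [← hTe, hnorm, hs, Finset.sum_sigma,
      ENNReal.ofReal_sum_of_nonneg fun k _ => Finset.sum_nonneg fun j _ => by positivity]
    refine Finset.sum_congr rfl fun k _ => ?_
    rw [ENNReal.ofReal_sum_of_nonneg fun j _ => by positivity, Finset.mul_sum]
    refine Finset.sum_congr rfl fun j _ => ?_
    rw [← ENNReal.ofReal_mul (sq_nonneg _), hl]
    congr 1
    simp [mul_pow]

/-- Tonelli's theorem and orthogonality separate the variables: the `u`-integral for each `k` is
bounded uniformly in `k`, and Bessel's inequality sums the energies. -/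
theorem exists_lintegral_squareFn_le {N : ℕ} (hN : 1 ≤ N) {β : ℝ} (hβ : -1 / 2 < β) :
    ∃ C : ℝ≥0, ∀ f : Sph N → ℂ, MemLp f 2 (σ N) →
      ∫⁻ x, squareFn N β f x ∂(σ N) ≤ C * ∫⁻ x, ‖f x‖ₑ ^ 2 ∂(σ N) := by
  obtain ⟨C, hC⟩ := exists_lintegral_diffMult_sq_le hN hβ
  refine ⟨C, fun f hf => ?_⟩
  obtain ⟨E, hE1, hE2⟩ := exists_energy hN hf
  have hm := measurable_diffMean N β f
  have hm' : Measurable fun p : Sph N × ℝ =>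
      ‖diffMean N β f p.2 p.1‖ₑ ^ 2 * ENNReal.ofReal (1 / p.2) :=
    ((hm.comp measurable_swap).enorm.pow_const 2).mul (by fun_prop)
  have hdm : ∀ k, Measurable fun u => ENNReal.ofReal (diffMult N β k u ^ 2 / u) := fun k =>
    (((measurable_diffMult N β k).pow_const 2).div measurable_id).ennreal_ofReal
  calc ∫⁻ x, squareFn N β f x ∂(σ N)
      = ∫⁻ u in Set.Ioi (0 : ℝ), ∫⁻ x, ‖diffMean N β f u x‖ₑ ^ 2
          * ENNReal.ofReal (1 / u) ∂(σ N) := by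
        unfold squareFn
        exact lintegral_lintegral_swap hm'.aemeasurable
    _ ≤ ∫⁻ u in Set.Ioi (0 : ℝ), ∑' k, ENNReal.ofReal (diffMult N β k u ^ 2 / u) * E k := by
        refine setLIntegral_mono' measurableSet_Ioi fun u hu => ?_
        have hu' : (0 : ℝ) < u := hu
        rw [lintegral_mul_const' _ _ ENNReal.ofReal_ne_top]
        unfold diffMean
        rw [hE2 (fun k => diffMult N β k u), Finset.sum_mul]
        refine le_trans (Finset.sum_le_sum fun k _ => ?_) (ENNReal.sum_le_tsum _)
        · rw [mul_right_comm, ← ENNReal.ofReal_mul (sq_nonneg _), mul_one_div]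
    _ = ∑' k, (∫⁻ u in Set.Ioi (0 : ℝ), ENNReal.ofReal (diffMult N β k u ^ 2 / u)) * E k := by
        rw [lintegral_tsum fun k => ((hdm k).mul_const _).aemeasurable]
        exact tsum_congr fun k => lintegral_mul_const _ (hdm k)
    _ ≤ ∑' k, C * E k := ENNReal.tsum_le_tsum fun k => mul_le_mul_left (hC k) _
    _ = C * ∑' k, E k := ENNReal.tsum_mul_left
    _ ≤ C * ∫⁻ x, ‖f x‖ₑ ^ 2 ∂(σ N) := by
        gcongr
        exact ENNReal.tsum_le_of_sum_range_le hE1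

theorem measurable_squareFn (N : ℕ) (β : ℝ) (f : Sph N → ℂ) : Measurable (squareFn N β f) := by
  have hm' : Measurable fun p : Sph N × ℝ =>
      ‖diffMean N β f p.2 p.1‖ₑ ^ 2 * ENNReal.ofReal (1 / p.2) :=
    (((measurable_diffMean N β f).comp measurable_swap).enorm.pow_const 2).mul (by fun_prop)
  exact hm'.lintegral_prod_right'

theorem add_sq_le_two_mul (a b : ℝ≥0∞) : (a + b) ^ 2 ≤ 2 * (a ^ 2 + b ^ 2) := by
  have h := ENNReal.rpow_add_le_mul_rpow_add_rpow a b (one_le_two (α := ℝ))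
  norm_num at h
  exact h

theorem rieszMaximal_le {N : ℕ} (hN : 1 ≤ N) {β : ℝ} (hβ : -1 / 2 < β) {f : Sph N → ℂ}
    (hf : MemLp f 2 (σ N)) (x : Sph N) :
    rieszMaximal N (2 * β + 1) f x ≤ zonalMax (fun y => ‖f y‖ₑ) x
      + ENNReal.ofReal ((symmBeta β)⁻¹ * √((2 * β + 1)⁻¹)) * squareFn N β f x ^ (1 / 2 : ℝ) := by
  refine iSup_le fun t => iSup_le fun ht => ?_
  -- The integral representation needs `t > 0`; at `t = 0` the Riesz mean is an empty sum.
  rcases ht.eq_or_lt with rfl | ht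
  · have : (finite_eigenvalue_lt N 0).toFinset = ∅ := by
      refine Finset.eq_empty_of_forall_notMem fun k hk => ?_
      have : eigenvalue N k < 0 := by simpa using hk
      exact absurd (eigenvalue_nonneg hN k) this.not_ge
    simp [rieszMean, this]
  · exact enorm_rieszMean_le hN hβ hf ht x

/-- The maximal operator of the Riesz means of positive order is bounded on `L_2`. -/
theorem exists_lintegral_rieszMaximal_sq_le {N : ℕ} (hN : 1 ≤ N) {α : ℝ} (hα : 0 < α) :
    ∃ C : ℝ≥0, ∀ f : Sph N → ℂ, MemLp f 2 (σ N) →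
      ∫⁻ x, rieszMaximal N α f x ^ 2 ∂(σ N) ≤ C * ∫⁻ x, ‖f x‖ₑ ^ 2 ∂(σ N) := by
  -- With this choice `2 β + 1 = α`, and `α > 0` is exactly `β > -1/2`.
  set β := (α - 1) / 2 with hβdef
  have hβ : -1 / 2 < β := by rw [hβdef]; linarith
  have hαβ : α = 2 * β + 1 := by rw [hβdef]; ring
  obtain ⟨C₁, h₁⟩ := exists_lintegral_zonalMax_sq_le hN
  obtain ⟨C₂, h₂⟩ := exists_lintegral_squareFn_le hN hβ
  set κ : ℝ≥0 := Real.toNNReal ((symmBeta β)⁻¹ * √((2 * β + 1)⁻¹)) with hκ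
  refine ⟨2 * (C₁ + κ ^ 2 * C₂), fun f hf => ?_⟩
  have hV := measurable_zonalMax hN (hf.1.enorm : AEMeasurable (fun y => ‖f y‖ₑ) (σ N))
  have hS := measurable_squareFn N β f
  have hpt : ∀ x, rieszMaximal N α f x ^ 2
      ≤ 2 * (zonalMax (fun y => ‖f y‖ₑ) x ^ 2 + κ ^ 2 * squareFn N β f x) := by
    intro x
    rw [hαβ]
    refine (pow_le_pow_left' (rieszMaximal_le hN hβ hf x) 2).trans
      ((add_sq_le_two_mul _ _).trans_eq ?_)
    rw [mul_pow, ← ENNReal.rpow_natCast (squareFn N β f x ^ (1 / 2 : ℝ)), ← ENNReal.rpow_mul]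
    rw [show (1 / 2 : ℝ) * ((2 : ℕ) : ℝ) = 1 by norm_num, ENNReal.rpow_one]
    rfl
  refine (lintegral_mono hpt).trans ?_
  rw [lintegral_const_mul' _ _ (by simp), lintegral_add_left (hV.pow_const 2),
    lintegral_const_mul' _ _ (by simp)]
  push_cast
  rw [mul_assoc 2, add_mul, mul_assoc (_ ^ 2)]
  gcongr
  · exact h₁ _ hf.1.enorm
  · exact h₂ f hf

/-! ### A dense class with convergent Riesz means. -/

theorem _root_.Continuous.memLp_sph {N : ℕ} {f : Sph N → ℂ} (hf : Continuous f) :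
    MemLp f 2 (σ N) :=
  (BoundedContinuousFunction.mkOfCompact ⟨f, hf⟩).memLp_top.mono_exponent le_top

theorem component_add {N : ℕ} (hN : 1 ≤ N) (k : ℕ) {f g : Sph N → ℂ} (hf : MemLp f 2 (σ N))
    (hg : MemLp g 2 (σ N)) (x : Sph N) :
    component N k (fun y => f y + g y) x = component N k f x + component N k g x := by
  obtain ⟨m, Y, hY⟩ := exists_harmonicBasis hN k
  have hfg : MemLp (fun y => f y + g y) 2 (σ N) := hf.add hg
  rw [component_eq hY hf, component_eq hY hg, component_eq hY hfg,
    ← Finset.sum_add_distrib]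
  refine Finset.sum_congr rfl fun j _ => ?_
  rw [← mul_add, ← integral_add (integrable_mul_of_mem_harmonics (hY.mem j) hf)
    (integrable_mul_of_mem_harmonics (hY.mem j) hg)]
  simp only [add_mul]

theorem component_const_mul {N : ℕ} (hN : 1 ≤ N) (k : ℕ) (c : ℂ) {f : Sph N → ℂ}
    (hf : MemLp f 2 (σ N)) (x : Sph N) :
    component N k (fun y => c * f y) x = c * component N k f x := by
  obtain ⟨m, Y, hY⟩ := exists_harmonicBasis hN k
  rw [component_eq hY hf, component_eq hY (hf.const_mul c), Finset.mul_sum]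
  refine Finset.sum_congr rfl fun j _ => ?_
  simp only [mul_assoc, integral_const_mul]
  ring

theorem component_harmonic {N : ℕ} (hN : 1 ≤ N) {j : ℕ} {u : Sph N → ℝ}
    (hu : u ∈ harmonics N j) (k : ℕ) (x : Sph N) :
    component N k (fun y => (u y : ℂ)) x = if k = j then (u x : ℂ) else 0 := by
  obtain ⟨m, Y, hY⟩ := exists_harmonicBasis hN k
  have hc : Continuous fun y => (u y : ℂ) :=
    Complex.continuous_ofReal.comp (continuous_of_mem_harmonics hu)
  rw [component_eq hY hc.memLp_sph]
  have e : ∀ i, ∫ y, (u y : ℂ) * (Y i y : ℂ) ∂(σ N) = ((∫ y, u y * Y i y ∂(σ N) : ℝ) : ℂ) := by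
    intro i
    rw [← integral_complex_ofReal]
    simp
  simp_rw [e]
  split_ifs with h
  · subst h
    rw [hY.expand hu x]
    push_cast
    exact Finset.sum_congr rfl fun i _ => mul_comm _ _
  · refine Finset.sum_eq_zero fun i _ => ?_
    rw [integral_mul_eq_zero_of_mem_harmonics hN (Ne.symm h) hu (hY.mem i)]
    simp

theorem rieszMean_add {N : ℕ} (hN : 1 ≤ N) (α t : ℝ) {f g : Sph N → ℂ} (hf : MemLp f 2 (σ N))
    (hg : MemLp g 2 (σ N)) (x : Sph N) :
    rieszMean N α t (fun y => f y + g y) x = rieszMean N α t f x + rieszMean N α t g x := by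
  simp only [rieszMean, component_add hN _ hf hg, mul_add, Finset.sum_add_distrib]

theorem rieszMean_const_mul {N : ℕ} (hN : 1 ≤ N) (α t : ℝ) (c : ℂ) {f : Sph N → ℂ}
    (hf : MemLp f 2 (σ N)) (x : Sph N) :
    rieszMean N α t (fun y => c * f y) x = c * rieszMean N α t f x := by
  simp only [rieszMean, component_const_mul hN _ c hf, Finset.mul_sum]
  exact Finset.sum_congr rfl fun k _ => by ring

theorem tendsto_rieszMean_harmonic {N : ℕ} (hN : 1 ≤ N) (α : ℝ) {j : ℕ} {u : Sph N → ℝ}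
    (hu : u ∈ harmonics N j) (x : Sph N) :
    Tendsto (fun t => rieszMean N α t (fun y => (u y : ℂ)) x) atTop (𝓝 (u x : ℂ)) := by
  have h1 : Tendsto (fun t : ℝ => (((1 - eigenvalue N j / t) ^ α : ℝ) : ℂ) * (u x : ℂ)) atTop
      (𝓝 (u x : ℂ)) := by
    have h2 : Tendsto (fun t : ℝ => 1 - eigenvalue N j / t) atTop (𝓝 1) := by
      simpa [div_eq_mul_inv] using (tendsto_const_nhds (x := (1 : ℝ))).sub
        ((tendsto_inv_atTop_zero (𝕜 := ℝ)).const_mul (eigenvalue N j))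
    have h3 := h2.rpow_const (p := α) (Or.inl one_ne_zero)
    rw [Real.one_rpow] at h3
    have h4 := ((Complex.continuous_ofReal.tendsto 1).comp h3).mul_const (u x : ℂ)
    simpa using h4
  refine h1.congr' ?_
  filter_upwards [eventually_gt_atTop (eigenvalue N j)] with t ht
  rw [rieszMean, Finset.sum_eq_single j]
  · rw [component_harmonic hN hu, if_pos rfl]
  · intro k _ hk
    rw [component_harmonic hN hu, if_neg hk, mul_zero]
  · intro h
    exact absurd (by simpa using ht) h

/-- The functions in `L_2` whose Riesz means converge to them everywhere. -/
def RieszConvergent (N : ℕ) (α : ℝ) (g : Sph N → ℂ) : Prop :=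
  MemLp g 2 (σ N) ∧ ∀ x, Tendsto (fun t => rieszMean N α t g x) atTop (𝓝 (g x))

theorem RieszConvergent.sum {N : ℕ} (hN : 1 ≤ N) {α : ℝ} {ι : Type*} (s : Finset ι)
    {g : ι → Sph N → ℂ} (hg : ∀ i ∈ s, RieszConvergent N α (g i)) :
    RieszConvergent N α fun x => ∑ i ∈ s, g i x := by
  classical
  induction s using Finset.induction_on with
  | empty =>
    refine ⟨by simp, fun x => ?_⟩
    have h := rieszMean_const_mul hN α (c := 0) (f := fun _ : Sph N => (0 : ℂ))
    simp only [Finset.sum_empty]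
    refine tendsto_const_nhds.congr fun t => ?_
    have := h t MemLp.zero x
    simpa using this.symm
  | insert i s hi ih =>
    have h1 := hg i (Finset.mem_insert_self i s)
    have h2 := ih fun j hj => hg j (Finset.mem_insert_of_mem hj)
    simp only [Finset.sum_insert hi]
    refine ⟨h1.1.add h2.1, fun x => ?_⟩
    simp only [rieszMean_add hN α _ h1.1 h2.1 x]
    exact (h1.2 x).add (h2.2 x)

/-- A zonal average is a finite combination of harmonics, and on a single harmonic the Riesz mean is
multiplication by a factor tending to `1`. -/
theorem rieszConvergent_zonalAvg {N : ℕ} (hN : 1 ≤ N) (α : ℝ) {φ : Sph N → ℂ}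
    (hφ : MemLp φ 2 (σ N)) (n : ℕ) : RieszConvergent N α (zonalAvg n φ) := by
  choose m Y hY using exists_harmonicBasis hN
  have e : zonalAvg n φ = fun x => ∑ k ∈ Finset.range (n + 1), ∑ j,
      ((zonalMult N n k : ℂ) * ∫ y, φ y * (Y k j y : ℂ) ∂(σ N)) * (Y k j x : ℂ) := by
    funext x
    rw [zonalAvg_eq_sum_component hN hφ]
    refine Finset.sum_congr rfl fun k _ => ?_
    rw [component_eq (hY k) hφ, Finset.mul_sum]
    exact Finset.sum_congr rfl fun j _ => by ring
  rw [e]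
  refine RieszConvergent.sum hN _ fun k _ => RieszConvergent.sum hN _ fun j _ => ?_
  have hc : Continuous fun y => (Y k j y : ℂ) :=
    Complex.continuous_ofReal.comp (continuous_of_mem_harmonics ((hY k).mem j))
  refine ⟨hc.memLp_sph.const_mul _, fun x => ?_⟩
  simp only [rieszMean_const_mul hN α _ _ hc.memLp_sph x]
  exact (tendsto_rieszMean_harmonic hN α ((hY k).mem j) x).const_mul _

theorem zonalMax_le_of_le {N : ℕ} {F : Sph N → ℝ≥0∞} {s : ℝ≥0∞} (h : ∀ y, F y ≤ s) (x : Sph N) :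
    zonalMax F x ≤ s := by
  have h1 := zonalMax_add_const_le (F := F) (G := fun _ => 0) (s := s) (by simpa using h) x
  simpa [zonalMax] using h1

/-- Dominated convergence: the averages converge pointwise and are bounded by the supremum of `|φ|`.
-/
theorem tendsto_lintegral_zonalAvg_sub {N : ℕ} (hN : 1 ≤ N) {φ : Sph N → ℂ}
    (hφ : Continuous φ) :
    Tendsto (fun n => ∫⁻ x, ‖φ x - zonalAvg n φ x‖ₑ ^ 2 ∂(σ N)) atTop (𝓝 0) := by
  obtain ⟨M, hM⟩ := (isCompact_range hφ).isBounded.exists_norm_le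
  have hM' : ∀ y, ‖φ y‖ₑ ≤ ENNReal.ofReal M := fun y => by
    rw [← ofReal_norm]
    exact ENNReal.ofReal_le_ofReal (hM _ ⟨y, rfl⟩)
  have hcont : ∀ n, Continuous (zonalAvg n φ) := by
    intro n
    have e : zonalAvg n φ = fun x => ∑ k ∈ Finset.range (n + 1),
        (zonalMult N n k : ℂ) * component N k φ x :=
      funext fun x => zonalAvg_eq_sum_component hN hφ.memLp_sph n x
    rw [e]
    exact continuous_finsetSum _ fun k _ => continuous_const.mul (continuous_component N k φ)
  have h := tendsto_lintegral_of_dominated_convergence (μ := σ N)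
    (F := fun n x => ‖φ x - zonalAvg n φ x‖ₑ ^ 2) (f := fun _ => 0)
    (fun _ => (ENNReal.ofReal M + ENNReal.ofReal M) ^ 2)
    (fun n => ((hφ.sub (hcont n)).enorm.measurable.pow_const 2)) (fun n => .of_forall fun x => ?_)
    ?_ (.of_forall fun x => ?_)
  · simpa using h
  · refine pow_le_pow_left' ((enorm_sub_le).trans (add_le_add (hM' x) ?_)) 2
    exact (enorm_zonalAvg_le n φ x).trans (zonalMax_le_of_le hM' x)
  · rw [lintegral_const]
    finiteness
  · have h1 : Tendsto (fun n => φ x - zonalAvg n φ x) atTop (𝓝 0) := by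
      simpa using (tendsto_const_nhds (x := φ x)).sub (tendsto_zonalAvg hφ x)
    have h2 := ENNReal.Tendsto.pow (n := 2) h1.enorm
    simpa using h2

theorem exists_rieszConvergent_approx {N : ℕ} (hN : 1 ≤ N) (α : ℝ) {f : Sph N → ℂ}
    (hf : MemLp f 2 (σ N)) {ε : ℝ≥0∞} (hε : ε ≠ 0) :
    ∃ g, RieszConvergent N α g ∧ ∫⁻ x, ‖f x - g x‖ₑ ^ 2 ∂(σ N) ≤ 2 * (ε ^ 2 + ε) := by
  obtain ⟨φ, hφ, hφ2⟩ := hf.exists_boundedContinuous_eLpNorm_sub_le (by simp) hε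
  obtain ⟨n, hn⟩ := ((tendsto_lintegral_zonalAvg_sub hN φ.continuous).eventually
    (gt_mem_nhds (pos_iff_ne_zero.mpr hε))).exists
  have hg := rieszConvergent_zonalAvg hN α hφ2 n
  refine ⟨zonalAvg n φ, hg, ?_⟩
  have h1 : ∫⁻ x, ‖f x - φ x‖ₑ ^ 2 ∂(σ N) ≤ ε ^ 2 := by
    have h := eLpNorm_two_sq (f - (φ : Sph N → ℂ)) (σ N)
    simp only [Pi.sub_apply] at h
    rw [← h]
    exact pow_le_pow_left' hφ 2
  calc ∫⁻ x, ‖f x - zonalAvg n φ x‖ₑ ^ 2 ∂(σ N)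
      ≤ ∫⁻ x, 2 * (‖f x - φ x‖ₑ ^ 2 + ‖φ x - zonalAvg n φ x‖ₑ ^ 2) ∂(σ N) := by
        refine lintegral_mono fun x => ?_
        refine le_trans (pow_le_pow_left' ?_ 2) (add_sq_le_two_mul _ _)
        rw [← sub_add_sub_cancel (f x) (φ x) (zonalAvg n φ x)]
        exact enorm_add_le _ _
    _ = 2 * (∫⁻ x, ‖f x - φ x‖ₑ ^ 2 ∂(σ N) + ∫⁻ x, ‖φ x - zonalAvg n φ x‖ₑ ^ 2 ∂(σ N)) := by
        rw [lintegral_const_mul' _ _ (by simp), lintegral_add_left']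
        exact (hf.1.sub hφ2.1).enorm.pow_const 2
    _ ≤ 2 * (ε ^ 2 + ε) := by gcongr

/-! ### Almost everywhere convergence. -/

theorem edist_rieszMean_le {N : ℕ} (hN : 1 ≤ N) {α : ℝ} {f g : Sph N → ℂ}
    (hf : MemLp f 2 (σ N)) (hg : MemLp g 2 (σ N)) {t : ℝ} (ht : 0 ≤ t) (x : Sph N) :
    edist (rieszMean N α t f x) (f x) ≤ rieszMaximal N α (fun y => f y - g y) x
      + ‖f x - g x‖ₑ + edist (rieszMean N α t g x) (g x) := by
  have h1 := rieszMean_add hN α t (hf.sub hg) hg x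
  simp only [Pi.sub_apply, sub_add_cancel] at h1
  have h2 : ‖rieszMean N α t (fun y => f y - g y) x‖ₑ
      ≤ rieszMaximal N α (fun y => f y - g y) x :=
    le_iSup₂ (f := fun t (_ : 0 ≤ t) => ‖rieszMean N α t (fun y => f y - g y) x‖ₑ) t ht
  rw [edist_eq_enorm_sub, edist_eq_enorm_sub]
  have e : rieszMean N α t f x - f x = rieszMean N α t (fun y => f y - g y) x
      + (g x - f x) + (rieszMean N α t g x - g x) := by
    have h1' : rieszMean N α t f x = rieszMean N α t (fun y => f y - g y) x
      + rieszMean N α t g x := h1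
    rw [h1']
    ring
  rw [e]
  refine (enorm_add_le _ _).trans (add_le_add_left ((enorm_add_le _ _).trans ?_) _)
  rw [← enorm_neg (g x - f x), neg_sub]
  exact add_le_add_left h2 _

/-- For an approximant `g j` in the dense class, the asymptotic deviation of the means from `f x` is
at most `H j x`. The maximal inequality makes `H j` tend to `0` in `L_2`, so the infimum over `j`
vanishes almost everywhere. -/
theorem ae_tendsto_rieszMean {N : ℕ} (hN : 1 ≤ N) {α : ℝ} (hα : 0 < α) {f : Sph N → ℂ}
    (hf : MemLp f 2 (σ N)) :
    ∀ᵐ x ∂(σ N), Tendsto (fun t => rieszMean N α t f x) atTop (𝓝 (f x)) := by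
  obtain ⟨C, hC⟩ := exists_lintegral_rieszMaximal_sq_le hN hα
  have hpos : ∀ j : ℕ, ((j : ℝ≥0∞) + 1)⁻¹ ≠ 0 := fun j => by simp
  choose g hg hfg using fun j : ℕ => exists_rieszConvergent_approx hN α hf (hpos j)
  set H : ℕ → Sph N → ℝ≥0∞ := fun j x =>
    rieszMaximal N α (fun y => f y - g j y) x + ‖f x - g j x‖ₑ with hH
  have hHm : ∀ j, AEMeasurable (H j) (σ N) := fun j =>
    (measurable_rieszMaximal N α _).aemeasurable.add (hf.1.sub (hg j).1.1).enorm
  have hHint : ∀ j : ℕ, ∫⁻ x, H j x ^ 2 ∂(σ N)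
      ≤ 2 * (C + 1) * (2 * ((((j : ℝ≥0∞) + 1)⁻¹) ^ 2 + ((j : ℝ≥0∞) + 1)⁻¹)) := by
    intro j
    calc ∫⁻ x, H j x ^ 2 ∂(σ N)
        ≤ ∫⁻ x, 2 * (rieszMaximal N α (fun y => f y - g j y) x ^ 2 + ‖f x - g j x‖ₑ ^ 2)
            ∂(σ N) := lintegral_mono fun x => add_sq_le_two_mul _ _
      _ = 2 * (∫⁻ x, rieszMaximal N α (fun y => f y - g j y) x ^ 2 ∂(σ N)
            + ∫⁻ x, ‖f x - g j x‖ₑ ^ 2 ∂(σ N)) := by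
          rw [lintegral_const_mul' _ _ (by simp),
            lintegral_add_left ((measurable_rieszMaximal N α _).pow_const 2)]
      _ ≤ 2 * (C * ∫⁻ x, ‖f x - g j x‖ₑ ^ 2 ∂(σ N) + ∫⁻ x, ‖f x - g j x‖ₑ ^ 2 ∂(σ N)) := by
          gcongr
          exact hC _ (hf.sub (hg j).1)
      _ = 2 * (C + 1) * ∫⁻ x, ‖f x - g j x‖ₑ ^ 2 ∂(σ N) := by ring
      _ ≤ _ := by gcongr; exact hfg j
  have hlim : Tendsto (fun j : ℕ => 2 * ((C : ℝ≥0∞) + 1)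
      * (2 * ((((j : ℝ≥0∞) + 1)⁻¹) ^ 2 + ((j : ℝ≥0∞) + 1)⁻¹))) atTop (𝓝 0) := by
    have h1 : Tendsto (fun j : ℕ => ((j : ℝ≥0∞) + 1)⁻¹) atTop (𝓝 0) := by
      have := (tendsto_add_atTop_iff_nat 1).mpr ENNReal.tendsto_inv_nat_nhds_zero
      simpa using this
    have h2 := ENNReal.Tendsto.const_mul (a := 2) ((ENNReal.Tendsto.pow (n := 2) h1).add h1) (Or.inr (by simp))
    have h3 := ENNReal.Tendsto.const_mul (a := 2 * ((C : ℝ≥0∞) + 1)) h2 (Or.inr (by finiteness))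
    simpa using h3
  have hinf : ∫⁻ x, (⨅ j, H j x) ^ 2 ∂(σ N) = 0 := by
    refine le_antisymm (ge_of_tendsto' hlim fun j => le_trans ?_ (hHint j)) zero_le
    exact lintegral_mono fun x => pow_le_pow_left' (iInf_le _ j) 2
  rw [lintegral_eq_zero_iff' ((AEMeasurable.iInf hHm).pow_const 2)] at hinf
  filter_upwards [hinf] with x hx
  have hx0 : ⨅ j, H j x = 0 := by simpa using hx
  rw [tendsto_iff_edist_tendsto_0, ENNReal.tendsto_nhds_zero]
  intro ε hε
  have hε2 : 0 < ε / 2 := ENNReal.half_pos hε.ne'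
  obtain ⟨j, hj⟩ := iInf_lt_iff.mp (hx0.trans_lt hε2)
  have h1 := ENNReal.tendsto_nhds_zero.mp (tendsto_iff_edist_tendsto_0.mp ((hg j).2 x)) _ hε2
  filter_upwards [h1, eventually_ge_atTop 0] with t ht ht0
  refine (edist_rieszMean_le hN hf (hg j).1 ht0 x).trans ?_
  exact (add_le_add hj.le ht).trans_eq (ENNReal.add_halves ε)

theorem tendsto_eigenvalue {N : ℕ} (hN : 1 ≤ N) : Tendsto (eigenvalue N) atTop atTop :=
  tendsto_atTop_mono (natCast_le_eigenvalue hN) tendsto_natCast_atTop_atTop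

end FourierLaplace

end

theorem mainTheorem2 (N : ℕ) (hN : 1 ≤ N) (α : ℝ) (hα : 0 < α) :
    (∃ c : ℝ≥0, ∀ f : FourierLaplace.Sph N → ℂ, MemLp f 2 (FourierLaplace.σ N) →
      Measurable (FourierLaplace.rieszMaximal N α f) ∧
      eLpNorm (FourierLaplace.rieszMaximal N α f) 2 (FourierLaplace.σ N)
        ≤ c * eLpNorm f 2 (FourierLaplace.σ N)) ∧
    (∀ f : FourierLaplace.Sph N → ℂ, MemLp f 2 (FourierLaplace.σ N) →
      ∀ᵐ x ∂(FourierLaplace.σ N),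
        Tendsto (fun t : ℝ => FourierLaplace.rieszMean N α t f x) atTop (𝓝 (f x)) ∧
        Tendsto (fun n : ℕ => FourierLaplace.rieszMeanNat N α n f x) atTop (𝓝 (f x))) := by
  refine ⟨?_, fun f hf => ?_⟩
  · obtain ⟨C, hC⟩ := FourierLaplace.exists_lintegral_rieszMaximal_sq_le hN hα
    -- The estimate is proved for squared norms, hence the square root of its constant.
    refine ⟨NNReal.sqrt C, fun f hf => ⟨FourierLaplace.measurable_rieszMaximal N α f, ?_⟩⟩
    rw [← ENNReal.pow_le_pow_left_iff two_ne_zero, mul_pow, FourierLaplace.eLpNorm_two_sq,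
      FourierLaplace.eLpNorm_two_sq, ← ENNReal.coe_pow, NNReal.sq_sqrt]
    exact hC f hf
  · filter_upwards [FourierLaplace.ae_tendsto_rieszMean hN hα hf] with x hx
    -- The integer-indexed means are the means at `t = λ_n → ∞`, so the same exceptional null set
    -- serves both limits.
    refine ⟨hx, (hx.comp (FourierLaplace.tendsto_eigenvalue hN)).congr' ?_⟩
    filter_upwards [eventually_ge_atTop 1] with n hn
    exact (FourierLaplace.rieszMeanNat_eq hN hα hn f x).symm
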